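/- **Setting.** Let $G=(V,E)$ be a finite directed or undirected graph (loops and parallel edges allowed) with $|V|=N$ nodes and $|E|=M\ge 1$ edges, a start node $s$ and an end node $t$ such that at least one $s$–$t$ path exists, and let $\hat c\in\mathbb{R}^E$, $\hat c\ge 0$, and $d\in\mathbb{R}^E$, $d>0$, be given. Let $\mathcal{P}$ be the set of simple paths from $s$ to $t$, and write $c(P)=\sum_{e\in P}c_e$ for $c\in\mathbb{R}^E$, $P\in\mathcal{P}$. The generalized Manhattan norm is $\|c\|=\sum_{e\in E}|c_e|/d_e$, its unit ball is $B=\{c:\|c\|\le 1\}$, and for $\lambda\ge 0$ the uncertainty set is $\mathcal{U}_\lambda=\{\hat c\}+\lambda B$. A path is optimal for $\mathsf{P}(\lambda)$ if it attains $\min_{P\in\mathcal{P}}\max_{c\in\mathcal{U}_\lambda}c(P)$. The variable-sized robust shortest path problem asks for a set $\mathcal{S}\subseteq\mathcal{P}$ of smallest cardinality such that for every $\lambda\ge 0$ it contains a path that is optimal for $\mathsf{P}(\lambda)$. With $F(P)=(\hat c(P),\max_{c\in B}c(P))$ and $\mathcal{V}=\operatorname{conv}\{F(P):P\in\mathcal{P}\}+\mathbb{R}^2_+$,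 a path $P\in\mathcal{P}$ is called efficient extreme if $F(P)$ is a vertex of $\mathcal{V}$, and two paths $P\ne P'$ are equivalent if $F(P)=F(P')$. **Theorem.** (a) There are one algorithm (a program of a random access machine with exact real arithmetic and unit cost per operation) and one constant $C$ such that for every such instance the algorithm outputs a solution $\mathcal{S}$ of the variable-sized robust shortest path problem with the generalized Manhattan norm, listing every path of $\mathcal{S}$ explicitly, in at most $C\,(M^2+NM\log N)$ steps, and $|\mathcal{S}|\le M$. (b) For every finite directed or undirected graph with $M\ge 1$ edges and data $s,t,\hat c\ge 0,d>0$ as above (whether or not an $s$–$t$ path exists), every maximal set of pairwise non-equivalent efficient extreme paths has at most as many elements as there are distinct values $d_e$, $e\in E$. -/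

import Mathlib

open scoped Pointwise

namespace RobustSP

noncomputable section

/-! ## The machine model: a random access machine with exact real arithmetic, at unit cost -/

/-- The memory consists of integer arrays and real arrays, each addressed by an array number
(a literal in the program) and an index (computed at run time). -/
structure Memory where
  int : ℕ → ℕ → ℕ
  real : ℕ → ℕ → ℝ

/-- Integer expressions: literals, array cells (so indirect addressing is possible), addition
and truncated subtraction. -/
inductive NatExp : Type
  | lit (k : ℕ)
  | cell (a : ℕ) (i : NatExp)
  | add (x y : NatExp)
  | sub (x y : NatExp)

def NatExp.eval (m : Memory) : NatExp → ℕ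
  | .lit k => k
  | .cell a i => m.int a (i.eval m)
  | .add x y => x.eval m + y.eval m
  | .sub x y => x.eval m - y.eval m

/-- Real expressions: literals `0, 1, 2, …`, array cells and the four field operations.
There is no conversion between real and integer cells in either direction. -/
inductive RealExp : Type
  | lit (k : ℕ)
  | cell (b : ℕ) (i : NatExp)
  | add (x y : RealExp)
  | sub (x y : RealExp)
  | mul (x y : RealExp)
  | div (x y : RealExp)

def RealExp.eval (m : Memory) : RealExp → ℝ
  | .lit k => (k : ℝ)
  | .cell b i => m.real b (i.eval m)
  | .add x y => x.eval m + y.eval m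
  | .sub x y => x.eval m - y.eval m
  | .mul x y => x.eval m * y.eval m
  | .div x y => x.eval m / y.eval m

/-- Tests: comparisons of integers or of reals, and their Boolean combinations. -/
inductive Test : Type
  | natLt (x y : NatExp)
  | natEq (x y : NatExp)
  | realLt (x y : RealExp)
  | neg (c : Test)
  | conj (c e : Test)

def Test.Holds (m : Memory) : Test → Prop
  | .natLt x y => x.eval m < y.eval m
  | .natEq x y => x.eval m = y.eval m
  | .realLt x y => x.eval m < y.eval m
  | .neg c => ¬ c.Holds m
  | .conj c e => c.Holds m ∧ e.Holds m

/-- Programs are finite pieces of structured code. -/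
inductive Prog : Type
  | skip
  | setNat (a : ℕ) (i : NatExp) (x : NatExp)
  | setReal (b : ℕ) (i : NatExp) (x : RealExp)
  | seq (p q : Prog)
  | cond (c : Test) (p q : Prog)
  | loop (c : Test) (p : Prog)

def Memory.setNat (m : Memory) (a i v : ℕ) : Memory where
  int := Function.update m.int a (Function.update (m.int a) i v)
  real := m.real

def Memory.setReal (m : Memory) (b i : ℕ) (v : ℝ) : Memory where
  int := m.int
  real := Function.update m.real b (Function.update (m.real b) i v)

/-- `Runs p m k m'`: started on the memory `m`, the program `p` halts after `k` steps with
memory `m'`. Every assignment and every evaluation of a test is one step (the expressions in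
a fixed program have bounded size, so each of them stands for boundedly many elementary
operations). `loop c p` repeats `p` while `c` holds. -/
inductive Runs : Prog → Memory → ℕ → Memory → Prop
  | skip (m : Memory) : Runs .skip m 1 m
  | setNat (a : ℕ) (i x : NatExp) (m : Memory) :
      Runs (.setNat a i x) m 1 (m.setNat a (i.eval m) (x.eval m))
  | setReal (b : ℕ) (i : NatExp) (x : RealExp) (m : Memory) :
      Runs (.setReal b i x) m 1 (m.setReal b (i.eval m) (x.eval m))
  | seq {p q : Prog} {m m₁ m₂ : Memory} {k l : ℕ} :
      Runs p m k m₁ → Runs q m₁ l m₂ → Runs (.seq p q) m (k + l) m₂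
  | condTrue {c : Test} {p q : Prog} {m m₁ : Memory} {k : ℕ} :
      c.Holds m → Runs p m k m₁ → Runs (.cond c p q) m (k + 1) m₁
  | condFalse {c : Test} {p q : Prog} {m m₁ : Memory} {k : ℕ} :
      ¬ c.Holds m → Runs q m k m₁ → Runs (.cond c p q) m (k + 1) m₁
  | loopDone {c : Test} {p : Prog} {m : Memory} :
      ¬ c.Holds m → Runs (.loop c p) m 1 m
  | loopStep {c : Test} {p : Prog} {m m₁ m₂ : Memory} {k l : ℕ} :
      c.Holds m → Runs p m k m₁ → Runs (.loop c p) m₁ l m₂ →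
        Runs (.loop c p) m (k + l + 1) m₂

/-- The machine is deterministic: step count and final memory are determined by the start. -/
theorem Runs.unique {p : Prog} {m m₁ m₂ : Memory} {k l : ℕ}
    (h : Runs p m k m₁) (h' : Runs p m l m₂) : k = l ∧ m₁ = m₂ := by
  induction h generalizing l m₂ with
  | skip | setNat | setReal => cases h'; exact ⟨rfl, rfl⟩
  | seq _ _ ih ih2 =>
    cases h' with
    | seq a b =>
      obtain ⟨rfl, rfl⟩ := ih a
      obtain ⟨rfl, rfl⟩ := ih2 b
      exact ⟨rfl, rfl⟩
  | condTrue hc _ ih =>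
    cases h' with
    | condTrue _ a => obtain ⟨rfl, rfl⟩ := ih a; exact ⟨rfl, rfl⟩
    | condFalse hn _ => exact absurd hc hn
  | condFalse hn _ ih =>
    cases h' with
    | condTrue hc _ => exact absurd hc hn
    | condFalse _ a => obtain ⟨rfl, rfl⟩ := ih a; exact ⟨rfl, rfl⟩
  | loopDone hn =>
    cases h' with
    | loopDone _ => exact ⟨rfl, rfl⟩
    | loopStep hc _ _ => exact absurd hc hn
  | loopStep hc _ _ ih ih2 =>
    cases h' with
    | loopDone hn => exact absurd hc hn
    | loopStep _ a b =>
      obtain ⟨rfl, rfl⟩ := ih a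
      obtain ⟨rfl, rfl⟩ := ih2 b
      exact ⟨rfl, rfl⟩

/-! ## The robust shortest path problem -/

/-- A directed or undirected graph with `N` nodes and `M` edges (loops and parallel edges are
allowed), a start node, an end node, the nominal costs `ĉ ≥ 0` and the weights `d > 0` of the
generalized Manhattan norm. -/
structure Instance (N M : ℕ) where
  directed : Bool
  tail : Fin M → Fin N
  head : Fin M → Fin N
  source : Fin N
  target : Fin N
  nominal : Fin M → ℝ
  weight : Fin M → ℝ
  nominal_nonneg : ∀ e, 0 ≤ nominal e
  weight_pos : ∀ e, 0 < weight e

namespace Instance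

variable {N M : ℕ} (G : Instance N M)

/-- The edge `e` can be traversed from `u` to `v`. -/
def Joins (e : Fin M) (u v : Fin N) : Prop :=
  (G.tail e = u ∧ G.head e = v) ∨ (G.directed = false ∧ G.tail e = v ∧ G.head e = u)

/-- `G.Trace u v vs es`: the walk from `u` to `v` with the list `es` of edges visits the nodes
in the list `vs`. -/
inductive Trace : Fin N → Fin N → List (Fin N) → List (Fin M) → Prop
  | nil (v : Fin N) : Trace v v [v] []
  | cons {u w v : Fin N} {e : Fin M} {vs : List (Fin N)} {es : List (Fin M)} :
      G.Joins e u w → Trace w v vs es → Trace u v (u :: vs) (e :: es)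

/-- The feasible set: the (simple) paths from the start node to the end node, each given by
its list of edges. -/
def paths : Set (List (Fin M)) :=
  {P | ∃ vs : List (Fin N), vs.Nodup ∧ G.Trace G.source G.target vs P}

/-- `c(P) = ∑_{e ∈ P} c_e`. -/
def cost (c : Fin M → ℝ) (P : List (Fin M)) : ℝ := ∑ e ∈ P.toFinset, c e

/-- The unit ball of the generalized Manhattan norm `‖c‖ = ∑_e |c_e| / d_e`. -/
def ball : Set (Fin M → ℝ) := {c | ∑ e, |c e| / G.weight e ≤ 1}

/-- The uncertainty set `{ĉ} + lam • B`. -/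
def uncertaintySet (lam : ℝ) : Set (Fin M → ℝ) := {G.nominal} + lam • G.ball

/-- The largest cost of `P` over the scenarios in `U`. -/
def worstCost (U : Set (Fin M → ℝ)) (P : List (Fin M)) : ℝ :=
  sSup ((fun c => cost c P) '' U)

/-- `P` is optimal for the min-max robust problem of size `lam`. -/
def IsOptimal (lam : ℝ) (P : List (Fin M)) : Prop :=
  P ∈ G.paths ∧ ∀ Q ∈ G.paths,
    worstCost (G.uncertaintySet lam) P ≤ worstCost (G.uncertaintySet lam) Q

/-- `S` is a set of paths that contains an optimal one for every size `lam ≥ 0`. -/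
def Covers (S : Finset (List (Fin M))) : Prop :=
  (∀ P ∈ S, P ∈ G.paths) ∧ ∀ lam : ℝ, 0 ≤ lam → ∃ P ∈ S, G.IsOptimal lam P

/-- `S` is a solution of the variable-sized robust problem: a smallest covering set. -/
def IsSolution (S : Finset (List (Fin M))) : Prop :=
  G.Covers S ∧ ∀ S' : Finset (List (Fin M)), G.Covers S' → S.card ≤ S'.card

/-- The two objectives `(ĉ(P), max_{c ∈ B} c(P))`. -/
def objectives (P : List (Fin M)) : ℝ × ℝ := (cost G.nominal P, worstCost G.ball P)

/-- The polyhedron `conv (F(𝒳)) + ℝ²_+`. -/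
def polyhedron : Set (ℝ × ℝ) :=
  convexHull ℝ (G.objectives '' G.paths) + {p : ℝ × ℝ | 0 ≤ p.1 ∧ 0 ≤ p.2}

/-- `P` is an efficient extreme path. -/
def IsEfficientExtreme (P : List (Fin M)) : Prop :=
  P ∈ G.paths ∧ G.objectives P ∈ Set.extremePoints ℝ G.polyhedron

/-- `T` is a maximal set of pairwise non-equivalent efficient extreme paths. -/
def IsMaximalExtremeFamily (T : Finset (List (Fin M))) : Prop :=
  Maximal (fun T' : Finset (List (Fin M)) =>
    (∀ P ∈ T', G.IsEfficientExtreme P) ∧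
      ∀ P ∈ T', ∀ Q ∈ T', P ≠ Q → G.objectives P ≠ G.objectives Q) T

/-! ## Input and output -/

/-- The input: integer array `0` holds `N`, `M`, the start node, the end node and the flag for
directed graphs; integer arrays `1`, `2` hold the ends of the edges; real arrays `0`, `1` hold
`ĉ` and `d`. All other cells are `0`. -/
def input : Memory where
  int a i :=
    match a with
    | 0 => [N, M, (G.source : ℕ), (G.target : ℕ), if G.directed then 1 else 0].getD i 0
    | 1 => if h : i < M then (G.tail ⟨i, h⟩ : ℕ) else 0
    | 2 => if h : i < M then (G.head ⟨i, h⟩ : ℕ) else 0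
    | _ => 0
  real b i :=
    match b with
    | 0 => if h : i < M then G.nominal ⟨i, h⟩ else 0
    | 1 => if h : i < M then G.weight ⟨i, h⟩ else 0
    | _ => 0

end Instance

/-- The family of lists in the output: integer array `3` holds their number (cell `0`), array
`4` the start of each list and array `5` its length; the entries stand consecutively in
array `6`. -/
def Memory.output (m : Memory) : List (List ℕ) :=
  (List.range (m.int 3 0)).map fun k =>
    (List.range (m.int 5 k)).map fun j => m.int 6 (m.int 4 k + j)

/-- The output lists each member of `S` exactly once, as its list of edge numbers. -/
def Memory.Outputs {M : ℕ} (m : Memory) (S : Finset (List (Fin M))) : Prop :=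
  ∃ L : List (List (Fin M)), L.Nodup ∧ L.toFinset = S ∧
    m.output = L.map (fun P => P.map (fun e => (e : ℕ)))

end

end RobustSP

set_option linter.unusedSimpArgs false

namespace RobustSP

namespace Instance

variable {N M : ℕ} (G : Instance N M)

/-! ## Paths -/

/-! Under the generalized Manhattan norm the adversary does best by spending the whole budget on the
heaviest edge of `P`, so the maximum of `c(P)` over the unit ball is the largest weight `d_e` on `P`
(`worstCost_ball`), taken as `0` for the empty path. Hence the worst cost of `P` as a function of
`λ` is a line with intercept `ĉ(P)` and slope `maxWeight P` (`worstCost_uncertaintySet`).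

For (b): the polyhedron is closed under increasing the first coordinate, so two of its extreme
points with the same second coordinate coincide (`snd_injOn_extremePoints`). Pairwise non-equivalent
efficient extreme paths therefore have distinct maximal weights, and these are weights of edges.

For (a): let `val e` be the least nominal cost of a path all of whose edges weigh at most `d_e`.
Taking a cheapest such path for every edge `e` loses nothing, and the lines `val e + λ d_e` decide
which of these paths are needed. If a line is, for some `λ ≥ 0`, strictly below all lines of other
slopes, then (unless start and end node coincide) every covering set must contain a path whose
maximal weight is exactly that slope. One path for each such slope also suffices, so these paths
form a smallest covering set (`isSolution_image_selected`), with at most one path per edge.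

The algorithm finds `val e` and a path for each of the `M` thresholds by Dijkstra's method from the
end node, and then selects the lines in time `O(M²)`. A search must cost only `O(M + N log M)`, so
the queue needs decrease-key in constant amortized time. A hollow heap provides it: decreasing a key
creates a new node, the old one becomes hollow and keeps its two children of largest rank, and the
other children pass to the new node. A weight built from Fibonacci numbers never exceeds the number
of created nodes, which makes the ranks logarithmic; a potential pays for all work on the stack of
roots. Finally `N log M ≤ 2 (M + N log N)` (`mul_log_le`) brings the total to `O(M² + NM log N)`.

The heap is analysed as a family of changes of an array function that preserve `HeapInv`, and
Dijkstra's method as changes that preserve `Search`; neither mentions programs. The lemmas named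
`ends_…` transfer both to the machine, with step counts paid from potentials (`ends_loop`), up to
`ends_main`. -/

theorem Trace.target_mem {u v : Fin N} {vs : List (Fin N)} {es : List (Fin M)}
    (h : G.Trace u v vs es) : v ∈ vs := by
  induction h with
  | nil => simp
  | cons _ _ ih => exact List.mem_cons_of_mem _ ih

theorem Trace.source_mem {u v : Fin N} {vs : List (Fin N)} {es : List (Fin M)}
    (h : G.Trace u v vs es) : u ∈ vs := by
  cases h <;> simp

theorem Trace.ends_mem {u v : Fin N} {vs : List (Fin N)} {es : List (Fin M)}
    (h : G.Trace u v vs es) : ∀ e ∈ es, G.tail e ∈ vs ∧ G.head e ∈ vs := by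
  induction h with
  | nil => simp
  | @cons u w v e vs es hj ht ih =>
    intro e' he'
    rcases List.mem_cons.1 he' with rfl | he'
    · have hw := ht.source_mem
      rcases hj with ⟨rfl, rfl⟩ | ⟨_, rfl, rfl⟩
      · exact ⟨by simp, by simp [hw]⟩
      · exact ⟨by simp [hw], by simp⟩
    · exact ⟨List.mem_cons_of_mem _ (ih e' he').1, List.mem_cons_of_mem _ (ih e' he').2⟩

/-- An edge used again later would make its first end a node of the remaining walk. This turns
`cost`, a sum over a finite set, into a sum over the list that a program can accumulate. -/
theorem Trace.nodup_edges {u v : Fin N} {vs : List (Fin N)} {es : List (Fin M)}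
    (h : G.Trace u v vs es) (hvs : vs.Nodup) : es.Nodup := by
  induction h with
  | nil => simp
  | @cons u w v e vs es hj ht ih =>
    rw [List.nodup_cons] at hvs ⊢
    refine ⟨fun he => hvs.1 ?_, ih hvs.2⟩
    have := Trace.ends_mem G ht e he
    rcases hj with ⟨rfl, rfl⟩ | ⟨_, rfl, rfl⟩
    · exact this.1
    · exact this.2

theorem Trace.length_eq {u v : Fin N} {vs : List (Fin N)} {es : List (Fin M)}
    (h : G.Trace u v vs es) : vs.length = es.length + 1 := by
  induction h with
  | nil => simp
  | cons _ _ ih => simp [ih]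

theorem nodup_of_mem_paths {P : List (Fin M)} (hP : P ∈ G.paths) : P.Nodup := by
  obtain ⟨vs, hvs, ht⟩ := hP
  exact ht.nodup_edges G hvs

theorem cost_eq_sum {P : List (Fin M)} (hP : P ∈ G.paths) (c : Fin M → ℝ) :
    cost c P = (P.map c).sum :=
  List.sum_toFinset _ (G.nodup_of_mem_paths hP)

theorem eq_nil_of_mem_paths {P : List (Fin M)} (hP : P ∈ G.paths) (h : G.source = G.target) :
    P = [] := by
  obtain ⟨vs, hvs, ht⟩ := hP
  rw [h] at ht
  cases ht with
  | nil => rfl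
  | cons _ ht => exact absurd ht.target_mem (List.nodup_cons.1 hvs).1

theorem source_eq_target_of_nil_mem_paths (hP : [] ∈ G.paths) : G.source = G.target := by
  obtain ⟨vs, _, ht⟩ := hP
  generalize hs : G.source = s at ht
  generalize hq : G.target = q at ht
  cases ht
  rfl

/-! ## The worst case over the ball -/

open Classical in
/-- The largest weight on a path, `0` for the empty path. -/
noncomputable def maxWeight (P : List (Fin M)) : ℝ :=
  if h : P.toFinset.Nonempty then P.toFinset.sup' h G.weight else 0

theorem maxWeight_nil : G.maxWeight [] = 0 := by simp [maxWeight]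

theorem weight_le_maxWeight {P : List (Fin M)} {e : Fin M} (he : e ∈ P) :
    G.weight e ≤ G.maxWeight P := by
  have h : e ∈ P.toFinset := List.mem_toFinset.2 he
  rw [maxWeight, dif_pos ⟨e, h⟩]
  exact Finset.le_sup' G.weight h

theorem exists_weight_eq_maxWeight {P : List (Fin M)} (hP : P ≠ []) :
    ∃ e ∈ P, G.maxWeight P = G.weight e := by
  have h : P.toFinset.Nonempty := by
    obtain ⟨e, he⟩ := List.exists_mem_of_ne_nil P hP
    exact ⟨e, List.mem_toFinset.2 he⟩
  obtain ⟨e, he, h'⟩ := Finset.exists_mem_eq_sup' h G.weight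
  exact ⟨e, List.mem_toFinset.1 he, by rw [maxWeight, dif_pos h, h']⟩

theorem maxWeight_nonneg (P : List (Fin M)) : 0 ≤ G.maxWeight P := by
  by_cases hP : P = []
  · rw [hP, maxWeight_nil]
  · obtain ⟨e, _, h⟩ := G.exists_weight_eq_maxWeight hP
    rw [h]
    exact (G.weight_pos e).le

theorem maxWeight_le {P : List (Fin M)} {x : ℝ} (hx : 0 ≤ x) (h : ∀ e ∈ P, G.weight e ≤ x) :
    G.maxWeight P ≤ x := by
  by_cases hP : P = []
  · rwa [hP, maxWeight_nil]
  · obtain ⟨e, he, h'⟩ := G.exists_weight_eq_maxWeight hP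
    rw [h']
    exact h e he

/-- Hölder's inequality: write `b e` as `d_e` times `b e / d_e`, bound `d_e` by its maximum on the
path, and use that the quotients have total absolute value at most `1`. -/
theorem cost_le_maxWeight {b : Fin M → ℝ} (hb : b ∈ G.ball) (P : List (Fin M)) :
    cost b P ≤ G.maxWeight P := by
  have h1 : cost b P ≤ ∑ e ∈ P.toFinset, G.maxWeight P * (|b e| / G.weight e) := by
    refine Finset.sum_le_sum fun e he => ?_
    have hw := G.weight_pos e
    have hm := G.weight_le_maxWeight (List.mem_toFinset.1 he)
    calc b e ≤ |b e| := le_abs_self _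
      _ = G.weight e * (|b e| / G.weight e) := by field_simp
      _ ≤ _ := by gcongr
  refine h1.trans ?_
  rw [← Finset.mul_sum]
  have h2 : ∑ e ∈ P.toFinset, |b e| / G.weight e ≤ 1 :=
    (Finset.sum_le_sum_of_subset_of_nonneg (Finset.subset_univ _)
      fun e _ _ => div_nonneg (abs_nonneg _) (G.weight_pos e).le).trans hb
  exact mul_le_of_le_one_right (G.maxWeight_nonneg P) h2

/-- The bound is attained by `d_e` times the unit vector of a heaviest edge `e` of the path. -/
theorem exists_mem_ball_cost (P : List (Fin M)) : ∃ b ∈ G.ball, cost b P = G.maxWeight P := by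
  by_cases hP : P = []
  · exact ⟨0, by simp [ball], by simp [hP, cost, maxWeight_nil]⟩
  · obtain ⟨e, he, h⟩ := G.exists_weight_eq_maxWeight hP
    have hw := G.weight_pos e
    refine ⟨Pi.single e (G.weight e), ?_, ?_⟩
    · rw [ball, Set.mem_ofPred_eq, Finset.sum_eq_single e]
      · simp [abs_of_pos hw, hw.ne']
      · intro e' _ hne
        simp [Pi.single_eq_of_ne hne]
      · simp
    · rw [cost, Finset.sum_eq_single e]
      · simp [h]
      · intro e' _ hne
        simp [Pi.single_eq_of_ne hne]
      · simp [he]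

theorem worstCost_add_smul_ball (a : Fin M → ℝ) {lam : ℝ} (hl : 0 ≤ lam) (P : List (Fin M)) :
    worstCost ({a} + lam • G.ball) P = cost a P + lam * G.maxWeight P := by
  have key : ∀ b : Fin M → ℝ, cost (a + lam • b) P = cost a P + lam * cost b P := by
    intro b
    simp [cost, Finset.sum_add_distrib, Finset.mul_sum]
  apply IsGreatest.csSup_eq
  constructor
  · obtain ⟨b, hb, h⟩ := G.exists_mem_ball_cost P
    refine ⟨a + lam • b, Set.add_mem_add rfl (Set.smul_mem_smul_set hb), ?_⟩
    simp only [key, h]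
  · rintro _ ⟨c, hc, rfl⟩
    obtain ⟨a', rfl, c', ⟨b, hb, rfl⟩, rfl⟩ := Set.mem_add.1 hc
    simp only [key]
    gcongr
    exact G.cost_le_maxWeight hb P

theorem worstCost_uncertaintySet {lam : ℝ} (hl : 0 ≤ lam) (P : List (Fin M)) :
    worstCost (G.uncertaintySet lam) P = cost G.nominal P + lam * G.maxWeight P :=
  G.worstCost_add_smul_ball _ hl P

theorem worstCost_ball (P : List (Fin M)) : worstCost G.ball P = G.maxWeight P := by
  have h := G.worstCost_add_smul_ball 0 zero_le_one P
  rw [Set.singleton_zero, zero_add, one_smul] at h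
  rw [h]
  simp [cost]

/-! ## Efficient extreme paths -/

/-- Of two points at the same height, the right one is the midpoint of the left one and a point
further to the right, hence not extreme. -/
theorem snd_injOn_extremePoints {p q : ℝ × ℝ} (hp : p ∈ Set.extremePoints ℝ G.polyhedron)
    (hq : q ∈ Set.extremePoints ℝ G.polyhedron) (h : p.2 = q.2) : p = q := by
  have aux : ∀ p q : ℝ × ℝ, p ∈ Set.extremePoints ℝ G.polyhedron →
      q ∈ Set.extremePoints ℝ G.polyhedron → p.2 = q.2 → ¬ p.1 < q.1 := by
    intro p q hp hq h hlt
    -- The reflection of `p` in `q`, which lies to the right of `q` and so in the polyhedron.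
    have hr : ((2 * q.1 - p.1, q.2) : ℝ × ℝ) ∈ G.polyhedron := by
      obtain ⟨x, hx, y, hy, hxy⟩ := Set.mem_add.1 hq.1
      refine Set.mem_add.2 ⟨x, hx, y + (q.1 - p.1, 0), ?_, ?_⟩
      · exact ⟨by simpa using add_nonneg hy.1 (sub_nonneg.2 hlt.le), by simpa using hy.2⟩
      · rw [← add_assoc, hxy]
        ext
        · simp
          ring
        · simp
    have hseg : q ∈ openSegment ℝ p (2 * q.1 - p.1, q.2) := by
      refine ⟨1 / 2, 1 / 2, by norm_num, by norm_num, by norm_num, ?_⟩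
      ext
      · simp
        ring
      · simp [h]
        ring
    have := hq.2 hp.1 hr hseg
    rw [this] at hlt
    exact lt_irrefl _ hlt
  exact Prod.ext (le_antisymm (not_lt.1 (aux q p hq hp h.symm)) (not_lt.1 (aux p q hp hq h))) h

theorem card_le_of_isMaximalExtremeFamily (hM : 0 < M) {T : Finset (List (Fin M))}
    (hT : G.IsMaximalExtremeFamily T) : T.card ≤ (Finset.univ.image G.weight).card := by
  obtain ⟨hext, hne⟩ := hT.1
  -- If the ends coincide, the only path is empty and its maximal weight `0` is not the weight of an
  -- edge, so the injection below fails; one edge is then enough for the bound.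
  by_cases hst : G.source = G.target
  · have h1 : T ⊆ {[]} := fun P hP =>
      Finset.mem_singleton.2 (G.eq_nil_of_mem_paths (hext P hP).1 hst)
    refine (Finset.card_le_card h1).trans ?_
    rw [Finset.card_singleton]
    exact Finset.card_pos.2 ⟨_, Finset.mem_image_of_mem _ (Finset.mem_univ ⟨0, hM⟩)⟩
  · refine Finset.card_le_card_of_injOn G.maxWeight ?_ ?_
    · intro P hP
      have hnil : P ≠ [] := by
        rintro rfl
        exact hst (G.source_eq_target_of_nil_mem_paths (hext _ hP).1)
      obtain ⟨e, _, h⟩ := G.exists_weight_eq_maxWeight hnil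
      simp [h]
    · intro P hP Q hQ h
      by_contra hPQ
      refine hne P hP Q hQ hPQ (G.snd_injOn_extremePoints (hext P hP).2 (hext Q hQ).2 ?_)
      simpa [objectives, worstCost_ball] using h

/-! ## Selecting a solution among the cheapest paths of bounded weight -/

/-- The line `lam ↦ val e + lam * weight e` is, among the lines given by the edges in `feas`,
below the steeper ones and strictly below the flatter ones for some `lam ≥ 0`; among lines of
the same slope the one with the smallest index is chosen. -/
def Selected (feas : Fin M → Prop) (val : Fin M → ℝ) (e : Fin M) : Prop :=
  feas e ∧ ∃ lam : ℝ, 0 ≤ lam ∧ ∀ j, feas j →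
    (G.weight e < G.weight j → val e + lam * G.weight e ≤ val j + lam * G.weight j) ∧
    (G.weight j < G.weight e → val e + lam * G.weight e < val j + lam * G.weight j) ∧
    (G.weight j = G.weight e → e ≤ j)

variable {G} {feas : Fin M → Prop} {val : Fin M → ℝ}

/-- Increase `lam` a little: ties with steeper lines become strict at once, while the strict
inequalities against flatter lines survive by continuity. -/
theorem Selected.exists_strict {e : Fin M} (h : G.Selected feas val e) :
    ∃ lam : ℝ, 0 ≤ lam ∧ ∀ j, feas j → G.weight j ≠ G.weight e →
      val e + lam * G.weight e < val j + lam * G.weight j := by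
  obtain ⟨_, lam, hl, hj⟩ := h
  have : ∀ᶠ x in nhdsWithin lam (Set.Ioi lam), ∀ j, feas j → G.weight j ≠ G.weight e →
      val e + x * G.weight e < val j + x * G.weight j := by
    rw [Filter.eventually_all]
    intro j
    by_cases hf : feas j
    · rcases lt_trichotomy (G.weight j) (G.weight e) with hlt | heq | hgt
      · have hc : Continuous fun x : ℝ => val j + x * G.weight j - (val e + x * G.weight e) := by
          fun_prop
        have h0 := (hj j hf).2.1 hlt
        have := (hc.tendsto lam).eventually (lt_mem_nhds (sub_pos.2 h0))
        filter_upwards [nhdsWithin_le_nhds this] with x hx _ _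
        exact sub_pos.1 hx
      · exact Filter.Eventually.of_forall fun x _ hne => absurd heq hne
      · have h0 := (hj j hf).1 hgt
        filter_upwards [self_mem_nhdsWithin] with x hx _ _
        have hx : lam < x := hx
        nlinarith
    · exact Filter.Eventually.of_forall fun x h => absurd h hf
  obtain ⟨x, hx, hx'⟩ := (this.and self_mem_nhdsWithin).exists
  exact ⟨x, hl.trans (le_of_lt hx'), hx⟩

/-- This is why selected edges suffice: at every `lam` some selected line attains the minimum. -/
theorem exists_selected (hne : ∃ e, feas e)
    (hval : ∀ i j, feas i → feas j → G.weight i = G.weight j → val i = val j) {lam : ℝ} (hl : 0 ≤ lam) :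
    ∃ e, G.Selected feas val e ∧
      ∀ j, feas j → val e + lam * G.weight e ≤ val j + lam * G.weight j := by
  classical
  obtain ⟨e₀, he₀⟩ := hne
  -- Minimize value, then slope, then index. A flatter line of equal value would win at the second
  -- stage, so flatter lines are strictly above; lines of equal slope have equal value and are
  -- separated by the index.
  obtain ⟨e, he, hmin⟩ := Finset.exists_min_image (Finset.univ.filter feas)
    (fun e => toLex (val e + lam * G.weight e, toLex (G.weight e, e))) ⟨e₀, by simpa⟩
  simp only [Finset.mem_filter, Finset.mem_univ, true_and] at he hmin
  have hle : ∀ j, feas j → val e + lam * G.weight e ≤ val j + lam * G.weight j := by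
    intro j hj
    have := hmin j hj
    simp only [Prod.Lex.toLex_le_toLex] at this
    rcases this with h | h
    · exact h.le
    · exact h.1.le
  refine ⟨e, ⟨he, lam, hl, fun j hj => ⟨fun _ => hle j hj, fun hlt => ?_, fun heq => ?_⟩⟩, hle⟩
  · have := hmin j hj
    simp only [Prod.Lex.toLex_le_toLex] at this
    rcases this with h | ⟨_, h | h⟩
    · exact h
    · exact absurd hlt h.not_gt
    · exact absurd h.1 hlt.ne'
  · have := hmin j hj
    simp only [Prod.Lex.toLex_le_toLex] at this
    rcases this with h | ⟨_, h | h⟩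
    · rw [heq, hval j e hj he heq] at h
      exact absurd h (lt_irrefl _)
    · exact absurd heq h.ne'
    · exact h.2

/-- Let `path e` be a cheapest path among those of weight at most `weight e`, for the edges `e`
for which there is such a path. The selected ones are distinct and form a solution. -/
theorem isSolution_image_selected [DecidablePred (G.Selected feas val)]
    {path : Fin M → List (Fin M)}
    (hpath : ∀ e, feas e → path e ∈ G.paths ∧ cost G.nominal (path e) = val e ∧
      ∀ e' ∈ path e, G.weight e' ≤ G.weight e)
    (hmin : ∀ e, ∀ P ∈ G.paths, (∀ e' ∈ P, G.weight e' ≤ G.weight e) →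
      feas e ∧ val e ≤ cost G.nominal P)
    (hne : G.paths.Nonempty) (hM : 0 < M) :
    Set.InjOn path {e | G.Selected feas val e} ∧
      G.IsSolution ((Finset.univ.filter (G.Selected feas val)).image path) := by
  have hmw : ∀ e, feas e → G.maxWeight (path e) ≤ G.weight e := fun e he =>
    G.maxWeight_le (G.weight_pos e).le (hpath e he).2.2
  have hval : ∀ i j, feas i → feas j → G.weight i = G.weight j → val i = val j := by
    intro i j hi hj hw
    apply le_antisymm
    · rw [← (hpath j hj).2.1]
      exact (hmin i _ (hpath j hj).1 (hw ▸ (hpath j hj).2.2)).2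
    · rw [← (hpath i hi).2.1]
      exact (hmin j _ (hpath i hi).1 (hw ▸ (hpath i hi).2.2)).2
  have hfe : ∃ e, feas e := by
    obtain ⟨P, hP⟩ := hne
    obtain ⟨e, -, he⟩ := Finset.exists_max_image Finset.univ G.weight ⟨⟨0, hM⟩, Finset.mem_univ _⟩
    exact ⟨e, (hmin e P hP fun e' _ => he e' (Finset.mem_univ _)).1⟩
  -- A nonempty path is never below the line of its heaviest edge, which is therefore the only line
  -- to compare with.
  have hline : ∀ P ∈ G.paths, P ≠ [] → ∃ j, feas j ∧ G.maxWeight P = G.weight j ∧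
      val j ≤ cost G.nominal P := by
    intro P hP hnil
    obtain ⟨j, -, hj⟩ := G.exists_weight_eq_maxWeight hnil
    have := hmin j P hP fun e' he' => hj ▸ G.weight_le_maxWeight he'
    exact ⟨j, this.1, hj, this.2⟩
  have hinj : Set.InjOn path {e | G.Selected feas val e} := by
    intro i hi j hj hij
    have hv : val i = val j := by
      rw [← (hpath i hi.1).2.1, ← (hpath j hj.1).2.1, hij]
    obtain ⟨li, hli, hi'⟩ := hi.exists_strict
    obtain ⟨lj, hlj, hj'⟩ := hj.exists_strict
    rcases lt_trichotomy (G.weight i) (G.weight j) with h | h | h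
    · have := hj' i hi.1 h.ne
      rw [hv] at this
      nlinarith
    · obtain ⟨_, _, _, hi2⟩ := hi
      obtain ⟨_, _, _, hj2⟩ := hj
      exact le_antisymm ((hi2 j ‹_›).2.2 h.symm) ((hj2 i ‹_›).2.2 h)
    · have := hi' j hj.1 h.ne
      rw [hv] at this
      nlinarith
  refine ⟨hinj, ⟨?_, ?_⟩, ?_⟩
  · intro P hP
    obtain ⟨e, he, rfl⟩ := Finset.mem_image.1 hP
    exact (hpath e (Finset.mem_filter.1 he).2.1).1
  · intro lam hl
    obtain ⟨e, he, hle⟩ := exists_selected hfe hval hl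
    refine ⟨path e, Finset.mem_image_of_mem _ (by simpa using he), (hpath e he.1).1, ?_⟩
    intro Q hQ
    rw [G.worstCost_uncertaintySet hl, G.worstCost_uncertaintySet hl]
    by_cases hnil : Q = []
    · have hst := G.source_eq_target_of_nil_mem_paths (hnil ▸ hQ)
      rw [hnil, G.eq_nil_of_mem_paths (hpath e he.1).1 hst]
    · obtain ⟨j, hj, hjw, hjv⟩ := hline Q hQ hnil
      have h1 := hle j hj
      have h2 := mul_le_mul_of_nonneg_left (hmw e he.1) hl
      rw [(hpath e he.1).2.1, hjw]
      linarith
  · intro S' hS'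
    -- Again the empty path is separated: it has no heaviest edge, and any covering set has at least
    -- one element.
    by_cases hst : G.source = G.target
    · have h1 : (Finset.univ.filter (G.Selected feas val)).image path ⊆ {[]} := by
        intro P hP
        obtain ⟨e, he, rfl⟩ := Finset.mem_image.1 hP
        exact Finset.mem_singleton.2
          (G.eq_nil_of_mem_paths (hpath e (Finset.mem_filter.1 he).2.1).1 hst)
      refine (Finset.card_le_card h1).trans ?_
      rw [Finset.card_singleton]
      obtain ⟨P, hP, _⟩ := hS'.2 0 le_rfl
      exact Finset.card_pos.2 ⟨P, hP⟩
    -- Where the line of `e` is strictly below all lines of other slopes, an optimal `Q` of another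
    -- maximal weight would be worse than `path e`. So `Q` has exactly the weight of `e`.
    · have hQ : ∀ e, G.Selected feas val e → ∃ Q ∈ S', G.maxWeight Q = G.weight e := by
        intro e he
        obtain ⟨lam, hl, hs⟩ := he.exists_strict
        obtain ⟨Q, hQS, hQ, hopt⟩ := hS'.2 lam hl
        refine ⟨Q, hQS, ?_⟩
        have hnil : Q ≠ [] := by
          rintro rfl
          exact hst (G.source_eq_target_of_nil_mem_paths hQ)
        obtain ⟨j, hj, hjw, hjv⟩ := hline Q hQ hnil
        by_contra hne'
        have h1 := hs j hj (hjw ▸ hne')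
        have h2 := hopt _ (hpath e he.1).1
        rw [G.worstCost_uncertaintySet hl, G.worstCost_uncertaintySet hl,
          (hpath e he.1).2.1, hjw] at h2
        have h3 := mul_le_mul_of_nonneg_left (hmw e he.1) hl
        linarith
      choose! Q hQS hQw using hQ
      refine Finset.card_image_le.trans (Finset.card_le_card_of_injOn Q ?_ ?_)
      · intro e he
        exact hQS e (Finset.mem_filter.1 he).2
      -- Selected edges of equal weight are equal because of the tie-break by index, so distinct
      -- ones need distinct members of `S'`.
      · intro i hi j hj hij
        have hi := (Finset.mem_filter.1 hi).2
        have hj := (Finset.mem_filter.1 hj).2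
        have hw : G.weight i = G.weight j := by rw [← hQw i hi, ← hQw j hj, hij]
        obtain ⟨_, _, _, hi2⟩ := id hi
        obtain ⟨_, _, _, hj2⟩ := id hj
        exact le_antisymm ((hi2 j hj.1).2.2 hw.symm) ((hj2 i hi.1).2.2 hw)

end Instance

/-! ## Reasoning about programs -/

/-- `f` with the value at `(a, i)` replaced by `v`. -/
def upd {α : Type*} (f : ℕ → ℕ → α) (a i : ℕ) (v : α) : ℕ → ℕ → α :=
  fun b j => if b = a ∧ j = i then v else f b j

@[simp] theorem Memory.setNat_int (m : Memory) (a i v : ℕ) :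
    (m.setNat a i v).int = upd m.int a i v := by
  funext b j
  simp only [Memory.setNat, upd, Function.update_apply]
  by_cases h : b = a
  · subst h
    simp [Function.update_apply]
  · simp [h]

@[simp] theorem Memory.setNat_real (m : Memory) (a i v : ℕ) :
    (m.setNat a i v).real = m.real := rfl

@[simp] theorem Memory.setReal_real (m : Memory) (a i : ℕ) (v : ℝ) :
    (m.setReal a i v).real = upd m.real a i v := by
  funext b j
  simp only [Memory.setReal, upd, Function.update_apply]
  by_cases h : b = a
  · subst h
    simp [Function.update_apply]
  · simp [h]

@[simp] theorem Memory.setReal_int (m : Memory) (a i : ℕ) (v : ℝ) :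
    (m.setReal a i v).int = m.int := rfl

attribute [simp] NatExp.eval RealExp.eval Test.Holds

/-- The program `p` halts on the memory `m`, with a step count and a final memory that
satisfy `Q`. -/
def Ends (p : Prog) (m : Memory) (Q : ℕ → Memory → Prop) : Prop :=
  ∃ k m', Runs p m k m' ∧ Q k m'

theorem Ends.mono {p : Prog} {m : Memory} {Q Q' : ℕ → Memory → Prop} (h : Ends p m Q)
    (hQ : ∀ k m', Q k m' → Q' k m') : Ends p m Q' := by
  obtain ⟨k, m', hr, hq⟩ := h
  exact ⟨k, m', hr, hQ _ _ hq⟩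

theorem ends_skip {m : Memory} {Q : ℕ → Memory → Prop} (h : Q 1 m) : Ends .skip m Q :=
  ⟨_, _, .skip m, h⟩

theorem ends_setNat {a : ℕ} {i x : NatExp} {m : Memory} {Q : ℕ → Memory → Prop}
    (h : Q 1 (m.setNat a (i.eval m) (x.eval m))) : Ends (.setNat a i x) m Q :=
  ⟨_, _, .setNat a i x m, h⟩

theorem ends_setReal {a : ℕ} {i : NatExp} {x : RealExp} {m : Memory} {Q : ℕ → Memory → Prop}
    (h : Q 1 (m.setReal a (i.eval m) (x.eval m))) : Ends (.setReal a i x) m Q :=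
  ⟨_, _, .setReal a i x m, h⟩

theorem ends_seq {p q : Prog} {m : Memory} {Q : ℕ → Memory → Prop}
    (h : Ends p m fun k m₁ => Ends q m₁ fun l m₂ => Q (k + l) m₂) : Ends (.seq p q) m Q := by
  obtain ⟨k, m₁, hp, l, m₂, hq, h⟩ := h
  exact ⟨_, _, .seq hp hq, h⟩

theorem ends_cond {c : Test} {p q : Prog} {m : Memory} {Q : ℕ → Memory → Prop}
    (h : c.Holds m → Ends p m fun k => Q (k + 1))
    (h' : ¬ c.Holds m → Ends q m fun k => Q (k + 1)) : Ends (.cond c p q) m Q := by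
  by_cases hc : c.Holds m
  · obtain ⟨k, m₁, hp, hQ⟩ := h hc
    exact ⟨_, _, .condTrue hc hp, hQ⟩
  · obtain ⟨k, m₁, hp, hQ⟩ := h' hc
    exact ⟨_, _, .condFalse hc hp, hQ⟩

/-- A loop with invariant `I`, whose running time is paid from the potential `Φ`. -/
theorem ends_loop {c : Test} {p : Prog} (I : Memory → Prop) (Φ : Memory → ℕ)
    (h : ∀ m, I m → c.Holds m → Ends p m fun k m' => I m' ∧ k + 1 + Φ m' ≤ Φ m)
    {m : Memory} (hm : I m) :
    Ends (.loop c p) m fun k m' => I m' ∧ ¬ c.Holds m' ∧ k + Φ m' ≤ Φ m + 1 := by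
  induction hn : Φ m using Nat.strong_induction_on generalizing m with
  | _ n ih =>
    by_cases hc : c.Holds m
    · obtain ⟨k, m₁, hp, hI, hk⟩ := h m hm hc
      obtain ⟨l, m₂, hl, hI₂, hc₂, hk₂⟩ := ih (Φ m₁) (by omega) hI rfl
      exact ⟨_, _, .loopStep hc hp hl, hI₂, hc₂, by omega⟩
    · exact ⟨_, _, .loopDone hc, hm, hc, by omega⟩

/-- The sequence of the programs in a list. -/
def Prog.block : List Prog → Prog
  | [] => .skip
  | p :: ps => .seq p (Prog.block ps)

/-- The equivalences allow straight-line code to be executed symbolically by `simp`: the claim about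
the program becomes a claim about one explicit memory. -/
theorem ends_skip_iff {m : Memory} {Q : ℕ → Memory → Prop} : Ends .skip m Q ↔ Q 1 m :=
  ⟨fun ⟨_, _, hr, h⟩ => by cases hr; exact h, ends_skip⟩

theorem ends_setNat_iff {a : ℕ} {i x : NatExp} {m : Memory} {Q : ℕ → Memory → Prop} :
    Ends (.setNat a i x) m Q ↔ Q 1 (m.setNat a (i.eval m) (x.eval m)) :=
  ⟨fun ⟨_, _, hr, h⟩ => by cases hr; exact h, ends_setNat⟩

theorem ends_setReal_iff {a : ℕ} {i : NatExp} {x : RealExp} {m : Memory}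
    {Q : ℕ → Memory → Prop} :
    Ends (.setReal a i x) m Q ↔ Q 1 (m.setReal a (i.eval m) (x.eval m)) :=
  ⟨fun ⟨_, _, hr, h⟩ => by cases hr; exact h, ends_setReal⟩

theorem ends_seq_iff {p q : Prog} {m : Memory} {Q : ℕ → Memory → Prop} :
    Ends (.seq p q) m Q ↔ Ends p m fun k m₁ => Ends q m₁ fun l m₂ => Q (k + l) m₂ :=
  ⟨fun ⟨_, _, hr, h⟩ => by cases hr with | seq hp hq => exact ⟨_, _, hp, _, _, hq, h⟩, ends_seq⟩

/-! Notation for expressions -/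

instance : OfNat NatExp n := ⟨.lit n⟩
instance : Add NatExp := ⟨.add⟩
instance : Sub NatExp := ⟨.sub⟩
instance : OfNat RealExp n := ⟨.lit n⟩
instance : Add RealExp := ⟨.add⟩
instance : Sub RealExp := ⟨.sub⟩
instance : Mul RealExp := ⟨.mul⟩
instance : Div RealExp := ⟨.div⟩

@[simp] theorem NatExp.eval_ofNat (m : Memory) (n : ℕ) :
    NatExp.eval m (OfNat.ofNat n) = OfNat.ofNat n := rfl
@[simp] theorem NatExp.eval_add' (m : Memory) (x y : NatExp) :
    NatExp.eval m (x + y) = x.eval m + y.eval m := rfl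
@[simp] theorem NatExp.eval_sub' (m : Memory) (x y : NatExp) :
    NatExp.eval m (x - y) = x.eval m - y.eval m := rfl
@[simp] theorem RealExp.eval_ofNat (m : Memory) (n : ℕ) :
    RealExp.eval m (OfNat.ofNat n) = (OfNat.ofNat n : ℕ) := rfl
@[simp] theorem RealExp.eval_add' (m : Memory) (x y : RealExp) :
    RealExp.eval m (x + y) = x.eval m + y.eval m := rfl
@[simp] theorem RealExp.eval_sub' (m : Memory) (x y : RealExp) :
    RealExp.eval m (x - y) = x.eval m - y.eval m := rfl
@[simp] theorem RealExp.eval_mul' (m : Memory) (x y : RealExp) :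
    RealExp.eval m (x * y) = x.eval m * y.eval m := rfl
@[simp] theorem RealExp.eval_div' (m : Memory) (x y : RealExp) :
    RealExp.eval m (x / y) = x.eval m / y.eval m := rfl

/-! ## Sums over arrays -/

/-- The change of one summand, written additively so that no truncated subtraction occurs. All
balances of weight and potential below rest on it. -/
theorem sum_range_eq_add_of_eq_off {B i : ℕ} {g g' : ℕ → ℕ} (hi : i < B)
    (h : ∀ j, j < B → j ≠ i → g' j = g j) :
    ∑ j ∈ Finset.range B, g' j + g i = ∑ j ∈ Finset.range B, g j + g' i := by
  have hi' := Finset.mem_range.2 hi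
  rw [← Finset.add_sum_erase _ _ hi', ← Finset.add_sum_erase _ g hi']
  have : ∑ j ∈ (Finset.range B).erase i, g' j = ∑ j ∈ (Finset.range B).erase i, g j :=
    Finset.sum_congr rfl fun j hj =>
      h j (Finset.mem_range.1 (Finset.mem_of_mem_erase hj)) (Finset.ne_of_mem_erase hj)
  omega

theorem sum_range_congr {B : ℕ} {g g' : ℕ → ℕ} (h : ∀ j, j < B → g' j = g j) :
    ∑ j ∈ Finset.range B, g' j = ∑ j ∈ Finset.range B, g j :=
  Finset.sum_congr rfl fun j hj => h j (Finset.mem_range.1 hj)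

/-! ## The heap

The priority queue is a hollow heap kept in flat arrays. Its nodes are positive integers.
Integer array `10` is a stack of roots, whose height is cell `(7, 0)`; array `11` holds at most
one root of each rank; cell `v * W + i` of array `12` holds the child of rank `i` of the node
of the vertex `v`; arrays `13` and `14` hold the two children of a hollow node. A cell of these
five arrays is in use if it is not `0`. Array `15` maps a node to its vertex, array `16` to its
rank, and array `17` maps a vertex to its node, `0` if the vertex is not in the queue. Cell
`(7, 1)` counts the nodes, cell `(7, 2)` bounds the ranks in array `11`. -/

/-- The node `y` is in one of the five arrays that hold the structure of the heap. -/
def Located (f : ℕ → ℕ → ℕ) (y : ℕ) : Prop := ∃ a i, 10 ≤ a ∧ a ≤ 14 ∧ f a i = y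

/-- No node occurs twice. -/
def Placed (f : ℕ → ℕ → ℕ) : Prop :=
  ∀ a i b j, 10 ≤ a → a ≤ 14 → 10 ≤ b → b ≤ 14 → f a i = f b j → f a i ≠ 0 → a = b ∧ i = j

/-- Here and in the three lemmas that follow, a change of one or two cells keeps the structure free
of repetitions, and the effect on the set of present nodes is recorded. The new function is
described only on arrays `10` to `14`, so ranks, vertices and counters may change at the same time.
-/
theorem Placed.clear {f f' : ℕ → ℕ → ℕ} (h : Placed f) {a i : ℕ}
    (ha : 10 ≤ a) (ha' : a ≤ 14) (hn : f a i ≠ 0)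
    (hf : ∀ c k, 10 ≤ c → c ≤ 14 → f' c k = if c = a ∧ k = i then 0 else f c k) :
    Placed f' ∧ ∀ y, y ≠ 0 → (Located f' y ↔ Located f y ∧ y ≠ f a i) := by
  refine ⟨?_, fun y hy => ⟨?_, ?_⟩⟩
  · intro c k d l hc hc' hd hd' heq hne
    rw [hf c k hc hc'] at heq hne
    rw [hf d l hd hd'] at heq
    have h3 := h c k d l hc hc' hd hd'
    split_ifs at heq hne <;> grind
  · rintro ⟨c, k, hc, hc', rfl⟩
    rw [hf c k hc hc'] at hy ⊢
    split_ifs at hy ⊢ with h1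
    · exact absurd rfl hy
    · exact ⟨⟨c, k, hc, hc', rfl⟩, fun he => h1 (h c k a i hc hc' ha ha' he hy)⟩
  · rintro ⟨⟨c, k, hc, hc', rfl⟩, hne⟩
    refine ⟨c, k, hc, hc', ?_⟩
    rw [hf c k hc hc', if_neg]
    rintro ⟨rfl, rfl⟩
    exact hne rfl

theorem Placed.insert {f f' : ℕ → ℕ → ℕ} (h : Placed f) {a i z : ℕ}
    (ha : 10 ≤ a) (ha' : a ≤ 14) (hn : f a i = 0) (hz : ¬ Located f z)
    (hf : ∀ c k, 10 ≤ c → c ≤ 14 → f' c k = if c = a ∧ k = i then z else f c k) :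
    Placed f' ∧ ∀ y, y ≠ 0 → (Located f' y ↔ Located f y ∨ y = z) := by
  have hz' : ∀ c k, 10 ≤ c → c ≤ 14 → f c k ≠ z := fun c k hc hc' he => hz ⟨c, k, hc, hc', he⟩
  refine ⟨?_, fun y hy => ⟨?_, ?_⟩⟩
  · intro c k d l hc hc' hd hd' heq hne
    rw [hf c k hc hc'] at heq hne
    rw [hf d l hd hd'] at heq
    have h3 := h c k d l hc hc' hd hd'
    have h1 := hz' c k hc hc'
    have h2 := hz' d l hd hd'
    split_ifs at heq hne <;> grind
  · rintro ⟨c, k, hc, hc', rfl⟩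
    rw [hf c k hc hc'] at hy ⊢
    split_ifs at hy ⊢ with h1
    · exact Or.inr rfl
    · exact Or.inl ⟨c, k, hc, hc', rfl⟩
  · rintro (⟨c, k, hc, hc', rfl⟩ | rfl)
    · refine ⟨c, k, hc, hc', ?_⟩
      rw [hf c k hc hc', if_neg]
      rintro ⟨rfl, rfl⟩
      exact hy hn
    · exact ⟨a, i, ha, ha', by simp [hf a i ha ha']⟩

theorem Placed.swap {f f' : ℕ → ℕ → ℕ} (h : Placed f) {a i b j : ℕ}
    (ha : 10 ≤ a) (ha' : a ≤ 14) (hb : 10 ≤ b) (hb' : b ≤ 14) (hn : f a i ≠ 0) (hn' : f b j ≠ 0)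
    (hf : ∀ c k, 10 ≤ c → c ≤ 14 →
      f' c k = if c = a ∧ k = i then f b j else if c = b ∧ k = j then f a i else f c k) :
    Placed f' ∧ ∀ y, y ≠ 0 → (Located f' y ↔ Located f y) := by
  refine ⟨?_, fun y hy => ⟨?_, ?_⟩⟩
  · intro c k d l hc hc' hd hd' heq hne
    rw [hf c k hc hc'] at heq hne
    rw [hf d l hd hd'] at heq
    have h0 := h a i b j ha ha' hb hb'
    have h1 := h a i d l ha ha' hd hd'
    have h2 := h c k a i hc hc' ha ha'
    have h3 := h c k d l hc hc' hd hd'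
    have h4 := h b j d l hb hb' hd hd'
    have h5 := h c k b j hc hc' hb hb'
    split_ifs at heq hne <;> grind
  · rintro ⟨c, k, hc, hc', rfl⟩
    rw [hf c k hc hc'] at hy ⊢
    split_ifs at hy ⊢ with h1 h2
    · exact ⟨b, j, hb, hb', rfl⟩
    · exact ⟨a, i, ha, ha', rfl⟩
    · exact ⟨c, k, hc, hc', rfl⟩
  · rintro ⟨c, k, hc, hc', rfl⟩
    by_cases h1 : c = a ∧ k = i
    · refine ⟨b, j, hb, hb', ?_⟩
      rw [hf b j hb hb', h1.1, h1.2]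
      by_cases h2 : b = a ∧ j = i
      · rw [if_pos h2, h2.1, h2.2]
      · rw [if_neg h2, if_pos ⟨rfl, rfl⟩]
    · by_cases h2 : c = b ∧ k = j
      · refine ⟨a, i, ha, ha', ?_⟩
        rw [hf a i ha ha', if_pos ⟨rfl, rfl⟩, h2.1, h2.2]
      · exact ⟨c, k, hc, hc', by rw [hf c k hc hc', if_neg h1, if_neg h2]⟩

theorem Placed.move {f f' : ℕ → ℕ → ℕ} (h : Placed f) {a i b j : ℕ}
    (ha : 10 ≤ a) (ha' : a ≤ 14) (hb : 10 ≤ b) (hb' : b ≤ 14) (h0 : f b j = 0) (hn : f a i ≠ 0)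
    (hf : ∀ c k, 10 ≤ c → c ≤ 14 →
      f' c k = if c = a ∧ k = i then 0 else if c = b ∧ k = j then f a i else f c k) :
    Placed f' ∧ ∀ y, y ≠ 0 → (Located f' y ↔ Located f y) := by
  refine ⟨?_, fun y hy => ⟨?_, ?_⟩⟩
  · intro c k d l hc hc' hd hd' heq hne
    rw [hf c k hc hc'] at heq hne
    rw [hf d l hd hd'] at heq
    have h1 := h a i d l ha ha' hd hd'
    have h2 := h c k a i hc hc' ha ha'
    have h3 := h c k d l hc hc' hd hd'
    split_ifs at heq hne <;> grind
  · rintro ⟨c, k, hc, hc', rfl⟩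
    rw [hf c k hc hc'] at hy ⊢
    split_ifs at hy ⊢ with h1 h2
    · exact absurd rfl hy
    · exact ⟨a, i, ha, ha', rfl⟩
    · exact ⟨c, k, hc, hc', rfl⟩
  · rintro ⟨c, k, hc, hc', rfl⟩
    by_cases h1 : c = a ∧ k = i
    · refine ⟨b, j, hb, hb', ?_⟩
      rw [hf b j hb hb', h1.1, h1.2, if_neg, if_pos ⟨rfl, rfl⟩]
      rintro ⟨rfl, rfl⟩
      exact hn h0
    · refine ⟨c, k, hc, hc', ?_⟩
      rw [hf c k hc hc', if_neg h1, if_neg]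
      rintro ⟨rfl, rfl⟩
      exact hy h0

/-- The weight of the heap, which bounds the ranks. -/
def heapWeight (N W : ℕ) (f : ℕ → ℕ → ℕ) : ℕ :=
  ∑ i ∈ Finset.range (f 7 0), Nat.fib (f 16 (f 10 i) + 1) +
    ∑ i ∈ Finset.range W, (if f 11 i = 0 then 0 else Nat.fib (i + 1)) +
    ∑ v ∈ Finset.range N, Nat.fib (f 16 (f 17 v))

/-- The potential of the heap, which pays for the work on its roots. -/
def heapPot (W : ℕ) (f : ℕ → ℕ → ℕ) : ℕ :=
  2 * f 7 0 + ∑ i ∈ Finset.range W, (if f 11 i = 0 then 0 else 1) +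
    2 * ∑ x ∈ Finset.range W, (if f 13 x = 0 then 0 else 1) +
    2 * ∑ x ∈ Finset.range W, (if f 14 x = 0 then 0 else 1)

/-- The invariant of the heap. -/
structure HeapInv (N W : ℕ) (f : ℕ → ℕ → ℕ) (key : ℕ → ℝ) : Prop where
  stack : ∀ i, f 10 i ≠ 0 ↔ i < f 7 0
  root : ∀ i, f 11 i ≠ 0 →
    f 16 (f 11 i) = i ∧ f 17 (f 15 (f 11 i)) = f 11 i ∧ i ≤ f 7 2 ∧ i < W
  kid : ∀ j, f 12 j ≠ 0 → ∃ v i, j = v * W + i ∧ f 17 v ≠ 0 ∧ i < f 16 (f 17 v) ∧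
    f 16 (f 12 j) = i ∧ key (f 17 v) ≤ key (f 12 j)
  kids : ∀ v i, f 17 v ≠ 0 → i < f 16 (f 17 v) → f 12 (v * W + i) ≠ 0
  hollow₁ : ∀ x, f 13 x ≠ 0 → x ≠ 0 ∧ Located f x ∧ f 17 (f 15 x) ≠ x ∧
    f 16 (f 13 x) + 1 = f 16 x ∧ key x ≤ key (f 13 x)
  hollow₂ : ∀ x, f 14 x ≠ 0 → f 13 x ≠ 0 ∧ f 16 (f 14 x) + 2 = f 16 x ∧ key x ≤ key (f 14 x)
  node : ∀ v, f 17 v ≠ 0 → v < N ∧ f 15 (f 17 v) = v ∧ Located f (f 17 v)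
  le : ∀ a i, 10 ≤ a → a ≤ 14 → f a i ≤ f 7 1
  placed : Placed f
  rank_zero : f 16 0 = 0
  count : f 7 1 + 2 ≤ W
  -- Only the creation of a node can increase the weight, and by at most one; this is what bounds
  -- the ranks.
  weight : heapWeight N W f ≤ f 7 1

/-! ### Bounds on the ranks, and the moves of full roots -/

namespace HeapInv

variable {N W : ℕ} {f f' : ℕ → ℕ → ℕ} {key : ℕ → ℝ}

/-- This linear bound is enough to keep the blocks of children of different vertices apart; the
logarithmic bound is needed only for the running time. -/
theorem lt_of_fib_le {r c : ℕ} (h : Nat.fib r ≤ c) : r < c + 2 := by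
  have := Nat.le_fib_add_one r
  omega

theorem rank_lt (h : HeapInv N W f key) {v : ℕ} (hv : f 17 v ≠ 0) : f 16 (f 17 v) < W := by
  have h1 : Nat.fib (f 16 (f 17 v)) ≤ ∑ v ∈ Finset.range N, Nat.fib (f 16 (f 17 v)) :=
    Finset.single_le_sum (f := fun v => Nat.fib (f 16 (f 17 v))) (fun _ _ => Nat.zero_le _)
      (Finset.mem_range.2 (h.node v hv).1)
  have h2 := h.weight
  rw [heapWeight] at h2
  have := lt_of_fib_le (h1.trans (by omega : _ ≤ f 7 1))
  have := h.count
  omega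

theorem fib_rank_stack_le (h : HeapInv N W f key) {i : ℕ} (hi : i < f 7 0) :
    Nat.fib (f 16 (f 10 i) + 1) ≤ f 7 1 := by
  have h1 : Nat.fib (f 16 (f 10 i) + 1) ≤
      ∑ i ∈ Finset.range (f 7 0), Nat.fib (f 16 (f 10 i) + 1) :=
    Finset.single_le_sum (f := fun i => Nat.fib (f 16 (f 10 i) + 1)) (fun _ _ => Nat.zero_le _)
      (Finset.mem_range.2 hi)
  have h2 := h.weight
  rw [heapWeight] at h2
  omega

theorem rank_stack_lt (h : HeapInv N W f key) {i : ℕ} (hi : i < f 7 0) :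
    f 16 (f 10 i) + 1 < W := by
  have := lt_of_fib_le (h.fib_rank_stack_le hi)
  have := h.count
  omega

/-- Division with remainder by `W`. It applies because every rank is below `W`. -/
theorem address_inj {v w i j : ℕ} (hi : i < W) (hj : j < W) (h : v * W + i = w * W + j) :
    v = w ∧ i = j := by
  have hW : 0 < W := by omega
  have h1 := congrArg (· / W) h
  have h2 := congrArg (· % W) h
  simp only [mul_comm _ W, Nat.mul_add_div hW, Nat.div_eq_of_lt hi, Nat.div_eq_of_lt hj,
    Nat.mul_add_mod, Nat.mod_eq_of_lt hi, Nat.mod_eq_of_lt hj] at h1 h2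
  exact ⟨by simpa using h1, h2⟩

/-- A cell of array `12` whose index is not below the rank is free. -/
theorem kid_eq_zero (h : HeapInv N W f key) {v i : ℕ} (hi : i < W)
    (hr : f 16 (f 17 v) ≤ i) : f 12 (v * W + i) = 0 := by
  by_contra hne
  obtain ⟨w, j, hj, hw, hjr, -⟩ := h.kid _ hne
  obtain ⟨rfl, rfl⟩ := address_inj hi (hjr.trans (h.rank_lt hw)) hj
  omega

theorem kid_spec (h : HeapInv N W f key) {v i : ℕ} (hi : i < W) (hne : f 12 (v * W + i) ≠ 0) :
    f 17 v ≠ 0 ∧ i < f 16 (f 17 v) ∧ f 16 (f 12 (v * W + i)) = i ∧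
      key (f 17 v) ≤ key (f 12 (v * W + i)) := by
  obtain ⟨w, j, hj, hw, hjr, h1, h2⟩ := h.kid _ hne
  obtain ⟨rfl, rfl⟩ := address_inj hi (hjr.trans (h.rank_lt hw)) hj
  exact ⟨hw, hjr, h1, h2⟩

/-- A full root on the top of the stack moves to the array of roots. -/
theorem place (h : HeapInv N W f key) (ht : 0 < f 7 0) {x r : ℕ} (hx : f 10 (f 7 0 - 1) = x)
    (hr : f 16 x = r) (hfull : f 17 (f 15 x) = x) (hA : f 11 r = 0)
    (h10 : ∀ i, f' 10 i = if i = f 7 0 - 1 then 0 else f 10 i)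
    (h11 : ∀ i, f' 11 i = if i = r then x else f 11 i)
    (h70 : f' 7 0 = f 7 0 - 1) (h71 : f' 7 1 = f 7 1) (h72 : f 7 2 ≤ f' 7 2) (h72' : r ≤ f' 7 2)
    (same : ∀ a, 12 ≤ a → a ≤ 17 → f' a = f a) :
    HeapInv N W f' key ∧ heapPot W f' < heapPot W f := by
  have hx0 : x ≠ 0 := hx ▸ (h.stack _).2 (by omega)
  obtain ⟨hp, hl⟩ := h.placed.move (f' := f') (a := 10) (i := f 7 0 - 1) (b := 11) (j := r)
    (by omega) (by omega) (by omega) (by omega) hA (hx ▸ hx0) (by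
      intro c k hc hc'
      obtain rfl | rfl | hc2 : c = 10 ∨ c = 11 ∨ 12 ≤ c := by omega
      · simp [h10]
      · simp [h11, hx]
      · rw [same c hc2 (by omega)]
        simp [show c ≠ 10 by omega, show c ≠ 11 by omega])
  have e12 := same 12 (by omega) (by omega)
  have e13 := same 13 (by omega) (by omega)
  have e14 := same 14 (by omega) (by omega)
  have e15 := same 15 (by omega) (by omega)
  have e16 := same 16 (by omega) (by omega)
  have e17 := same 17 (by omega) (by omega)
  have hrW := h.rank_stack_lt (i := f 7 0 - 1) (by omega)
  refine ⟨⟨?_, ?_, ?_, ?_, ?_, ?_, ?_, ?_, hp, ?_, ?_, ?_⟩, ?_⟩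
  · intro i
    have := h.stack i
    grind
  · intro i hi
    have := h.root i
    grind
  · rw [e12, e16, e17]
    exact h.kid
  · rw [e12, e16, e17]
    exact h.kids
  · intro x hx
    rw [e13] at hx
    have := h.hollow₁ x hx
    rw [hl x this.1, e13, e15, e16, e17]
    exact this
  · rw [e13, e14, e16]
    exact h.hollow₂
  · intro v hv
    rw [e17] at hv
    rw [e17, e15, hl _ hv]
    exact h.node v hv
  · intro a i ha ha'
    have := h.le a i ha ha'
    have := h.le 10 (f 7 0 - 1) (by omega) (by omega)
    obtain rfl | rfl | hc2 : a = 10 ∨ a = 11 ∨ 12 ≤ a := by omega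
    · grind
    · grind
    · rw [same a hc2 (by omega)]
      omega
  · rw [e16]
    exact h.rank_zero
  · rw [h71]
    exact h.count
  · rw [h71]
    refine le_trans (le_of_eq ?_) h.weight
    have hs := Finset.sum_range_succ (fun i => Nat.fib (f 16 (f 10 i) + 1)) (f 7 0 - 1)
    rw [show f 7 0 - 1 + 1 = f 7 0 by omega, hx, hr] at hs
    have hs' : ∑ i ∈ Finset.range (f 7 0 - 1), Nat.fib (f 16 (f' 10 i) + 1) =
        ∑ i ∈ Finset.range (f 7 0 - 1), Nat.fib (f 16 (f 10 i) + 1) :=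
      sum_range_congr fun j hj => by rw [h10, if_neg (by omega)]
    have hA' := sum_range_eq_add_of_eq_off (B := W) (i := r)
      (g := fun i => if f 11 i = 0 then 0 else Nat.fib (i + 1))
      (g' := fun i => if f' 11 i = 0 then 0 else Nat.fib (i + 1))
      (by rw [hx] at hrW; omega) (fun j _ hj => by simp [h11, hj])
    simp only [hA, h11 r, if_true, if_neg hx0] at hA'
    rw [heapWeight, heapWeight, h70, e16, e17]
    omega
  · have hA' := sum_range_eq_add_of_eq_off (B := W) (i := r)
      (g := fun i => if f 11 i = 0 then 0 else 1)
      (g' := fun i => if f' 11 i = 0 then 0 else 1)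
      (by rw [hx] at hrW; omega) (fun j _ hj => by simp [h11, hj])
    simp only [hA, h11 r, if_true, if_neg hx0] at hA'
    rw [heapPot, heapPot, h70, e13, e14]
    omega


/-- The top of the stack changes places with the full root of the same rank in the array. -/
theorem swap (h : HeapInv N W f key) (ht : 0 < f 7 0) {x y r : ℕ} (hx : f 10 (f 7 0 - 1) = x)
    (hr : f 16 x = r) (hfull : f 17 (f 15 x) = x) (hy : f 11 r = y) (hy0 : y ≠ 0)
    (h10 : ∀ i, f' 10 i = if i = f 7 0 - 1 then y else f 10 i)
    (h11 : ∀ i, f' 11 i = if i = r then x else f 11 i)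
    (h7 : f' 7 = f 7)
    (same : ∀ a, 12 ≤ a → a ≤ 17 → f' a = f a) :
    HeapInv N W f' key ∧ heapPot W f' = heapPot W f := by
  have hx0 : x ≠ 0 := hx ▸ (h.stack _).2 (by omega)
  obtain ⟨hyr, hyf, hy2, hrW⟩ := h.root r (hy ▸ hy0)
  rw [hy] at hyr hyf
  obtain ⟨hp, hl⟩ := h.placed.swap (f' := f') (a := 10) (i := f 7 0 - 1) (b := 11) (j := r)
    (by omega) (by omega) (by omega) (by omega) (hx ▸ hx0) (hy ▸ hy0) (by
      intro c k hc hc'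
      obtain rfl | rfl | hc2 : c = 10 ∨ c = 11 ∨ 12 ≤ c := by omega
      · simp [h10, hy]
      · simp [h11, hx]
      · rw [same c hc2 (by omega)]
        simp [show c ≠ 10 by omega, show c ≠ 11 by omega])
  have e12 := same 12 (by omega) (by omega)
  have e13 := same 13 (by omega) (by omega)
  have e14 := same 14 (by omega) (by omega)
  have e15 := same 15 (by omega) (by omega)
  have e16 := same 16 (by omega) (by omega)
  have e17 := same 17 (by omega) (by omega)
  have hzero : ∀ i, f' 11 i = 0 ↔ f 11 i = 0 := by
    intro i
    have := h11 i
    grind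
  refine ⟨⟨?_, ?_, ?_, ?_, ?_, ?_, ?_, ?_, hp, ?_, ?_, ?_⟩, ?_⟩
  · intro i
    have := h.stack i
    grind
  · intro i hi
    have := h.root i
    grind
  · rw [e12, e16, e17]
    exact h.kid
  · rw [e12, e16, e17]
    exact h.kids
  · intro x hx
    rw [e13] at hx
    have := h.hollow₁ x hx
    rw [hl x this.1, e13, e15, e16, e17]
    exact this
  · rw [e13, e14, e16]
    exact h.hollow₂
  · intro v hv
    rw [e17] at hv
    rw [e17, e15, hl _ hv]
    exact h.node v hv
  · intro a i ha ha'
    have := h.le a i ha ha'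
    have := h.le 10 (f 7 0 - 1) (by omega) (by omega)
    have := h.le 11 r (by omega) (by omega)
    rw [h7]
    obtain rfl | rfl | hc2 : a = 10 ∨ a = 11 ∨ 12 ≤ a := by omega
    · grind
    · grind
    · rw [same a hc2 (by omega)]
      omega
  · rw [e16]
    exact h.rank_zero
  · rw [h7]
    exact h.count
  · rw [h7]
    refine le_trans (le_of_eq ?_) h.weight
    rw [heapWeight, heapWeight, h7, e16, e17]
    congr 2
    · refine sum_range_congr fun j hj => ?_
      rw [h10]
      split_ifs with hj'
      · rw [hj', hx, hr, hyr]
      · rfl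
    · exact sum_range_congr fun j hj => by simp only [hzero]
  · simp only [heapPot, hzero, h7, e13, e14]

/-- The top of the stack wins against the full root of the same rank in the array. -/
theorem link (h : HeapInv N W f key) (ht : 0 < f 7 0) {x y r v : ℕ}
    (hx : f 10 (f 7 0 - 1) = x)
    (hr : f 16 x = r) (hv : f 15 x = v) (hfull : f 17 v = x) (hy : f 11 r = y) (hy0 : y ≠ 0)
    (hkey : key x ≤ key y)
    (h11 : ∀ i, f' 11 i = if i = r then 0 else f 11 i)
    (h12 : ∀ j, f' 12 j = if j = v * W + r then y else f 12 j)
    (h16 : ∀ u, f' 16 u = if u = x then r + 1 else f 16 u)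
    (h7 : f' 7 = f 7)
    (same : ∀ a, a = 10 ∨ a = 13 ∨ a = 14 ∨ a = 15 ∨ a = 17 → f' a = f a) :
    HeapInv N W f' key ∧ heapPot W f' < heapPot W f := by
  have hx0 : x ≠ 0 := hx ▸ (h.stack _).2 (by omega)
  obtain ⟨hyr, hyf, hy2, hrW⟩ := h.root r (hy ▸ hy0)
  rw [hy] at hyr hyf
  have hk0 : f 12 (v * W + r) = 0 := h.kid_eq_zero hrW (by rw [hfull, hr])
  obtain ⟨hp, hl⟩ := h.placed.move (f' := f') (a := 11) (i := r) (b := 12) (j := v * W + r)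
    (by omega) (by omega) (by omega) (by omega) hk0 (hy ▸ hy0) (by
      intro c k hc hc'
      obtain rfl | rfl | hc2 : c = 11 ∨ c = 12 ∨ (c = 10 ∨ c = 13 ∨ c = 14) := by omega
      · simp [h11]
      · simp [h12, hy]
      · rw [same c (by omega)]
        simp [show c ≠ 11 by omega, show c ≠ 12 by omega])
  have e10 := same 10 (by omega)
  have e13 := same 13 (by omega)
  have e14 := same 14 (by omega)
  have e15 := same 15 (by omega)
  have e17 := same 17 (by omega)
  -- The node `x` stands nowhere but on the top of the stack, so raising its rank affects no other
  -- cell of the structure.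
  have hxu : ∀ a i, 10 ≤ a → a ≤ 14 → f a i = x → a = 10 ∧ i = f 7 0 - 1 := by
    intro a i ha ha' he
    exact h.placed a i 10 (f 7 0 - 1) ha ha' (by omega) (by omega) (he.trans hx.symm) (he ▸ hx0)
  have hyx : y ≠ x := fun he => by
    have := hxu 11 r (by omega) (by omega) (hy.trans he)
    omega
  refine ⟨⟨?_, ?_, ?_, ?_, ?_, ?_, ?_, ?_, hp, ?_, ?_, ?_⟩, ?_⟩
  · rw [e10, h7]
    exact h.stack
  · intro i hi
    have := h.root i
    have := hxu 11 i (by omega) (by omega)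
    grind
  · intro j hj
    by_cases hj' : j = v * W + r
    · refine ⟨v, r, hj', ?_⟩
      rw [e17, hfull, h12, if_pos hj', h16, if_pos rfl, h16, if_neg hyx]
      exact ⟨hx0, by omega, hyr, hkey⟩
    · rw [h12, if_neg hj'] at hj ⊢
      obtain ⟨w, i, h1, h2, h3, h4, h5⟩ := h.kid j hj
      refine ⟨w, i, h1, ?_⟩
      have hjx : f 12 j ≠ x := fun he => by
        have := hxu 12 j (by omega) (by omega) he
        omega
      rw [e17, h16, h16, if_neg hjx]
      refine ⟨h2, ?_, h4, h5⟩
      split_ifs with he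
      · rw [he, hr] at h3
        omega
      · exact h3
  · intro w i hw hi
    rw [h12]
    split_ifs with he
    · exact hy0
    · rw [e17] at hw hi
      refine h.kids w i hw ?_
      rw [h16] at hi
      split_ifs at hi with hwx
      · have hwv : w = v := by rw [← hv, ← hwx, (h.node w hw).2.1]
        rw [hwx, hr]
        have : i ≠ r := by
          rintro rfl
          exact he (by rw [hwv])
        omega
      · exact hi
  · intro u hu
    rw [e13] at hu
    have := h.hollow₁ u hu
    have hux : u ≠ x := by
      rintro rfl
      exact this.2.2.1 (by rw [hv, hfull])
    have hux' := hxu 13 u (by omega) (by omega)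
    rw [hl u this.1, e13, e15, h16, h16, e17, if_neg hux, if_neg (by omega)]
    exact this
  · intro u hu
    rw [e14] at hu
    have h1 := h.hollow₂ u hu
    have := h.hollow₁ u h1.1
    have hux : u ≠ x := by
      rintro rfl
      exact this.2.2.1 (by rw [hv, hfull])
    have hux' := hxu 14 u (by omega) (by omega)
    rw [e13, e14, h16, h16, if_neg hux, if_neg (by omega)]
    exact h1
  · intro v hv
    rw [e17] at hv
    rw [e17, e15, hl _ hv]
    exact h.node v hv
  · intro a i ha ha'
    have := h.le a i ha ha'
    have := h.le 11 r (by omega) (by omega)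
    rw [h7]
    obtain rfl | rfl | hc2 : a = 11 ∨ a = 12 ∨ (a = 10 ∨ a = 13 ∨ a = 14) := by omega
    · grind
    · grind
    · rw [same a (by omega)]
      omega
  · rw [h16, if_neg hx0.symm]
    exact h.rank_zero
  · rw [h7]
    exact h.count
  · rw [h7]
    refine le_trans (le_of_eq ?_) h.weight
    have hs := sum_range_eq_add_of_eq_off (B := f 7 0) (i := f 7 0 - 1)
      (g := fun i => Nat.fib (f 16 (f 10 i) + 1)) (g' := fun i => Nat.fib (f' 16 (f 10 i) + 1))
      (by omega) (fun j hj hne => by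
        simp only [h16]
        rw [if_neg fun he => hne (hxu 10 j (by omega) (by omega) he).2])
    have hA' := sum_range_eq_add_of_eq_off (B := W) (i := r)
      (g := fun i => if f 11 i = 0 then 0 else Nat.fib (i + 1))
      (g' := fun i => if f' 11 i = 0 then 0 else Nat.fib (i + 1))
      hrW (fun j _ hj => by simp [h11, hj])
    have hvN : v < N := (h.node v (hfull ▸ hx0)).1
    have hV := sum_range_eq_add_of_eq_off (B := N) (i := v)
      (g := fun i => Nat.fib (f 16 (f 17 i))) (g' := fun i => Nat.fib (f' 16 (f 17 i)))
      hvN (fun j hj hne => by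
        simp only [h16]
        rw [if_neg]
        intro he
        exact hne (by rw [← hv, ← he, (h.node j (he ▸ hx0)).2.1]))
    simp only [hx, h16 x, if_true, hr, hfull, hy, if_neg hy0, h11 r] at hs hA' hV
    -- The weight is unchanged: two roots of rank `r` and the term of `v` give `2 F(r+1) + F(r)`;
    -- afterwards there are one root of rank `r+1` and the new term of `v`, together `F(r+2) +
    -- F(r+1)`.
    have hf := Nat.fib_add_two (n := r)
    rw [heapWeight, heapWeight, h7, e10, e17]
    rw [show r + 1 + 1 = r + 2 by rfl] at hs
    omega
  · have hA' := sum_range_eq_add_of_eq_off (B := W) (i := r)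
      (g := fun i => if f 11 i = 0 then 0 else 1)
      (g' := fun i => if f' 11 i = 0 then 0 else 1)
      hrW (fun j _ hj => by simp [h11, hj])
    simp only [hy, if_neg hy0, h11 r, if_true] at hA'
    rw [heapPot, heapPot, h7, e13, e14]
    omega

/-- A root moves from the array to the stack. -/
theorem pushback (h : HeapInv N W f key) {r y : ℕ} (hy : f 11 r = y) (hy0 : y ≠ 0)
    (h10 : ∀ i, f' 10 i = if i = f 7 0 then y else f 10 i)
    (h11 : ∀ i, f' 11 i = if i = r then 0 else f 11 i)
    (h70 : f' 7 0 = f 7 0 + 1) (h71 : f' 7 1 = f 7 1) (h72 : f' 7 2 = f 7 2)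
    (same : ∀ a, 12 ≤ a → a ≤ 17 → f' a = f a) :
    HeapInv N W f' key ∧ heapPot W f' = heapPot W f + 1 := by
  obtain ⟨hyr, hyf, hy2, hrW⟩ := h.root r (hy ▸ hy0)
  rw [hy] at hyr hyf
  have hs0 : f 10 (f 7 0) = 0 := by
    by_contra hne
    exact absurd ((h.stack _).1 hne) (lt_irrefl _)
  obtain ⟨hp, hl⟩ := h.placed.move (f' := f') (a := 11) (i := r) (b := 10) (j := f 7 0)
    (by omega) (by omega) (by omega) (by omega) hs0 (hy ▸ hy0) (by
      intro c k hc hc'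
      obtain rfl | rfl | hc2 : c = 10 ∨ c = 11 ∨ 12 ≤ c := by omega
      · simp [h10, hy]
      · simp [h11]
      · rw [same c hc2 (by omega)]
        simp [show c ≠ 10 by omega, show c ≠ 11 by omega])
  have e12 := same 12 (by omega) (by omega)
  have e13 := same 13 (by omega) (by omega)
  have e14 := same 14 (by omega) (by omega)
  have e15 := same 15 (by omega) (by omega)
  have e16 := same 16 (by omega) (by omega)
  have e17 := same 17 (by omega) (by omega)
  refine ⟨⟨?_, ?_, ?_, ?_, ?_, ?_, ?_, ?_, hp, ?_, ?_, ?_⟩, ?_⟩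
  · intro i
    have := h.stack i
    grind
  · intro i hi
    have := h.root i
    grind
  · rw [e12, e16, e17]
    exact h.kid
  · rw [e12, e16, e17]
    exact h.kids
  · intro x hx
    rw [e13] at hx
    have := h.hollow₁ x hx
    rw [hl x this.1, e13, e15, e16, e17]
    exact this
  · rw [e13, e14, e16]
    exact h.hollow₂
  · intro v hv
    rw [e17] at hv
    rw [e17, e15, hl _ hv]
    exact h.node v hv
  · intro a i ha ha'
    have := h.le a i ha ha'
    have := h.le 11 r (by omega) (by omega)
    rw [h71]
    obtain rfl | rfl | hc2 : a = 10 ∨ a = 11 ∨ 12 ≤ a := by omega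
    · grind
    · grind
    · rw [same a hc2 (by omega)]
      omega
  · rw [e16]
    exact h.rank_zero
  · rw [h71]
    exact h.count
  · rw [h71]
    refine le_trans (le_of_eq ?_) h.weight
    have hs := Finset.sum_range_succ (fun i => Nat.fib (f 16 (f' 10 i) + 1)) (f 7 0)
    rw [h10 (f 7 0), if_pos rfl, hyr] at hs
    have hs' : ∑ i ∈ Finset.range (f 7 0), Nat.fib (f 16 (f' 10 i) + 1) =
        ∑ i ∈ Finset.range (f 7 0), Nat.fib (f 16 (f 10 i) + 1) :=
      sum_range_congr fun j hj => by rw [h10, if_neg (by omega)]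
    have hA' := sum_range_eq_add_of_eq_off (B := W) (i := r)
      (g := fun i => if f 11 i = 0 then 0 else Nat.fib (i + 1))
      (g' := fun i => if f' 11 i = 0 then 0 else Nat.fib (i + 1))
      hrW (fun j _ hj => by simp [h11, hj])
    simp only [hy, if_neg hy0, h11 r, if_true] at hA'
    rw [heapWeight, heapWeight, h70, e16, e17]
    omega
  · have hA' := sum_range_eq_add_of_eq_off (B := W) (i := r)
      (g := fun i => if f 11 i = 0 then 0 else 1)
      (g' := fun i => if f' 11 i = 0 then 0 else 1)
      hrW (fun j _ hj => by simp [h11, hj])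
    simp only [hy, if_neg hy0, h11 r, if_true] at hA'
    rw [heapPot, heapPot, h70, e13, e14]
    omega

end HeapInv

/-! ### Hollow roots, release of children, removal of a vertex -/

namespace HeapInv

variable {N W : ℕ} {f f' : ℕ → ℕ → ℕ} {key : ℕ → ℝ}

/-- A hollow root without children is dropped. -/
theorem drop (h : HeapInv N W f key) (ht : 0 < f 7 0) {x : ℕ} (hx : f 10 (f 7 0 - 1) = x)
    (hhol : f 17 (f 15 x) ≠ x) (h13 : f 13 x = 0)
    (h10 : ∀ i, f' 10 i = if i = f 7 0 - 1 then 0 else f 10 i)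
    (h70 : f' 7 0 = f 7 0 - 1) (h71 : f' 7 1 = f 7 1) (h72 : f' 7 2 = f 7 2)
    (same : ∀ a, 11 ≤ a → a ≤ 17 → f' a = f a) :
    HeapInv N W f' key ∧ heapPot W f' < heapPot W f := by
  have hx0 : x ≠ 0 := hx ▸ (h.stack _).2 (by omega)
  obtain ⟨hp, hl⟩ := h.placed.clear (f' := f') (a := 10) (i := f 7 0 - 1)
    (by omega) (by omega) (hx ▸ hx0) (by
      intro c k hc hc'
      obtain rfl | hc2 : c = 10 ∨ 11 ≤ c := by omega
      · simp [h10]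
      · rw [same c hc2 (by omega)]
        simp [show c ≠ 10 by omega])
  have e11 := same 11 (by omega) (by omega)
  have e12 := same 12 (by omega) (by omega)
  have e13 := same 13 (by omega) (by omega)
  have e14 := same 14 (by omega) (by omega)
  have e15 := same 15 (by omega) (by omega)
  have e16 := same 16 (by omega) (by omega)
  have e17 := same 17 (by omega) (by omega)
  refine ⟨⟨?_, ?_, ?_, ?_, ?_, ?_, ?_, ?_, hp, ?_, ?_, ?_⟩, ?_⟩
  · intro i
    have := h.stack i
    grind
  · rw [e11, e15, e16, e17, h72]
    exact h.root
  · rw [e12, e16, e17]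
    exact h.kid
  · rw [e12, e16, e17]
    exact h.kids
  · intro u hu
    rw [e13] at hu
    have := h.hollow₁ u hu
    rw [hl u this.1, e13, e15, e16, e17, hx]
    refine ⟨this.1, ⟨this.2.1, ?_⟩, this.2.2⟩
    rintro rfl
    exact hu h13
  · rw [e13, e14, e16]
    exact h.hollow₂
  · intro v hv
    rw [e17] at hv
    rw [e17, e15, hl _ hv, hx]
    obtain ⟨h1, h2, h3⟩ := h.node v hv
    exact ⟨h1, h2, h3, fun he => hhol (by rw [← he, h2])⟩
  · intro a i ha ha'
    have := h.le a i ha ha'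
    rw [h71]
    obtain rfl | hc2 : a = 10 ∨ 11 ≤ a := by omega
    · grind
    · rw [same a hc2 (by omega)]
      omega
  · rw [e16]
    exact h.rank_zero
  · rw [h71]
    exact h.count
  · rw [h71]
    refine le_trans ?_ h.weight
    have hs := Finset.sum_range_succ (fun i => Nat.fib (f 16 (f 10 i) + 1)) (f 7 0 - 1)
    rw [show f 7 0 - 1 + 1 = f 7 0 by omega] at hs
    have hs' : ∑ i ∈ Finset.range (f 7 0 - 1), Nat.fib (f 16 (f' 10 i) + 1) =
        ∑ i ∈ Finset.range (f 7 0 - 1), Nat.fib (f 16 (f 10 i) + 1) :=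
      sum_range_congr fun j hj => by rw [h10, if_neg (by omega)]
    rw [heapWeight, heapWeight, h70, e11, e16, e17]
    omega
  · rw [heapPot, heapPot, h70, e11, e13, e14]
    omega

/-- A hollow root is replaced by its children. -/
theorem expose₁ (h : HeapInv N W f key) (ht : 0 < f 7 0) {x y : ℕ} (hx : f 10 (f 7 0 - 1) = x)
    (hhol : f 17 (f 15 x) ≠ x) (hy : f 13 x = y) (hy0 : y ≠ 0) (hx14 : f 14 x = 0)
    (h10 : ∀ i, f' 10 i = if i = f 7 0 - 1 then y else f 10 i)
    (h13 : ∀ i, f' 13 i = if i = x then 0 else f 13 i) (h7 : f' 7 = f 7)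
    (same : ∀ a, a = 11 ∨ a = 12 ∨ 14 ≤ a → a ≤ 17 → f' a = f a) :
    HeapInv N W f' key ∧ heapPot W f' < heapPot W f := by
  have hx0 : x ≠ 0 := hx ▸ (h.stack _).2 (by omega)
  obtain ⟨hp1, hl1⟩ := h.placed.clear (f' := upd f 10 (f 7 0 - 1) 0) (a := 10) (i := f 7 0 - 1)
    (by omega) (by omega) (hx ▸ hx0) (fun c k _ _ => rfl)
  obtain ⟨hp, hl'⟩ := hp1.move (f' := f') (a := 13) (i := x) (b := 10) (j := f 7 0 - 1)
    (by omega) (by omega) (by omega) (by omega) (by simp [upd]) (by simpa [upd, hy]) (by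
      intro c k hc hc'
      obtain rfl | rfl | hc2 : c = 10 ∨ c = 13 ∨ (c = 11 ∨ c = 12 ∨ 14 ≤ c) := by omega
      · simp only [h10, upd]
        grind
      · simp only [h13, upd]
        grind
      · rw [same c hc2 (by omega)]
        simp [upd, show c ≠ 10 by omega, show c ≠ 13 by omega])
  have hl : ∀ u, u ≠ 0 → (Located f' u ↔ Located f u ∧ u ≠ x) := by
    intro u hu
    rw [hl' u hu, hl1 u hu, hx]
  have e11 := same 11 (by omega) (by omega)
  have e12 := same 12 (by omega) (by omega)
  have e14 := same 14 (by omega) (by omega)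
  have e15 := same 15 (by omega) (by omega)
  have e16 := same 16 (by omega) (by omega)
  have e17 := same 17 (by omega) (by omega)
  have hx1 := h.hollow₁ x (hy ▸ hy0)
  have hxW : x < W := by
    have := h.count
    have := h.le 10 (f 7 0 - 1) (by omega) (by omega)
    omega
  refine ⟨⟨?_, ?_, ?_, ?_, ?_, ?_, ?_, ?_, hp, ?_, ?_, ?_⟩, ?_⟩
  · intro i
    have := h.stack i
    grind
  · rw [e11, e15, e16, e17, h7]
    exact h.root
  · rw [e12, e16, e17]
    exact h.kid
  · rw [e12, e16, e17]
    exact h.kids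
  · intro u hu
    have hux : u ≠ x := by
      rintro rfl
      exact hu (by rw [h13, if_pos rfl])
    rw [h13, if_neg hux] at hu
    have := h.hollow₁ u hu
    rw [hl u this.1, h13, if_neg hux, e15, e16, e17]
    exact ⟨this.1, ⟨this.2.1, hux⟩, this.2.2⟩
  · intro u hu
    rw [e14] at hu
    have hux : u ≠ x := by
      rintro rfl
      exact hu hx14
    rw [e14, e16, h13, if_neg hux]
    exact h.hollow₂ u hu
  · intro v hv
    rw [e17] at hv
    rw [e17, e15, hl _ hv]
    obtain ⟨h1, h2, h3⟩ := h.node v hv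
    exact ⟨h1, h2, h3, fun he => hhol (by rw [← he, h2])⟩
  · intro a i ha ha'
    have := h.le a i ha ha'
    have := h.le 13 x (by omega) (by omega)
    rw [h7]
    obtain rfl | rfl | hc2 : a = 10 ∨ a = 13 ∨ (a = 11 ∨ a = 12 ∨ 14 ≤ a) := by omega
    · grind
    · grind
    · rw [same a hc2 (by omega)]
      omega
  · rw [e16]
    exact h.rank_zero
  · rw [h7]
    exact h.count
  · rw [h7]
    refine le_trans ?_ h.weight
    have hs := sum_range_eq_add_of_eq_off (B := f 7 0) (i := f 7 0 - 1)
      (g := fun i => Nat.fib (f 16 (f 10 i) + 1)) (g' := fun i => Nat.fib (f 16 (f' 10 i) + 1))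
      (by omega) (fun j hj hne => by simp only [h10, if_neg hne])
    simp only [h10 (f 7 0 - 1), if_true, hx] at hs
    have hm : Nat.fib (f 16 y + 1) ≤ Nat.fib (f 16 x + 1) := by
      rw [hy] at hx1
      exact Nat.fib_mono (by omega)
    rw [heapWeight, heapWeight, h7, e11, e16, e17]
    omega
  · have hA' := sum_range_eq_add_of_eq_off (B := W) (i := x)
      (g := fun i => if f 13 i = 0 then 0 else 1)
      (g' := fun i => if f' 13 i = 0 then 0 else 1)
      hxW (fun j _ hj => by simp [h13, hj])
    simp only [hy, if_neg hy0, h13 x, if_true] at hA'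
    rw [heapPot, heapPot, h7, e11, e14]
    omega

/-- A hollow root is replaced by its children. -/
theorem expose₂ (h : HeapInv N W f key) (ht : 0 < f 7 0) {x y z : ℕ}
    (hx : f 10 (f 7 0 - 1) = x)
    (hhol : f 17 (f 15 x) ≠ x) (hy : f 13 x = y) (hz : f 14 x = z) (hz0 : z ≠ 0)
    (h10 : ∀ i, f' 10 i = if i = f 7 0 then z else if i = f 7 0 - 1 then y else f 10 i)
    (h13 : ∀ i, f' 13 i = if i = x then 0 else f 13 i)
    (h14 : ∀ i, f' 14 i = if i = x then 0 else f 14 i)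
    (h70 : f' 7 0 = f 7 0 + 1) (h71 : f' 7 1 = f 7 1) (h72 : f' 7 2 = f 7 2)
    (same : ∀ a, a = 11 ∨ a = 12 ∨ 15 ≤ a → a ≤ 17 → f' a = f a) :
    HeapInv N W f' key ∧ heapPot W f' < heapPot W f := by
  have hx0 : x ≠ 0 := hx ▸ (h.stack _).2 (by omega)
  have hs0 : f 10 (f 7 0) = 0 := by
    by_contra hne
    exact absurd ((h.stack _).1 hne) (lt_irrefl _)
  obtain ⟨hy0, hzr, -⟩ := h.hollow₂ x (hz ▸ hz0)
  have hx1 := h.hollow₁ x hy0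
  rw [hy] at hy0
  have hne : f 7 0 ≠ f 7 0 - 1 := by omega
  obtain ⟨hp1, hl1⟩ := h.placed.clear (f' := upd f 10 (f 7 0 - 1) 0) (a := 10) (i := f 7 0 - 1)
    (by omega) (by omega) (hx ▸ hx0) (fun c k _ _ => rfl)
  obtain ⟨hp2, hl2⟩ := hp1.move (f' := upd (upd f 10 (f 7 0 - 1) y) 13 x 0)
    (a := 13) (i := x) (b := 10) (j := f 7 0 - 1)
    (by omega) (by omega) (by omega) (by omega) (by simp [upd]) (by simpa [upd, hy]) (by
      intro c k hc hc'
      simp only [upd]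
      grind)
  obtain ⟨hp, hl'⟩ := hp2.move (f' := f')
    (a := 14) (i := x) (b := 10) (j := f 7 0)
    (by omega) (by omega) (by omega) (by omega) (by simp [upd, hs0, hne])
    (by simpa [upd, hz]) (by
      intro c k hc hc'
      obtain rfl | rfl | rfl | hc2 : c = 10 ∨ c = 13 ∨ c = 14 ∨ (c = 11 ∨ c = 12 ∨ 15 ≤ c) := by
        omega
      · simp only [h10, upd]
        grind
      · simp only [h13, upd]
        grind
      · simp only [h14, upd]
        grind
      · rw [same c hc2 (by omega)]
        simp [upd, show c ≠ 10 by omega, show c ≠ 13 by omega, show c ≠ 14 by omega])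
  have hl : ∀ u, u ≠ 0 → (Located f' u ↔ Located f u ∧ u ≠ x) := by
    intro u hu
    rw [hl' u hu, hl2 u hu, hl1 u hu, hx]
  have e11 := same 11 (by omega) (by omega)
  have e12 := same 12 (by omega) (by omega)
  have e15 := same 15 (by omega) (by omega)
  have e16 := same 16 (by omega) (by omega)
  have e17 := same 17 (by omega) (by omega)
  have hxW : x < W := by
    have := h.count
    have := h.le 10 (f 7 0 - 1) (by omega) (by omega)
    omega
  refine ⟨⟨?_, ?_, ?_, ?_, ?_, ?_, ?_, ?_, hp, ?_, ?_, ?_⟩, ?_⟩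
  · intro i
    have := h.stack i
    grind
  · rw [e11, e15, e16, e17, h72]
    exact h.root
  · rw [e12, e16, e17]
    exact h.kid
  · rw [e12, e16, e17]
    exact h.kids
  · intro u hu
    have hux : u ≠ x := by
      rintro rfl
      exact hu (by rw [h13, if_pos rfl])
    rw [h13, if_neg hux] at hu
    have := h.hollow₁ u hu
    rw [hl u this.1, h13, if_neg hux, e15, e16, e17]
    exact ⟨this.1, ⟨this.2.1, hux⟩, this.2.2⟩
  · intro u hu
    have hux : u ≠ x := by
      rintro rfl
      exact hu (by rw [h14, if_pos rfl])
    rw [h14, if_neg hux] at hu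
    rw [h14, e16, h13, if_neg hux, if_neg hux]
    exact h.hollow₂ u hu
  · intro v hv
    rw [e17] at hv
    rw [e17, e15, hl _ hv]
    obtain ⟨h1, h2, h3⟩ := h.node v hv
    exact ⟨h1, h2, h3, fun he => hhol (by rw [← he, h2])⟩
  · intro a i ha ha'
    have := h.le a i ha ha'
    have := h.le 13 x (by omega) (by omega)
    have := h.le 14 x (by omega) (by omega)
    rw [h71]
    obtain rfl | rfl | rfl | hc2 : a = 10 ∨ a = 13 ∨ a = 14 ∨ (a = 11 ∨ a = 12 ∨ 15 ≤ a) := by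
      omega
    · grind
    · grind
    · grind
    · rw [same a hc2 (by omega)]
      omega
  · rw [e16]
    exact h.rank_zero
  · rw [h71]
    exact h.count
  · rw [h71]
    refine le_trans ?_ h.weight
    have hs := sum_range_eq_add_of_eq_off (B := f 7 0) (i := f 7 0 - 1)
      (g := fun i => Nat.fib (f 16 (f 10 i) + 1)) (g' := fun i => Nat.fib (f 16 (f' 10 i) + 1))
      (by omega) (fun j hj hne => by simp only [h10, if_neg hne, if_neg hj.ne])
    simp only [h10 (f 7 0 - 1), if_true, hx, if_neg hne.symm] at hs
    have hs2 := Finset.sum_range_succ (fun i => Nat.fib (f 16 (f' 10 i) + 1)) (f 7 0)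
    rw [h10 (f 7 0), if_pos rfl] at hs2
    -- A hollow root of rank `ρ` has weight `F(ρ+1) = F(ρ) + F(ρ-1)`, exactly that of its children
    -- of ranks `ρ-1` and `ρ-2` as roots.
    have hm := Nat.fib_add_two (n := f 16 z + 1)
    rw [hy] at hx1
    rw [hz] at hzr
    rw [show f 16 z + 1 + 2 = f 16 x + 1 by omega, show f 16 z + 1 + 1 = f 16 y + 1 by omega] at hm
    rw [heapWeight, heapWeight, h70, e11, e16, e17]
    omega
  · have hA' := sum_range_eq_add_of_eq_off (B := W) (i := x)
      (g := fun i => if f 13 i = 0 then 0 else 1)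
      (g' := fun i => if f' 13 i = 0 then 0 else 1)
      hxW (fun j _ hj => by simp [h13, hj])
    have hA2 := sum_range_eq_add_of_eq_off (B := W) (i := x)
      (g := fun i => if f 14 i = 0 then 0 else 1)
      (g' := fun i => if f' 14 i = 0 then 0 else 1)
      hxW (fun j _ hj => by simp [h14, hj])
    simp only [hy, if_neg hy0, h13 x, hz, if_neg hz0, h14 x, if_true] at hA' hA2
    rw [heapPot, heapPot, h70, e11]
    omega

/-- The full root on the top of the stack gives up its child of the largest rank. -/
theorem unlink (h : HeapInv N W f key) (ht : 0 < f 7 0) {x y r v : ℕ}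
    (hx : f 10 (f 7 0 - 1) = x)
    (hr : f 16 x = r + 1) (hv : f 15 x = v) (hfull : f 17 v = x) (hy : f 12 (v * W + r) = y)
    (h10 : ∀ i, f' 10 i = if i = f 7 0 then x else if i = f 7 0 - 1 then y else f 10 i)
    (h12 : ∀ j, f' 12 j = if j = v * W + r then 0 else f 12 j)
    (h16 : ∀ u, f' 16 u = if u = x then r else f 16 u)
    (h70 : f' 7 0 = f 7 0 + 1) (h71 : f' 7 1 = f 7 1) (h72 : f' 7 2 = f 7 2)
    (same : ∀ a, a = 11 ∨ a = 13 ∨ a = 14 ∨ a = 15 ∨ a = 17 → f' a = f a) :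
    HeapInv N W f' key ∧ heapPot W f' = heapPot W f + 2 := by
  have hx0 : x ≠ 0 := hx ▸ (h.stack _).2 (by omega)
  have hs0 : f 10 (f 7 0) = 0 := by
    by_contra hne
    exact absurd ((h.stack _).1 hne) (lt_irrefl _)
  have hne : f 7 0 ≠ f 7 0 - 1 := by omega
  have hrW : r + 1 < W := by
    have := h.rank_lt (v := v) (hfull ▸ hx0)
    rwa [hfull, hr] at this
  have hy0 : y ≠ 0 := by
    rw [← hy]
    exact h.kids v r (hfull ▸ hx0) (by rw [hfull, hr]; omega)
  obtain ⟨-, -, hyr, -⟩ := h.kid_spec (by omega) (hy ▸ hy0)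
  rw [hy] at hyr
  obtain ⟨hp1, hl1⟩ := h.placed.move (f' := upd (upd f 10 (f 7 0) x) 10 (f 7 0 - 1) 0)
    (a := 10) (i := f 7 0 - 1) (b := 10) (j := f 7 0)
    (by omega) (by omega) (by omega) (by omega) hs0 (hx ▸ hx0) (by
      intro c k hc hc'
      simp only [upd]
      grind)
  obtain ⟨hp, hl'⟩ := hp1.move (f' := f')
    (a := 12) (i := v * W + r) (b := 10) (j := f 7 0 - 1)
    (by omega) (by omega) (by omega) (by omega) (by simp [upd])
    (by simpa [upd, hy]) (by
      intro c k hc hc'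
      obtain rfl | rfl | hc2 : c = 10 ∨ c = 12 ∨ (c = 11 ∨ c = 13 ∨ c = 14) := by
        omega
      · simp only [h10, upd]
        grind
      · simp only [h12, upd]
        grind
      · rw [same c (by omega)]
        simp [upd, show c ≠ 10 by omega, show c ≠ 12 by omega])
  have hl : ∀ u, u ≠ 0 → (Located f' u ↔ Located f u) := by
    intro u hu
    rw [hl' u hu, hl1 u hu]
  have e11 := same 11 (by omega)
  have e13 := same 13 (by omega)
  have e14 := same 14 (by omega)
  have e15 := same 15 (by omega)
  have e17 := same 17 (by omega)
  have hxu : ∀ a i, 10 ≤ a → a ≤ 14 → f a i = x → a = 10 ∧ i = f 7 0 - 1 := by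
    intro a i ha ha' he
    exact h.placed a i 10 (f 7 0 - 1) ha ha' (by omega) (by omega) (he.trans hx.symm) (he ▸ hx0)
  have hyx : y ≠ x := fun he => by
    have := hxu 12 (v * W + r) (by omega) (by omega) (hy.trans he)
    omega
  refine ⟨⟨?_, ?_, ?_, ?_, ?_, ?_, ?_, ?_, hp, ?_, ?_, ?_⟩, ?_⟩
  · intro i
    have := h.stack i
    grind
  · intro i hi
    rw [e11] at hi
    have := hxu 11 i (by omega) (by omega)
    rw [e11, e15, e17, h72, h16, if_neg (by omega)]
    exact h.root i hi
  · intro j hj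
    have hj' : j ≠ v * W + r := by
      rintro rfl
      exact hj (by rw [h12, if_pos rfl])
    rw [h12, if_neg hj'] at hj ⊢
    obtain ⟨w, i, h1, h2, h3, h4, h5⟩ := h.kid j hj
    refine ⟨w, i, h1, ?_⟩
    have hjx : f 12 j ≠ x := fun he => by
      have := hxu 12 j (by omega) (by omega) he
      omega
    rw [e17, h16, h16, if_neg hjx]
    refine ⟨h2, ?_, h4, h5⟩
    split_ifs with he
    · have hwv : w = v := by rw [← hv, ← he, (h.node w h2).2.1]
      rw [he, hr] at h3
      have : i ≠ r := by
        rintro rfl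
        exact hj' (by rw [h1, hwv])
      omega
    · exact h3
  · intro w i hw hi
    rw [e17] at hw hi
    rw [h16] at hi
    have hi' : i < f 16 (f 17 w) := by
      split_ifs at hi with hwx
      · rw [hwx]
        omega
      · exact hi
    rw [h12, if_neg]
    · exact h.kids w i hw hi'
    · intro he
      obtain ⟨rfl, rfl⟩ := address_inj (hi'.trans (h.rank_lt hw)) (by omega) he
      rw [if_pos hfull] at hi
      omega
  · intro u hu
    rw [e13] at hu
    have := h.hollow₁ u hu
    have hux : u ≠ x := by
      rintro rfl
      exact this.2.2.1 (by rw [hv, hfull])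
    have hux' := hxu 13 u (by omega) (by omega)
    rw [hl u this.1, e13, e15, h16, h16, e17, if_neg hux, if_neg (by omega)]
    exact this
  · intro u hu
    rw [e14] at hu
    have h1 := h.hollow₂ u hu
    have := h.hollow₁ u h1.1
    have hux : u ≠ x := by
      rintro rfl
      exact this.2.2.1 (by rw [hv, hfull])
    have hux' := hxu 14 u (by omega) (by omega)
    rw [e13, e14, h16, h16, if_neg hux, if_neg (by omega)]
    exact h1
  · intro v hv
    rw [e17] at hv
    rw [e17, e15, hl _ hv]
    exact h.node v hv
  · intro a i ha ha'
    have := h.le a i ha ha'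
    have := h.le 12 (v * W + r) (by omega) (by omega)
    have := h.le 10 (f 7 0 - 1) (by omega) (by omega)
    rw [h71]
    obtain rfl | rfl | hc2 : a = 10 ∨ a = 12 ∨ (a = 11 ∨ a = 13 ∨ a = 14) := by omega
    · grind
    · grind
    · rw [same a (by omega)]
      omega
  · rw [h16, if_neg hx0.symm]
    exact h.rank_zero
  · rw [h71]
    exact h.count
  · rw [h71]
    refine le_trans (le_of_eq ?_) h.weight
    have hs := sum_range_eq_add_of_eq_off (B := f 7 0) (i := f 7 0 - 1)
      (g := fun i => Nat.fib (f 16 (f 10 i) + 1)) (g' := fun i => Nat.fib (f' 16 (f' 10 i) + 1))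
      (by omega) (fun j hj hne => by
        simp only [h16, h10, if_neg hj.ne, if_neg hne]
        rw [if_neg fun he => hne (hxu 10 j (by omega) (by omega) he).2])
    have hs2 := Finset.sum_range_succ (fun i => Nat.fib (f' 16 (f' 10 i) + 1)) (f 7 0)
    rw [h10 (f 7 0), if_pos rfl, h16, if_pos rfl] at hs2
    have hvN : v < N := (h.node v (hfull ▸ hx0)).1
    have hV := sum_range_eq_add_of_eq_off (B := N) (i := v)
      (g := fun i => Nat.fib (f 16 (f 17 i))) (g' := fun i => Nat.fib (f' 16 (f 17 i)))
      hvN (fun j hj hne => by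
        simp only [h16]
        rw [if_neg]
        intro he
        exact hne (by rw [← hv, ← he, (h.node j (he ▸ hx0)).2.1]))
    simp only [hx, h16 x, h16 y, h10 (f 7 0 - 1), if_true, hr, hfull, if_neg hyx, if_neg hne.symm,
      hyr] at hs hV
    -- The balance of `link` read backwards.
    have hf := Nat.fib_add_two (n := r)
    rw [heapWeight, heapWeight, h70, e11, e17]
    rw [show r + 1 + 1 = r + 2 by rfl] at hs
    omega
  · rw [heapPot, heapPot, h70, e11, e13, e14]
    omega

/-- A full root of rank `0` on the top of the stack is removed from the queue. -/
theorem remove (h : HeapInv N W f key) (ht : 0 < f 7 0) {x v : ℕ}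
    (hx : f 10 (f 7 0 - 1) = x)
    (hr : f 16 x = 0) (hv : f 15 x = v) (hfull : f 17 v = x)
    (h10 : ∀ i, f' 10 i = if i = f 7 0 - 1 then 0 else f 10 i)
    (h17 : ∀ u, f' 17 u = if u = v then 0 else f 17 u)
    (hA : ∀ i, f 11 i = 0)
    (h70 : f' 7 0 = f 7 0 - 1) (h71 : f' 7 1 = f 7 1)
    (same : ∀ a, 11 ≤ a → a ≤ 16 → f' a = f a) :
    HeapInv N W f' key ∧ heapPot W f' < heapPot W f := by
  have hx0 : x ≠ 0 := hx ▸ (h.stack _).2 (by omega)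
  obtain ⟨hp, hl⟩ := h.placed.clear (f' := f') (a := 10) (i := f 7 0 - 1)
    (by omega) (by omega) (hx ▸ hx0) (by
      intro c k hc hc'
      obtain rfl | hc2 : c = 10 ∨ 11 ≤ c := by omega
      · simp [h10]
      · rw [same c hc2 (by omega)]
        simp [show c ≠ 10 by omega])
  have e11 := same 11 (by omega) (by omega)
  have e12 := same 12 (by omega) (by omega)
  have e13 := same 13 (by omega) (by omega)
  have e14 := same 14 (by omega) (by omega)
  have e15 := same 15 (by omega) (by omega)
  have e16 := same 16 (by omega) (by omega)
  have hx13 : f 13 x = 0 := by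
    by_contra hne
    exact (h.hollow₁ x hne).2.2.1 (by rw [hv, hfull])
  refine ⟨⟨?_, ?_, ?_, ?_, ?_, ?_, ?_, ?_, hp, ?_, ?_, ?_⟩, ?_⟩
  · intro i
    have := h.stack i
    grind
  · intro i hi
    rw [e11] at hi
    exact absurd (hA i) hi
  · intro j hj
    rw [e12] at hj
    obtain ⟨w, i, h1, h2, h3, h4, h5⟩ := h.kid j hj
    have hwv : w ≠ v := by
      rintro rfl
      rw [hfull, hr] at h3
      omega
    refine ⟨w, i, h1, ?_⟩
    rw [h17, if_neg hwv, e12, e16]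
    exact ⟨h2, h3, h4, h5⟩
  · intro w i hw hi
    have hwv : w ≠ v := by
      rintro rfl
      exact hw (by rw [h17, if_pos rfl])
    rw [h17, if_neg hwv] at hw hi
    rw [e16] at hi
    rw [e12]
    exact h.kids w i hw hi
  · intro u hu
    rw [e13] at hu
    obtain ⟨h1, h2, h3, h4⟩ := h.hollow₁ u hu
    rw [hl u h1, e13, e15, e16, hx, h17]
    refine ⟨h1, ⟨h2, ?_⟩, ?_, h4⟩
    · rintro rfl
      exact hu hx13
    · split_ifs
      · exact h1.symm
      · exact h3
  · rw [e13, e14, e16]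
    exact h.hollow₂
  · intro w hw
    have hwv : w ≠ v := by
      rintro rfl
      exact hw (by rw [h17, if_pos rfl])
    rw [h17, if_neg hwv] at hw
    rw [h17, if_neg hwv, e15, hl _ hw, hx]
    obtain ⟨h1, h2, h3⟩ := h.node w hw
    refine ⟨h1, h2, h3, fun he => hwv ?_⟩
    rw [← h2, he, hv]
  · intro a i ha ha'
    have := h.le a i ha ha'
    rw [h71]
    obtain rfl | hc2 : a = 10 ∨ 11 ≤ a := by omega
    · grind
    · rw [same a hc2 (by omega)]
      omega
  · rw [e16]
    exact h.rank_zero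
  · rw [h71]
    exact h.count
  · rw [h71]
    refine le_trans ?_ h.weight
    have hs := Finset.sum_range_succ (fun i => Nat.fib (f 16 (f 10 i) + 1)) (f 7 0 - 1)
    rw [show f 7 0 - 1 + 1 = f 7 0 by omega] at hs
    have hs' : ∑ i ∈ Finset.range (f 7 0 - 1), Nat.fib (f 16 (f' 10 i) + 1) =
        ∑ i ∈ Finset.range (f 7 0 - 1), Nat.fib (f 16 (f 10 i) + 1) :=
      sum_range_congr fun j hj => by rw [h10, if_neg (by omega)]
    have hV : ∑ i ∈ Finset.range N, Nat.fib (f 16 (f' 17 i)) ≤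
        ∑ i ∈ Finset.range N, Nat.fib (f 16 (f 17 i)) := by
      refine Finset.sum_le_sum fun i _ => Nat.fib_mono ?_
      rw [h17]
      split_ifs
      · rw [h.rank_zero]
        exact Nat.zero_le _
      · exact le_rfl
    rw [heapWeight, heapWeight, h70, e11, e16]
    omega
  · rw [heapPot, heapPot, h70, e11, e13, e14]
    omega

end HeapInv

theorem Placed.congr {f f' : ℕ → ℕ → ℕ} (h : Placed f)
    (hf : ∀ c k, 10 ≤ c → c ≤ 14 → f' c k = f c k) :
    Placed f' ∧ ∀ y, Located f' y ↔ Located f y := by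
  refine ⟨fun a i b j ha ha' hb hb' => ?_, fun y => ⟨?_, ?_⟩⟩
  · rw [hf a i ha ha', hf b j hb hb']
    exact h a i b j ha ha' hb hb'
  · rintro ⟨a, i, ha, ha', rfl⟩
    exact ⟨a, i, ha, ha', (hf a i ha ha').symm⟩
  · rintro ⟨a, i, ha, ha', rfl⟩
    exact ⟨a, i, ha, ha', hf a i ha ha'⟩

/-! ### Insertion and decrease of a key; the order of the heap -/

namespace HeapInv

variable {N W : ℕ} {f f' : ℕ → ℕ → ℕ} {key key' : ℕ → ℝ}

theorem le_of_located (h : HeapInv N W f key) {y : ℕ} (hy : Located f y) : y ≤ f 7 1 := by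
  obtain ⟨a, i, ha, ha', rfl⟩ := hy
  exact h.le a i ha ha'

/-- The vertex `u` is inserted with the key `d`, or its key is decreased to `d`. -/
theorem create (h : HeapInv N W f key) {u x r z : ℕ} {d : ℝ} (hu : u < N)
    (hx : f 17 u = x) (hr : f 16 x = r) (hz : f 7 1 + 1 = z) (hW : f 7 1 + 3 ≤ W)
    (hA : ∀ i, f 11 i = 0) (hd : x ≠ 0 → d ≤ key x)
    (hkey : ∀ y, key' y = if y = z then d else key y)
    (h10 : ∀ i, f' 10 i = if i = f 7 0 then z else f 10 i)
    (h12 : ∀ j, f' 12 j = if 1 ≤ r ∧ j = u * W + (r - 1) then 0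
      else if 2 ≤ r ∧ j = u * W + (r - 2) then 0 else f 12 j)
    (h13 : ∀ i, f' 13 i = if 1 ≤ r ∧ i = x then f 12 (u * W + (r - 1)) else f 13 i)
    (h14 : ∀ i, f' 14 i = if 2 ≤ r ∧ i = x then f 12 (u * W + (r - 2)) else f 14 i)
    (h15 : ∀ i, f' 15 i = if i = z then u else f 15 i)
    (h16 : ∀ i, f' 16 i = if i = z then r - 2 else f 16 i)
    (h17 : ∀ i, f' 17 i = if i = u then z else f 17 i)
    (h70 : f' 7 0 = f 7 0 + 1) (h71 : f' 7 1 = f 7 1 + 1) (h11 : f' 11 = f 11) :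
    HeapInv N W f' key' ∧ heapPot W f' ≤ heapPot W f + 6 := by
  have hs0 : f 10 (f 7 0) = 0 := by
    by_contra hne
    exact absurd ((h.stack _).1 hne) (lt_irrefl _)
  have hrx : 1 ≤ r → x ≠ 0 := by
    rintro h1 rfl
    rw [h.rank_zero] at hr
    omega
  have hrW : r < W := by
    by_cases h1 : 1 ≤ r
    · have := h.rank_lt (v := u) (hx ▸ hrx h1)
      rwa [hx, hr] at this
    · omega
  have hz0 : z ≠ 0 := by omega
  have hle : ∀ a i, 10 ≤ a → a ≤ 14 → f a i < z := fun a i ha ha' => by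
    have := h.le a i ha ha'
    omega
  have hLz : ∀ y, Located f y → y ≠ z := fun y hy => by
    have := h.le_of_located hy
    omega
  have hnz : ∀ w, f 17 w ≠ z := by
    intro w
    by_cases hw : f 17 w = 0
    · rw [hw]
      exact hz0.symm
    · exact hLz _ (h.node w hw).2.2
  have hxz : x ≠ z := hx ▸ hnz u
  have hx15 : x ≠ 0 → f 15 x = u := fun hx0 => by
    have := (h.node u (hx ▸ hx0)).2.1
    rwa [hx] at this
  have hx13 : f 13 x = 0 := by
    by_contra hne
    obtain ⟨h1, h2, h3, -⟩ := h.hollow₁ x hne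
    exact h3 (by rw [hx15 h1, hx])
  have hx14 : f 14 x = 0 := by
    by_contra hne
    exact (h.hollow₂ x hne).1 hx13
  have hk1 : 1 ≤ r → f 12 (u * W + (r - 1)) ≠ 0 := fun h1 =>
    h.kids u (r - 1) (hx ▸ hrx h1) (by rw [hx, hr]; omega)
  have hk2 : 2 ≤ r → f 12 (u * W + (r - 2)) ≠ 0 := fun h1 =>
    h.kids u (r - 2) (hx ▸ hrx (by omega)) (by rw [hx, hr]; omega)
  obtain ⟨hp1, hl1⟩ := h.placed.insert (f' := upd f 10 (f 7 0) z) (a := 10) (i := f 7 0) (z := z)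
    (by omega) (by omega) hs0 (fun hz => hLz z hz rfl) (fun c k _ _ => rfl)
  -- The change is decomposed into an insertion and up to two moves. The old node has children to
  -- keep only if its rank is at least `1` or `2`, hence the intermediate function.
  obtain ⟨f2, hf2, hp2, hl2⟩ : ∃ f2, f2 = (if 1 ≤ r then
      upd (upd (upd f 10 (f 7 0) z) 13 x (f 12 (u * W + (r - 1)))) 12 (u * W + (r - 1)) 0
      else upd f 10 (f 7 0) z) ∧ Placed f2 ∧
      ∀ y, y ≠ 0 → (Located f2 y ↔ Located f y ∨ y = z) := by
    refine ⟨_, rfl, ?_⟩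
    split_ifs with h1
    · obtain ⟨hp, hl⟩ := hp1.move
        (f' := upd (upd (upd f 10 (f 7 0) z) 13 x (f 12 (u * W + (r - 1)))) 12 (u * W + (r - 1)) 0)
        (a := 12) (i := u * W + (r - 1)) (b := 13) (j := x)
        (by omega) (by omega) (by omega) (by omega) (by simpa [upd])
        (by simpa [upd] using hk1 h1) (by
          intro c k hc hc'
          simp only [upd]
          grind)
      exact ⟨hp, fun y hy => by rw [hl y hy, hl1 y hy]⟩
    · exact ⟨hp1, hl1⟩
  have hl : Placed f' ∧ ∀ y, y ≠ 0 → (Located f' y ↔ Located f y ∨ y = z) := by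
    by_cases h2 : 2 ≤ r
    · rw [if_pos (by omega)] at hf2
      obtain ⟨hp, hl⟩ := hp2.move (f' := f')
        (a := 12) (i := u * W + (r - 2)) (b := 14) (j := x)
        (by omega) (by omega) (by omega) (by omega) (by simpa [hf2, upd])
        (by simpa [hf2, upd] using ⟨by omega, hk2 h2⟩) (by
          intro c k hc hc'
          obtain rfl | rfl | rfl | rfl | rfl : c = 10 ∨ c = 11 ∨ c = 12 ∨ c = 13 ∨ c = 14 := by
            omega
          · simp [h10, hf2, upd]
          · simp [h11, hf2, upd]
          · simp only [h12, hf2, upd]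
            grind
          · simp only [h13, hf2, upd]
            grind
          · simp only [h14, hf2, upd]
            grind)
      exact ⟨hp, fun y hy => by rw [hl y hy, hl2 y hy]⟩
    · obtain ⟨hp, hl⟩ := hp2.congr (f' := f') (by
        intro c k hc hc'
        obtain rfl | rfl | rfl | rfl | rfl : c = 10 ∨ c = 11 ∨ c = 12 ∨ c = 13 ∨ c = 14 := by
          omega
        · simp only [h10, hf2]
          split_ifs <;> simp_all [upd]
        · simp only [h11, hf2]
          split_ifs <;> simp_all [upd]
        · simp only [h12, hf2]
          split_ifs <;> simp_all [upd]
        · simp only [h13, hf2]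
          split_ifs <;> simp_all [upd]
        · simp only [h14, hf2]
          split_ifs <;> simp_all [upd])
      exact ⟨hp, fun y hy => by rw [hl y, hl2 y hy]⟩
  obtain ⟨hp, hl⟩ := hl
  refine ⟨⟨?_, ?_, ?_, ?_, ?_, ?_, ?_, ?_, hp, ?_, ?_, ?_⟩, ?_⟩
  · intro i
    have := h.stack i
    grind
  · intro i hi
    rw [h11] at hi
    exact absurd (hA i) hi
  · intro j hj
    have hj0 : f 12 j ≠ 0 := by
      rw [h12] at hj
      split_ifs at hj
      · exact absurd rfl hj
      · exact absurd rfl hj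
      · exact hj
    have hj1 : ¬ (1 ≤ r ∧ j = u * W + (r - 1)) := fun hc => hj (by rw [h12, if_pos hc])
    have hj2 : ¬ (2 ≤ r ∧ j = u * W + (r - 2)) := fun hc =>
      hj (by rw [h12, if_neg hj1, if_pos hc])
    have hjz := (hle 12 j (by omega) (by omega)).ne
    obtain ⟨w, i, h1, h2, h3, h4, h5⟩ := h.kid j hj0
    refine ⟨w, i, h1, ?_⟩
    rw [h12, if_neg hj1, if_neg hj2, hkey (f 12 j), if_neg hjz, h16 (f 12 j), if_neg hjz, h17]
    split_ifs with hwu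
    · subst hwu
      rw [hx, hr] at h3
      rw [hx] at h2 h5
      rw [h16, if_pos rfl, hkey, if_pos rfl]
      refine ⟨hz0, ?_, h4, (hd h2).trans h5⟩
      -- The old node keeps its children of ranks `r-1` and `r-2`; the rest have rank below `r-2`,
      -- the rank of the new node. They stay where they are, since a block of children belongs to a
      -- vertex and not to a node.
      have : i ≠ r - 1 := by
        rintro rfl
        exact hj1 ⟨by omega, h1⟩
      have : i ≠ r - 2 := by
        rintro rfl
        exact hj2 ⟨by omega, h1⟩
      omega
    · rw [h16, if_neg (hnz w), hkey, if_neg (hnz w)]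
      exact ⟨h2, h3, h4, h5⟩
  · intro w i hw hi
    rw [h17] at hw hi
    split_ifs at hw hi with hwu
    · subst hwu
      rw [h16, if_pos rfl] at hi
      rw [h12, if_neg (by omega), if_neg (by omega)]
      have h1 : 1 ≤ r := by omega
      exact h.kids w i (hx ▸ hrx h1) (by rw [hx, hr]; omega)
    · rw [h16, if_neg (hnz w)] at hi
      have hiW := hi.trans (h.rank_lt hw)
      rw [h12, if_neg, if_neg]
      · exact h.kids w i hw hi
      · rintro ⟨-, he⟩
        exact hwu (address_inj hiW (by omega) he).1
      · rintro ⟨-, he⟩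
        exact hwu (address_inj hiW (by omega) he).1
  · intro y hy
    rw [h13] at hy
    by_cases hyx : 1 ≤ r ∧ y = x
    · obtain ⟨h1, rfl⟩ := hyx
      have hy0 := hrx h1
      obtain ⟨k1, k2, k3, k4⟩ := h.kid_spec (by omega) (hk1 h1)
      rw [hx] at k4
      have hnode := h.node u (hx ▸ hy0)
      rw [hx] at hnode
      have hkz := (hle 12 (u * W + (r - 1)) (by omega) (by omega)).ne
      rw [hl y hy0, h13, if_pos ⟨h1, rfl⟩, h15, if_neg hxz, hx15 hy0, h17, if_pos rfl, h16,
        if_neg hkz, h16, if_neg hxz, hkey, hkey, if_neg hkz, if_neg hxz]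
      exact ⟨hy0, Or.inl hnode.2.2, hxz.symm, by omega, k4⟩
    · rw [if_neg hyx] at hy
      obtain ⟨h1, h2, h3, h4, h5⟩ := h.hollow₁ y hy
      have hyz := hLz y h2
      have hkz := (hle 13 y (by omega) (by omega)).ne
      rw [hl y h1, h13, if_neg hyx, h15, if_neg hyz, h17, h16, if_neg hkz, h16, if_neg hyz,
        hkey, hkey, if_neg hkz, if_neg hyz]
      refine ⟨h1, Or.inl h2, ?_, h4, h5⟩
      split_ifs
      · exact hyz.symm
      · exact h3
  · intro y hy
    rw [h14] at hy
    by_cases hyx : 2 ≤ r ∧ y = x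
    · obtain ⟨h1, rfl⟩ := hyx
      have hy0 := hrx (by omega)
      obtain ⟨k1, k2, k3, k4⟩ := h.kid_spec (by omega) (hk2 h1)
      rw [hx] at k4
      have hkz := (hle 12 (u * W + (r - 2)) (by omega) (by omega)).ne
      rw [h13, if_pos ⟨by omega, rfl⟩, h14, if_pos ⟨h1, rfl⟩, h16,
        if_neg hkz, h16, if_neg hxz, hkey, hkey, if_neg hkz, if_neg hxz]
      exact ⟨hk1 (by omega), by omega, k4⟩
    · rw [if_neg hyx] at hy
      obtain ⟨h1, h2, h3⟩ := h.hollow₂ y hy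
      have hyz := hLz y (h.hollow₁ y h1).2.1
      have hkz := (hle 14 y (by omega) (by omega)).ne
      have hyx' : y ≠ x := by
        rintro rfl
        exact h1 hx13
      rw [h13, if_neg fun hc => hyx' hc.2, h14, if_neg hyx, h16, if_neg hkz, h16, if_neg hyz,
        hkey, hkey, if_neg hkz, if_neg hyz]
      exact ⟨h1, h2, h3⟩
  · intro w hw
    rw [h17] at hw
    rw [h17]
    split_ifs at hw ⊢ with hwu
    · rw [h15, if_pos rfl, hl z hz0]
      exact ⟨hwu ▸ hu, hwu.symm, Or.inr rfl⟩
    · rw [h15, if_neg (hnz w), hl _ hw]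
      obtain ⟨h1, h2, h3⟩ := h.node w hw
      exact ⟨h1, h2, Or.inl h3⟩
  · intro a i ha ha'
    by_cases hai : f' a i = 0
    · omega
    · rcases (hl _ hai).1 ⟨a, i, ha, ha', rfl⟩ with h1 | h1
      · have := h.le_of_located h1
        omega
      · omega
  · rw [h16, if_neg hz0.symm]
    exact h.rank_zero
  · omega
  · rw [h71]
    have hw := h.weight
    have hs := Finset.sum_range_succ (fun i => Nat.fib (f' 16 (f' 10 i) + 1)) (f 7 0)
    rw [h10 (f 7 0), if_pos rfl, h16, if_pos rfl] at hs
    have hs' : ∑ i ∈ Finset.range (f 7 0), Nat.fib (f' 16 (f' 10 i) + 1) =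
        ∑ i ∈ Finset.range (f 7 0), Nat.fib (f 16 (f 10 i) + 1) :=
      sum_range_congr fun j hj => by
        rw [h10, if_neg (by omega), h16, if_neg (hle 10 j (by omega) (by omega)).ne]
    have hV := sum_range_eq_add_of_eq_off (B := N) (i := u)
      (g := fun i => Nat.fib (f 16 (f 17 i))) (g' := fun i => Nat.fib (f' 16 (f' 17 i)))
      hu (fun j hj hne => by
        simp only [h16, h17, if_neg hne, if_neg (hnz j)])
    simp only [h16 z, h17 u, if_true, hx, hr] at hV
    -- The new root contributes `F(r-1)` and the term of the vertex falls from `F(r)` to `F(r-2)`,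
    -- which cancels for `r ≥ 2`. For smaller `r` truncated subtraction gives rank `0`, and the
    -- weight grows by at most `1`, paid by the counter of nodes.
    have hfib : Nat.fib (r - 2 + 1) + Nat.fib (r - 2) ≤ Nat.fib r + 1 := by
      obtain rfl | rfl | ⟨k, rfl⟩ : r = 0 ∨ r = 1 ∨ ∃ k, r = k + 2 := by
        rcases r with _ | _ | k
        · exact Or.inl rfl
        · exact Or.inr (Or.inl rfl)
        · exact Or.inr (Or.inr ⟨k, rfl⟩)
      · simp
      · simp
      · have := Nat.fib_add_two (n := k)
        rw [show k + 2 - 2 = k by omega]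
        omega
    rw [heapWeight] at hw ⊢
    rw [h70, h11]
    omega
  -- At most one cell becomes occupied in each of arrays `13` and `14`. Each adds `2` to the
  -- potential, and so does the new entry of the stack: `6` in all.
  · have hB : ∀ (a : ℕ), (∀ i, i ≠ x → f' a i = f a i) →
        ∑ i ∈ Finset.range W, (if f' a i = 0 then 0 else 1) ≤
          ∑ i ∈ Finset.range W, (if f a i = 0 then 0 else 1) + 1 := by
      intro a ha
      have hxW : x < W := by
        by_cases hx0 : x = 0
        · omega
        · have := h.le_of_located (h.node u (hx ▸ hx0)).2.2
          omega
      have hA' := sum_range_eq_add_of_eq_off (B := W) (i := x)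
        (g := fun i => if f a i = 0 then 0 else 1)
        (g' := fun i => if f' a i = 0 then 0 else 1)
        hxW (fun j _ hj => by simp [ha j hj])
      have : (if f' a x = 0 then 0 else 1) ≤ 1 := by split_ifs <;> omega
      omega
    have hB1 := hB 13 (fun i hi => by rw [h13, if_neg fun hc => hi hc.2])
    have hB2 := hB 14 (fun i hi => by rw [h14, if_neg fun hc => hi hc.2])
    rw [heapPot, heapPot, h70, h11]
    omega

/-- If the stack is empty, every node has a root in the array above it, whose key is at most
its own. -/
theorem exists_root (h : HeapInv N W f key) (ht : f 7 0 = 0) {y : ℕ} (hy0 : y ≠ 0)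
    (hy : Located f y) : ∃ i, f 11 i ≠ 0 ∧ key (f 11 i) ≤ key y := by
  classical
  -- Among the nodes with a key at most that of `y`, take one of largest rank. A parent would have a
  -- larger rank and no larger key, so this node is a root. No recursion along the trees is needed.
  obtain ⟨x, hx, hmax⟩ := Finset.exists_max_image
    ((Finset.range (f 7 1 + 1)).filter fun x => x ≠ 0 ∧ Located f x ∧ key x ≤ key y) (f 16)
    ⟨y, by
      have := h.le_of_located hy
      simp only [Finset.mem_filter, Finset.mem_range]
      exact ⟨by omega, hy0, hy, le_rfl⟩⟩
  have hmax' : ∀ z, z ≠ 0 → Located f z → key z ≤ key x → f 16 z ≤ f 16 x := by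
    intro z hz0 hz hzx
    refine hmax z ?_
    have := h.le_of_located hz
    simp only [Finset.mem_filter, Finset.mem_range] at hx ⊢
    exact ⟨by omega, hz0, hz, hzx.trans hx.2.2.2⟩
  simp only [Finset.mem_filter, Finset.mem_range] at hx
  obtain ⟨-, hx0, ⟨a, i, ha, ha', rfl⟩, hxy⟩ := hx
  obtain rfl | rfl | rfl | rfl | rfl : a = 10 ∨ a = 11 ∨ a = 12 ∨ a = 13 ∨ a = 14 := by omega
  · have := (h.stack i).1 hx0
    omega
  · exact ⟨i, hx0, hxy⟩
  · obtain ⟨v, j, -, h2, h3, h4, h5⟩ := h.kid i hx0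
    have := hmax' _ h2 (h.node v h2).2.2 h5
    omega
  · obtain ⟨h1, h2, -, h4, h5⟩ := h.hollow₁ i hx0
    have := hmax' i h1 h2 h5
    omega
  · obtain ⟨h1, h2, h3⟩ := h.hollow₂ i hx0
    obtain ⟨h4, h5, -⟩ := h.hollow₁ i h1
    have := hmax' i h4 h5 h3
    omega

/-- If there are no roots, the heap is empty. -/
theorem eq_zero_of_no_root (h : HeapInv N W f key) (ht : f 7 0 = 0) (hA : ∀ i, f 11 i = 0) :
    (∀ a i, 10 ≤ a → a ≤ 14 → f a i = 0) ∧ ∀ v, f 17 v = 0 := by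
  have h1 : ∀ y, Located f y → y = 0 := by
    intro y hy
    by_contra hy0
    obtain ⟨i, hi, -⟩ := h.exists_root ht hy0 hy
    exact hi (hA i)
  refine ⟨fun a i ha ha' => h1 _ ⟨a, i, ha, ha', rfl⟩, fun v => ?_⟩
  by_contra hv
  exact hv (h1 _ (h.node v hv).2.2)

/-- The invariant only depends on the arrays of the heap. -/
theorem congr (h : HeapInv N W f key) (h7 : ∀ i, i < 3 → f' 7 i = f 7 i)
    (hf : ∀ a, 10 ≤ a → a ≤ 17 → f' a = f a) :
    HeapInv N W f' key ∧ heapPot W f' = heapPot W f := by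
  have e0 := h7 0 (by omega)
  have e1 := h7 1 (by omega)
  have e2 := h7 2 (by omega)
  have e10 := hf 10 (by omega) (by omega)
  have e11 := hf 11 (by omega) (by omega)
  have e12 := hf 12 (by omega) (by omega)
  have e13 := hf 13 (by omega) (by omega)
  have e14 := hf 14 (by omega) (by omega)
  have e15 := hf 15 (by omega) (by omega)
  have e16 := hf 16 (by omega) (by omega)
  have e17 := hf 17 (by omega) (by omega)
  obtain ⟨hp, hl⟩ := h.placed.congr (f' := f') fun c k hc hc' => by rw [hf c hc (by omega)]
  refine ⟨⟨?_, ?_, ?_, ?_, ?_, ?_, ?_, ?_, hp, ?_, ?_, ?_⟩, ?_⟩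
  · rw [e10, e0]
    exact h.stack
  · rw [e11, e15, e16, e17, e2]
    exact h.root
  · rw [e12, e16, e17]
    exact h.kid
  · rw [e12, e16, e17]
    exact h.kids
  · simp only [e13, e15, e16, e17, hl]
    exact h.hollow₁
  · rw [e13, e14, e16]
    exact h.hollow₂
  · simp only [e15, e17, hl]
    exact h.node
  · intro a i ha ha'
    rw [hf a ha (by omega), e1]
    exact h.le a i ha ha'
  · rw [e16]
    exact h.rank_zero
  · rw [e1]
    exact h.count
  · rw [heapWeight, e0, e1, e10, e11, e16, e17]
    exact h.weight
  · rw [heapPot, heapPot, e0, e11, e13, e14]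

end HeapInv

/-! ## The programs of the heap -/

namespace HeapProg

/-- The height of the stack. -/
def top : NatExp := .cell 7 0

/-- The node on the top of the stack. -/
def topNode : NatExp := .cell 10 (top - 1)

/-- The rank of the node on the top of the stack. -/
def topRank : NatExp := .cell 16 topNode

/-- Move the top of the stack to the array of roots. -/
def place : Prog := .block [
  .setNat 11 topRank topNode,
  .setNat 7 2 (.cell 7 2 + (topRank - .cell 7 2)),
  .setNat 10 (top - 1) 0,
  .setNat 7 0 (top - 1)]

/-- Exchange the top of the stack with the root of the same rank in the array. -/
def swap : Prog := .block [
  .setNat 8 0 topNode,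
  .setNat 10 (top - 1) (.cell 11 topRank),
  .setNat 11 (.cell 16 (.cell 8 0)) (.cell 8 0)]

/-- Make the root in the array a child of the top of the stack. -/
def link : Prog := .block [
  .setNat 12 (.cell 18 (.cell 15 topNode) + topRank) (.cell 11 topRank),
  .setNat 11 topRank 0,
  .setNat 16 topNode (topRank + 1)]

/-- Pop a hollow node without children. -/
def drop : Prog := .block [
  .setNat 10 (top - 1) 0,
  .setNat 7 0 (top - 1)]

/-- Replace a hollow node by its child. -/
def expose₁ : Prog := .block [
  .setNat 8 0 topNode,
  .setNat 10 (top - 1) (.cell 13 (.cell 8 0)),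
  .setNat 13 (.cell 8 0) 0]

/-- Replace a hollow node by its two children. -/
def expose₂ : Prog := .block [
  .setNat 8 0 topNode,
  .setNat 10 top (.cell 14 (.cell 8 0)),
  .setNat 10 (top - 1) (.cell 13 (.cell 8 0)),
  .setNat 13 (.cell 8 0) 0,
  .setNat 14 (.cell 8 0) 0,
  .setNat 7 0 (top + 1)]

/-- Process the top of the stack. -/
def step : Prog :=
  .cond (.natEq (.cell 17 (.cell 15 topNode)) topNode)
    (.cond (.natEq (.cell 11 topRank) 0) place
      (.seq (.cond (.realLt (.cell 2 (.cell 11 topRank)) (.cell 2 topNode)) swap .skip) link))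
    (.cond (.natEq (.cell 13 topNode) 0) drop
      (.cond (.natEq (.cell 14 topNode) 0) expose₁ expose₂))

/-- Empty the stack, linking roots of equal rank. -/
def drain : Prog := .loop (.natLt 0 top) step

/-- Find the root of smallest key; cell `(8, 2)` becomes its rank plus one. -/
def scan : Prog := .block [
  .setNat 8 1 0,
  .setNat 8 2 0,
  .loop (.neg (.natLt (.cell 7 2) (.cell 8 1)))
    (.seq
      (.cond (.conj (.neg (.natEq (.cell 11 (.cell 8 1)) 0))
          (.neg (.conj (.neg (.natEq (.cell 8 2) 0))
            (.neg (.realLt (.cell 2 (.cell 11 (.cell 8 1)))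
              (.cell 2 (.cell 11 (.cell 8 2 - 1))))))))
        (.setNat 8 2 (.cell 8 1 + 1)) .skip)
      (.setNat 8 1 (.cell 8 1 + 1)))]

/-- Push the root of rank `(8, 1)`, if there is one. -/
def pushRoot : Prog :=
  .cond (.natEq (.cell 11 (.cell 8 1)) 0) .skip (.block [
    .setNat 10 top (.cell 11 (.cell 8 1)),
    .setNat 11 (.cell 8 1) 0,
    .setNat 7 0 (top + 1)])

/-- Move all roots back to the stack, that of rank `(8, 2) - 1` last. -/
def collect : Prog := .block [
  .setNat 8 1 0,
  .loop (.neg (.natLt (.cell 7 2) (.cell 8 1)))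
    (.seq
      (.cond (.natEq (.cell 8 1 + 1) (.cell 8 2)) .skip pushRoot)
      (.setNat 8 1 (.cell 8 1 + 1))),
  .setNat 8 1 (.cell 8 2 - 1),
  pushRoot]

/-- Detach the children of the top of the stack. -/
def release : Prog :=
  .loop (.natLt 0 topRank) (.block [
    .setNat 8 0 topNode,
    .setNat 16 (.cell 8 0) (.cell 16 (.cell 8 0) - 1),
    .setNat 10 top (.cell 8 0),
    .setNat 10 (top - 1)
      (.cell 12 (.cell 18 (.cell 15 (.cell 8 0)) + .cell 16 (.cell 8 0))),
    .setNat 12 (.cell 18 (.cell 15 (.cell 8 0)) + .cell 16 (.cell 8 0)) 0,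
    .setNat 7 0 (top + 1)])

/-- Remove the top of the stack from the queue; cell `(8, 3)` becomes its vertex. -/
def pop : Prog := .block [
  .setNat 8 3 (.cell 15 topNode),
  .setNat 17 (.cell 8 3) 0,
  .setNat 10 (top - 1) 0,
  .setNat 7 0 (top - 1)]

/-- Make a new node for the vertex in cell `(8, 4)`, with the key in cell `(4, 0)`. Cells
`(8, 5)` and `(8, 6)` become the old node and its rank. -/
def newNode : Prog := .block [
  .setNat 8 5 (.cell 17 (.cell 8 4)),
  .setNat 8 6 (.cell 16 (.cell 8 5)),
  .setNat 7 1 (.cell 7 1 + 1),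
  .setNat 15 (.cell 7 1) (.cell 8 4),
  .setNat 16 (.cell 7 1) (.cell 8 6 - 2),
  .setNat 17 (.cell 8 4) (.cell 7 1),
  .setReal 2 (.cell 7 1) (.cell 4 0),
  .setNat 10 top (.cell 7 1),
  .setNat 7 0 (top + 1)]

/-- If the old node has rank at least `c`, it keeps its child of rank `(8, 6) - c` in array
`a`. -/
def keepChild (a c : ℕ) : Prog :=
  .cond (.natLt (.cell 8 6) (.lit c)) .skip (.seq
    (.setNat a (.cell 8 5) (.cell 12 (.cell 18 (.cell 8 4) + (.cell 8 6 - .lit c))))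
    (.setNat 12 (.cell 18 (.cell 8 4) + (.cell 8 6 - .lit c)) 0))

/-- Insert the vertex in cell `(8, 4)` with the key in cell `(4, 0)`, or decrease its key. -/
def create : Prog := .seq newNode (.seq (keepChild 13 1) (keepChild 14 2))

end HeapProg

open HeapProg

/-- What the programs of the heap leave unchanged; array `17` is treated separately. -/
structure HeapFrame (m m' : Memory) : Prop where
  int : ∀ a, a ≠ 7 → a ≠ 8 → (a < 10 ∨ a = 15 ∨ 17 ≤ a) → m'.int a = m.int a
  count : ∀ i, i ≠ 0 → i ≠ 2 → m'.int 7 i = m.int 7 i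
  real : m'.real = m.real

theorem HeapFrame.refl (m : Memory) : HeapFrame m m :=
  ⟨fun _ _ _ _ => rfl, fun _ _ _ => rfl, rfl⟩

theorem HeapFrame.trans {m m' m'' : Memory} (h : HeapFrame m m') (h' : HeapFrame m' m'') :
    HeapFrame m m'' where
  int a h1 h2 h3 := (h'.int a h1 h2 h3).trans (h.int a h1 h2 h3)
  count i h1 h2 := (h'.count i h1 h2).trans (h.count i h1 h2)
  real := h'.real.trans h.real

/-! ### Emptying the stack: correctness and cost -/

section

variable {N W : ℕ} {m : Memory}

/-- The last clause keeps the recorded rank bound logarithmic: when a root is placed in the array,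
its Fibonacci number is bounded by the number of created nodes. -/
theorem ends_step (h : HeapInv N W m.int (m.real 2)) (hb : ∀ v < N, m.int 18 v = v * W)
    (ht : 0 < m.int 7 0) :
    Ends step m fun k m' => (HeapInv N W m'.int (m'.real 2) ∧
      heapPot W m'.int < heapPot W m.int) ∧ HeapFrame m m' ∧ k ≤ 20 ∧
      ∀ b, Nat.fib (m.int 7 2 + 1) ≤ b → m.int 7 1 ≤ b → Nat.fib (m'.int 7 2 + 1) ≤ b := by
  refine ends_cond (fun hfull => ends_cond (fun hA => ?_) fun hA => ?_)
    fun hhol => ends_cond (fun h13 => ?_) fun h13 => ends_cond (fun h14 => ?_) fun h14 => ?_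
  · simp [topNode, topRank, top] at hfull hA
    simp only [place, Prog.block, ends_seq_iff, ends_setNat_iff, ends_skip_iff]
    refine ⟨h.place ht rfl rfl hfull hA ?_ ?_ ?_ ?_ ?_ ?_ ?_, ⟨?_, ?_, rfl⟩, by norm_num, ?_⟩
    · intro i
      simp [upd, topNode, topRank, top]
    · intro i
      simp [upd, topNode, topRank, top]
    · simp [upd, topNode, topRank, top]
    · simp [upd, topNode, topRank, top]
    · simp [upd, topNode, topRank, top]
    · simp [upd, topNode, topRank, top]
      omega
    · intro a h1 h2
      funext i
      simp [upd, topNode, topRank, top]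
      grind
    · intro a h1 h2 h3
      funext i
      simp [upd, topNode, topRank, top]
      grind
    · intro i h1 h2
      simp [upd, topNode, topRank, top]
      grind
    · intro b hb1 hb2
      have hfib := (h.fib_rank_stack_le (i := m.int 7 0 - 1) (by omega)).trans hb2
      simp [upd, topNode, topRank, top]
      -- Adding the truncated difference computes the maximum of the old bound and the rank.
      rcases le_total (m.int 16 (m.int 10 (m.int 7 0 - 1))) (m.int 7 2) with hle | hle
      · rwa [Nat.sub_eq_zero_of_le hle, add_zero]
      · rwa [Nat.add_sub_cancel' hle]
  · simp [topNode, topRank, top] at hfull hA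
    have hx0 := (h.stack (m.int 7 0 - 1)).2 (by omega)
    obtain ⟨hyr, hyf, -, -⟩ := h.root _ hA
    have hne : m.int 11 (m.int 16 (m.int 10 (m.int 7 0 - 1))) ≠ m.int 10 (m.int 7 0 - 1) := by
      intro he
      have := h.placed _ _ _ _ (by omega) (by omega) (by omega) (by omega) he hA
      omega
    -- Stated for an arbitrary memory, because linking starts either from the original memory or
    -- from the one after the exchange, always with the smaller key on the stack.
    have hlink : ∀ {m : Memory}, HeapInv N W m.int (m.real 2) → (∀ v < N, m.int 18 v = v * W) →
        0 < m.int 7 0 →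
        m.int 17 (m.int 15 (m.int 10 (m.int 7 0 - 1))) = m.int 10 (m.int 7 0 - 1) →
        m.int 11 (m.int 16 (m.int 10 (m.int 7 0 - 1))) ≠ 0 →
        m.real 2 (m.int 10 (m.int 7 0 - 1)) ≤
          m.real 2 (m.int 11 (m.int 16 (m.int 10 (m.int 7 0 - 1)))) →
        Ends link m fun k m' => (HeapInv N W m'.int (m'.real 2) ∧
          heapPot W m'.int < heapPot W m.int) ∧ HeapFrame m m' ∧ k ≤ 5 ∧
          m'.int 7 2 = m.int 7 2 := by
      intro m h hb ht hfull hA hkey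
      have hx0 := (h.stack (m.int 7 0 - 1)).2 (by omega)
      have hbase := hb _ (h.node _ (hfull.symm ▸ hx0)).1
      simp only [link, Prog.block, ends_seq_iff, ends_setNat_iff, ends_skip_iff]
      refine ⟨h.link ht rfl rfl rfl hfull rfl hA hkey ?_ ?_ ?_ ?_ ?_, ⟨?_, ?_, rfl⟩, by norm_num,
        ?_⟩
      · intro i
        simp [upd, topNode, topRank, top]
      · intro i
        simp [upd, topNode, topRank, top, hbase]
      · intro i
        simp [upd, topNode, topRank, top]
      · funext i
        simp [upd, topNode, topRank, top]
      · intro a h1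
        funext i
        simp [upd, topNode, topRank, top]
        grind
      · intro a h1 h2 h3
        funext i
        simp [upd, topNode, topRank, top]
        grind
      · intro i h1 h2
        simp [upd, topNode, topRank, top]
      · simp [upd]
    refine ends_seq (Ends.mono (Q := fun k m' => (HeapInv N W m'.int (m'.real 2) ∧
      heapPot W m'.int = heapPot W m.int) ∧ HeapFrame m m' ∧ k ≤ 8 ∧
      m'.int 7 2 = m.int 7 2 ∧ 0 < m'.int 7 0 ∧
      m'.int 17 (m'.int 15 (m'.int 10 (m'.int 7 0 - 1))) = m'.int 10 (m'.int 7 0 - 1) ∧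
      m'.int 11 (m'.int 16 (m'.int 10 (m'.int 7 0 - 1))) ≠ 0 ∧
      m'.real 2 (m'.int 10 (m'.int 7 0 - 1)) ≤
        m'.real 2 (m'.int 11 (m'.int 16 (m'.int 10 (m'.int 7 0 - 1))))) ?_ ?_)
    · refine ends_cond (fun hk => ?_) fun hk => ends_skip ?_
      · simp [topNode, topRank, top] at hk
        simp only [swap, Prog.block, ends_seq_iff, ends_setNat_iff, ends_skip_iff]
        refine ⟨h.swap ht rfl rfl hfull rfl hA ?_ ?_ ?_ ?_, ⟨?_, ?_, rfl⟩, by norm_num, ?_, ?_, ?_,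
          ?_, ?_⟩
        · intro i
          simp [upd, topNode, topRank, top]
        · intro i
          simp [upd, topNode, topRank, top]
        · funext i
          simp [upd, topNode, topRank, top]
        · intro a h1 h2
          funext i
          simp [upd, topNode, topRank, top]
          grind
        · intro a h1 h2 h3
          funext i
          simp [upd, topNode, topRank, top]
          grind
        · intro i h1 h2
          simp [upd, topNode, topRank, top]
        · simp [upd]
        · simpa [upd] using ht
        · simpa [upd, topNode, topRank, top] using hyf
        · simpa [upd, topNode, topRank, top, hyr] using hx0
        · simpa [upd, topNode, topRank, top, hyr] using hk.le
      · simp [topNode, topRank, top] at hk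
        exact ⟨⟨h, rfl⟩, .refl m, by norm_num, rfl, ht, hfull, hA, hk⟩
    · rintro k m' ⟨⟨h1, h2⟩, h3, h4, h40, h5, h6, h7, h8⟩
      refine (hlink h1 ?_ h5 h6 h7 h8).mono ?_
      · intro v hv
        rw [h3.int 18 (by omega) (by omega) (by omega), hb v hv]
      · rintro l m'' ⟨⟨g1, g2⟩, g3, g4, g5⟩
        exact ⟨⟨g1, by omega⟩, h3.trans g3, by omega, fun b hb1 _ => by rw [g5, h40]; exact hb1⟩
  · simp [topNode, topRank, top] at hhol h13
    simp only [drop, Prog.block, ends_seq_iff, ends_setNat_iff, ends_skip_iff]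
    refine ⟨h.drop ht rfl hhol h13 ?_ ?_ ?_ ?_ ?_, ⟨?_, ?_, rfl⟩, by norm_num, ?_⟩
    · intro i
      simp [upd, topNode, topRank, top]
    · simp [upd, topNode, topRank, top]
    · simp [upd, topNode, topRank, top]
    · simp [upd, topNode, topRank, top]
    · intro a h1 h2
      funext i
      simp [upd, topNode, topRank, top]
      grind
    · intro a h1 h2 h3
      funext i
      simp [upd, topNode, topRank, top]
      grind
    · intro i h1 h2
      simp [upd, topNode, topRank, top]
      grind
    · intro b hb1 _
      simpa [upd, topNode, topRank, top] using hb1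
  · simp [topNode, topRank, top] at hhol h13 h14
    simp only [expose₁, Prog.block, ends_seq_iff, ends_setNat_iff, ends_skip_iff]
    refine ⟨h.expose₁ ht rfl hhol rfl h13 h14 ?_ ?_ ?_ ?_, ⟨?_, ?_, rfl⟩, by norm_num, ?_⟩
    · intro i
      simp [upd, topNode, topRank, top]
    · intro i
      simp [upd, topNode, topRank, top]
    · funext i
      simp [upd, topNode, topRank, top]
    · intro a h1 h2
      funext i
      simp [upd, topNode, topRank, top]
      grind
    · intro a h1 h2 h3
      funext i
      simp [upd, topNode, topRank, top]
      grind
    · intro i h1 h2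
      simp [upd, topNode, topRank, top]
    · intro b hb1 _
      simpa [upd, topNode, topRank, top] using hb1
  · simp [topNode, topRank, top] at hhol h13 h14
    have hne : m.int 7 0 - 1 ≠ m.int 7 0 := by omega
    simp only [expose₂, Prog.block, ends_seq_iff, ends_setNat_iff, ends_skip_iff]
    refine ⟨h.expose₂ ht rfl hhol rfl rfl h14 ?_ ?_ ?_ ?_ ?_ ?_ ?_, ⟨?_, ?_, rfl⟩, by norm_num, ?_⟩
    · intro i
      simp [upd, topNode, topRank, top]
      grind
    · intro i
      simp [upd, topNode, topRank, top]
    · intro i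
      simp [upd, topNode, topRank, top]
    · simp [upd, topNode, topRank, top]
    · simp [upd, topNode, topRank, top]
    · simp [upd, topNode, topRank, top]
    · intro a h1 h2
      funext i
      simp [upd, topNode, topRank, top]
      grind
    · intro a h1 h2 h3
      funext i
      simp [upd, topNode, topRank, top]
      grind
    · intro i h1 h2
      simp [upd, topNode, topRank, top]
      grind
    · intro b hb1 _
      simpa [upd, topNode, topRank, top] using hb1

/-- A step costs at most `20`, one more for the test, and lowers the potential by at least one;
hence the factor `21`. -/
theorem ends_drain (h : HeapInv N W m.int (m.real 2)) (hb : ∀ v < N, m.int 18 v = v * W) :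
    Ends drain m fun k m' => HeapInv N W m'.int (m'.real 2) ∧ HeapFrame m m' ∧
      m'.int 7 0 = 0 ∧ k + 21 * heapPot W m'.int ≤ 21 * heapPot W m.int + 1 ∧
      ∀ b, Nat.fib (m.int 7 2 + 1) ≤ b → m.int 7 1 ≤ b → Nat.fib (m'.int 7 2 + 1) ≤ b := by
  refine (ends_loop (fun m' => HeapInv N W m'.int (m'.real 2) ∧ HeapFrame m m' ∧
      ∀ b, Nat.fib (m.int 7 2 + 1) ≤ b → m.int 7 1 ≤ b → Nat.fib (m'.int 7 2 + 1) ≤ b)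
    (fun m' => 21 * heapPot W m'.int) ?_ ⟨h, .refl m, fun _ hb _ => hb⟩).mono ?_
  · rintro m₁ ⟨h₁, hf, hm⟩ ht
    refine (ends_step h₁ ?_ ht).mono ?_
    · intro v hv
      rw [hf.int 18 (by omega) (by omega) (by omega), hb v hv]
    · rintro k m' ⟨⟨h1, h2⟩, h3, h4, h5⟩
      refine ⟨⟨h1, hf.trans h3, fun b hb1 hb2 => h5 b (hm b hb1 hb2) ?_⟩, by omega⟩
      rwa [hf.count 1 (by omega) (by omega)]
  · rintro k m' ⟨⟨h1, h2, h5⟩, h3, h4⟩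
    exact ⟨h1, h2, by simpa [top] using h3, h4, h5⟩

end

open HeapProg

/-! ### Finding and extracting the minimum, inserting and decreasing: correctness and cost -/

section

variable {N W : ℕ} {m : Memory}

theorem ends_scan (h : HeapInv N W m.int (m.real 2)) :
    Ends scan m fun k m' => (∀ a, a ≠ 8 → m'.int a = m.int a) ∧ m'.real = m.real ∧
      k ≤ 6 * m.int 7 2 + 20 ∧
      (m'.int 8 2 = 0 → ∀ j, m.int 11 j = 0) ∧
      (m'.int 8 2 ≠ 0 → m.int 11 (m'.int 8 2 - 1) ≠ 0 ∧ ∀ j, m.int 11 j ≠ 0 →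
        m.real 2 (m.int 11 (m'.int 8 2 - 1)) ≤ m.real 2 (m.int 11 j)) := by
  simp only [scan, Prog.block, ends_seq_iff, ends_setNat_iff, ends_skip_iff]
  refine (ends_loop (fun m' => (∀ a, a ≠ 8 → m'.int a = m.int a) ∧ m'.real = m.real ∧
      m'.int 8 1 ≤ m.int 7 2 + 1 ∧
      (m'.int 8 2 = 0 → ∀ j < m'.int 8 1, m.int 11 j = 0) ∧
      (m'.int 8 2 ≠ 0 → m.int 11 (m'.int 8 2 - 1) ≠ 0 ∧ ∀ j < m'.int 8 1, m.int 11 j ≠ 0 →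
        m.real 2 (m.int 11 (m'.int 8 2 - 1)) ≤ m.real 2 (m.int 11 j)))
    (fun m' => 6 * (m.int 7 2 + 1 - m'.int 8 1)) ?_ ?_).mono ?_
  · rintro m₁ ⟨h1, h2, h3, h4, h5⟩ hc
    have e7 := h1 7 (by omega)
    have e11 := h1 11 (by omega)
    simp [e7] at hc
    refine ends_seq (ends_cond (fun ht => ?_) fun ht => ?_)
    · simp only [ends_setNat_iff]
      simp [e11, h2] at ht
      refine ⟨⟨?_, ?_, ?_, ?_, ?_⟩, ?_⟩
      · intro a ha
        funext j
        simp [upd, ha, h1 a ha]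
      · exact h2
      · simp [upd, hc]
      · simp [upd]
      · intro _
        simp [upd]
        refine ⟨ht.1, fun j hj hj0 => ?_⟩
        rcases hj.lt_or_eq with hlt | rfl
        · by_cases hb : m₁.int 8 2 = 0
          · exact absurd (h4 hb j hlt) hj0
          · exact (ht.2 hb).le.trans ((h5 hb).2 j hlt hj0)
        · exact le_rfl
      · simp [upd]
        omega
    · simp only [ends_setNat_iff, ends_skip_iff]
      simp [e11, h2] at ht
      refine ⟨⟨?_, ?_, ?_, ?_, ?_⟩, ?_⟩
      · intro a ha
        funext j
        simp [upd, ha, h1 a ha]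
      · exact h2
      · simp [upd, hc]
      · simp [upd]
        intro hb j hj
        rcases hj.lt_or_eq with hlt | rfl
        · exact h4 hb j hlt
        · by_contra hne
          exact (ht hne).1 hb
      · simp [upd]
        intro hb
        refine ⟨(h5 hb).1, fun j hj hj0 => ?_⟩
        rcases hj.lt_or_eq with hlt | rfl
        · exact (h5 hb).2 j hlt hj0
        · exact (ht hj0).2
      · simp [upd]
        omega
  · refine ⟨?_, rfl, ?_, ?_, ?_⟩
    · intro a ha
      funext j
      simp [upd, ha]
    · simp [upd]
    · simp [upd]
    · simp [upd]
  · rintro k m' ⟨⟨h1, h2, h3, h4, h5⟩, hc, hk⟩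
    simp [h1 7 (by omega)] at hc
    simp [upd] at hk
    refine ⟨h1, h2, by omega, fun hb j => ?_, fun hb => ⟨(h5 hb).1, fun j hj => ?_⟩⟩
    · by_contra hj
      have := (h.root j hj).2.2.1
      exact hj (h4 hb j (by omega))
    · have := (h.root j hj).2.2.1
      exact (h5 hb).2 j (by omega) hj

/-- The registers of the heap do not matter for the invariant. -/
theorem HeapInv.of_eq_off {m m' : Memory} (h : HeapInv N W m.int (m.real 2))
    (hi : ∀ a, a ≠ 8 → m'.int a = m.int a) (hr : m'.real = m.real) :
    HeapInv N W m'.int (m'.real 2) ∧ heapPot W m'.int = heapPot W m.int := by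
  rw [hr]
  exact h.congr (fun i _ => by rw [hi 7 (by omega)]) fun a ha _ => hi a (by omega)

theorem ends_pushRoot (h : HeapInv N W m.int (m.real 2)) :
    Ends pushRoot m fun k m' => (HeapInv N W m'.int (m'.real 2) ∧
      heapPot W m'.int ≤ heapPot W m.int + 1) ∧ HeapFrame m m' ∧ k ≤ 6 ∧
      m'.int 8 = m.int 8 ∧ m'.int 16 = m.int 16 ∧ m'.int 7 2 = m.int 7 2 ∧
      (∀ j, m'.int 11 j = if j = m.int 8 1 then 0 else m.int 11 j) ∧
      (m.int 11 (m.int 8 1) ≠ 0 →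
        0 < m'.int 7 0 ∧ m'.int 10 (m'.int 7 0 - 1) = m.int 11 (m.int 8 1)) := by
  refine ends_cond (fun hc => ends_skip ?_) fun hc => ?_
  · simp at hc
    refine ⟨⟨h, by omega⟩, .refl m, by omega, rfl, rfl, rfl, fun j => ?_, fun hne => absurd hc hne⟩
    split_ifs with hj
    · rw [hj, hc]
    · rfl
  · simp at hc
    simp only [Prog.block, ends_seq_iff, ends_setNat_iff, ends_skip_iff]
    refine ⟨?_, ⟨?_, ?_, rfl⟩, by norm_num, ?_, ?_, ?_, ?_, ?_⟩
    · refine (h.pushback rfl hc ?_ ?_ ?_ ?_ ?_ ?_).imp id Eq.le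
      · intro i
        simp [upd, top]
      · intro i
        simp [upd, top]
      · simp [upd, top]
      · simp [upd, top]
      · simp [upd, top]
      · intro a h1 h2
        funext i
        simp [upd, top]
        grind
    · intro a h1 h2 h3
      funext i
      simp [upd, top]
      grind
    · intro i h1 h2
      simp [upd, top]
      grind
    · funext i
      simp [upd]
    · funext i
      simp [upd]
    · simp [upd]
    · intro j
      simp [upd]
    · intro _
      simp [upd, top]

/-- The chosen root goes last so that it ends on the top of the stack. Each of the at most `m.int 7
2 + 1` transfers raises the potential by at most one. -/
theorem ends_collect (h : HeapInv N W m.int (m.real 2)) {x b : ℕ} (hb : m.int 8 2 = b)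
    (hb0 : b ≠ 0) (hx : m.int 11 (b - 1) = x) (hx0 : x ≠ 0) :
    Ends collect m fun k m' => HeapInv N W m'.int (m'.real 2) ∧ HeapFrame m m' ∧
      k ≤ 10 * m.int 7 2 + 40 ∧ heapPot W m'.int ≤ heapPot W m.int + (m.int 7 2 + 2) ∧
      m'.int 16 = m.int 16 ∧ m'.int 7 2 = m.int 7 2 ∧ (∀ j, m'.int 11 j = 0) ∧
      0 < m'.int 7 0 ∧ m'.int 10 (m'.int 7 0 - 1) = x := by
  rw [collect, Prog.block, Prog.block]
  refine ends_seq (ends_setNat (ends_seq ?_))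
  refine (ends_loop (fun m' => HeapInv N W m'.int (m'.real 2) ∧ HeapFrame m m' ∧
      m'.int 8 2 = b ∧ m'.int 8 1 ≤ m.int 7 2 + 1 ∧
      heapPot W m'.int ≤ heapPot W m.int + m'.int 8 1 ∧
      m'.int 16 = m.int 16 ∧ m'.int 7 2 = m.int 7 2 ∧ m'.int 11 (b - 1) = x ∧
      (∀ j, j ≠ b - 1 → (j < m'.int 8 1 ∨ m.int 11 j = 0) → m'.int 11 j = 0))
    (fun m' => 9 * (m.int 7 2 + 1 - m'.int 8 1)) ?_ ?_).mono ?_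
  · rintro m₁ ⟨h1, h2, h3, h4, h5, h6, h7, h8, h9⟩ hc
    simp [h7] at hc
    refine ends_seq (ends_cond (fun ht => ?_) fun ht => ?_)
    · simp [h3] at ht
      simp only [ends_setNat_iff, ends_skip_iff]
      obtain ⟨g1, g2⟩ := h1.of_eq_off (m' := m₁.setNat 8 (NatExp.eval m₁ 1)
        (NatExp.eval m₁ (NatExp.cell 8 1 + 1))) (fun a ha => by funext j; simp [upd, ha]) rfl
      refine ⟨⟨g1, h2.trans ⟨?_, ?_, rfl⟩, ?_, ?_, ?_, ?_, ?_, ?_, ?_⟩, ?_⟩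
      · intro a _ ha _
        funext i
        simp [upd, ha]
      · intro i _ _
        simp [upd]
      · simpa [upd] using h3
      · simp [upd, hc]
      · rw [g2]
        simp [upd]
        omega
      · funext i
        simp [upd, h6]
      · simp [upd, h7]
      · simp [upd, h8]
      · simp [upd]
        intro j hj hj'
        exact h9 j hj (by omega)
      · simp [upd]
        omega
    · simp [h3] at ht
      refine (ends_pushRoot h1).mono ?_
      rintro k m₂ ⟨⟨k1, k2⟩, k3, k4, k5, k6, k7, k8, -⟩
      simp only [ends_setNat_iff, ends_skip_iff]
      obtain ⟨g1, g2⟩ := k1.of_eq_off (m' := m₂.setNat 8 (NatExp.eval m₂ 1)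
        (NatExp.eval m₂ (NatExp.cell 8 1 + 1))) (fun a ha => by funext j; simp [upd, ha]) rfl
      refine ⟨⟨g1, (h2.trans k3).trans ⟨?_, ?_, rfl⟩, ?_, ?_, ?_, ?_, ?_, ?_, ?_⟩, ?_⟩
      · intro a _ ha _
        funext i
        simp [upd, ha]
      · intro i _ _
        simp [upd]
      · simpa [upd, k5] using h3
      · simp [upd, k5, hc]
      · rw [g2]
        simp [upd, k5]
        omega
      · funext i
        simp [upd, k6, h6]
      · simp [upd, k7, h7]
      · simp [upd, k8]
        rw [if_neg (by omega), h8]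
      · simp [upd, k5, k8]
        intro j hj hj' hj''
        exact h9 j hj (by omega)
      · simp [upd, k5]
        omega
  · obtain ⟨g1, g2⟩ := h.of_eq_off (m' := m.setNat 8 (NatExp.eval m 1)
      (NatExp.eval m 0)) (fun a ha => by funext j; simp [upd, ha]) rfl
    refine ⟨g1, ⟨?_, ?_, rfl⟩, ?_, ?_, ?_, ?_, ?_, ?_, ?_⟩
    · intro a _ ha _
      funext i
      simp [upd, ha]
    · intro i _ _
      simp [upd]
    · simpa [upd] using hb
    · simp [upd]
    · rw [g2]
      omega
    · funext i
      simp [upd]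
    · simp [upd]
    · simp [upd, hx]
    · simp [upd]
  · rintro k m₁ ⟨⟨h1, h2, h3, h4, h5, h6, h7, h8, h9⟩, hc, hk⟩
    simp [upd] at hk
    simp [h7] at hc
    rw [Prog.block, Prog.block, Prog.block]
    refine ends_seq (ends_setNat (ends_seq ?_))
    obtain ⟨g1, g2⟩ := h1.of_eq_off (m' := m₁.setNat 8 (NatExp.eval m₁ 1)
      (NatExp.eval m₁ (NatExp.cell 8 2 - 1))) (fun a ha => by funext j; simp [upd, ha]) rfl
    refine (ends_pushRoot g1).mono ?_
    rintro l m₂ ⟨⟨k1, k2⟩, k3, k4, k5, k6, k7, k8, k9⟩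
    refine ends_skip ⟨k1, h2.trans (HeapFrame.trans (m' := m₁.setNat 8 (NatExp.eval m₁ 1)
      (NatExp.eval m₁ (NatExp.cell 8 2 - 1))) ⟨?_, ?_, rfl⟩ k3), ?_, ?_, ?_, ?_, ?_, ?_⟩
    · intro a _ ha _
      funext i
      simp [upd, ha]
    · intro i _ _
      simp [upd]
    · omega
    · omega
    · rw [k6]
      funext i
      simp [upd, h6]
    · rw [k7]
      simp [upd, h7]
    · intro j
      rw [k8]
      simp [upd, h3]
      intro hj
      refine h9 j hj ?_
      by_cases hj0 : m.int 11 j = 0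
      · exact Or.inr hj0
      · have := (h.root j hj0).2.2.1
        exact Or.inl (by omega)
    · simp [upd, h3, h8] at k9
      exact k9 hx0

/-- Each detached child slides below its parent, which stays on the top while its rank falls by one
and the potential rises by two. So the potential plus twice this rank is constant. -/
theorem ends_release (h : HeapInv N W m.int (m.real 2)) (hb : ∀ v < N, m.int 18 v = v * W)
    {x : ℕ} (ht : 0 < m.int 7 0) (hx : m.int 10 (m.int 7 0 - 1) = x)
    (hfull : m.int 17 (m.int 15 x) = x) :
    Ends release m fun k m' => HeapInv N W m'.int (m'.real 2) ∧ HeapFrame m m' ∧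
      k ≤ 10 * m.int 16 x + 10 ∧ heapPot W m'.int ≤ heapPot W m.int + 2 * m.int 16 x ∧
      m'.int 11 = m.int 11 ∧ m'.int 7 2 = m.int 7 2 ∧
      0 < m'.int 7 0 ∧ m'.int 10 (m'.int 7 0 - 1) = x ∧ m'.int 16 x = 0 := by
  refine (ends_loop (fun m' => HeapInv N W m'.int (m'.real 2) ∧ HeapFrame m m' ∧
      m'.int 16 x ≤ m.int 16 x ∧
      heapPot W m'.int + 2 * m'.int 16 x ≤ heapPot W m.int + 2 * m.int 16 x ∧
      m'.int 11 = m.int 11 ∧ m'.int 7 2 = m.int 7 2 ∧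
      0 < m'.int 7 0 ∧ m'.int 10 (m'.int 7 0 - 1) = x)
    (fun m' => 10 * m'.int 16 x) ?_ ⟨h, .refl m, le_rfl, le_rfl, rfl, rfl, ht, hx⟩).mono ?_
  · rintro m₁ ⟨h1, h2, h3, h4, h5, h6, h7, h8⟩ hc
    simp [topRank, topNode, top, h8] at hc
    have e15 := h2.int 15 (by omega) (by omega) (by omega)
    have e17 := h2.int 17 (by omega) (by omega) (by omega)
    have e18 := h2.int 18 (by omega) (by omega) (by omega)
    have hx0 : x ≠ 0 := h8 ▸ (h1.stack (m₁.int 7 0 - 1)).2 (by omega)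
    have hf1 : m₁.int 17 (m₁.int 15 x) = x := by rw [e17, e15, hfull]
    have hbase : m₁.int 18 (m₁.int 15 x) = m₁.int 15 x * W := by
      rw [e18, hb]
      exact (h1.node _ (hf1.symm ▸ hx0)).1
    obtain ⟨r, hr⟩ : ∃ r, m₁.int 16 x = r + 1 := ⟨m₁.int 16 x - 1, by omega⟩
    have hne : m₁.int 7 0 ≠ m₁.int 7 0 - 1 := by omega
    refine Ends.mono (Q := fun k m' => (HeapInv N W m'.int (m'.real 2) ∧
      heapPot W m'.int = heapPot W m₁.int + 2) ∧ HeapFrame m₁ m' ∧ k ≤ 9 ∧ m'.int 16 x = r ∧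
      m'.int 11 = m₁.int 11 ∧ m'.int 7 2 = m₁.int 7 2 ∧ m'.int 7 0 = m₁.int 7 0 + 1 ∧
      m'.int 10 (m'.int 7 0 - 1) = x) ?_ ?_
    · simp only [Prog.block, ends_seq_iff, ends_setNat_iff, ends_skip_iff]
      refine ⟨h1.unlink h7 h8 hr rfl hf1 rfl ?_ ?_ ?_ ?_ ?_ ?_ ?_, ⟨?_, ?_, rfl⟩, by norm_num, ?_,
        ?_, ?_, ?_, ?_⟩
      · intro i
        simp [upd, topNode, topRank, top, h8, hr, hbase]
        grind
      · intro i
        simp [upd, topNode, topRank, top, h8, hr, hbase]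
      · intro i
        simp [upd, topNode, topRank, top, h8, hr, hbase]
      · simp [upd, topNode, topRank, top, h8, hr, hbase]
      · simp [upd, topNode, topRank, top, h8, hr, hbase]
      · simp [upd, topNode, topRank, top, h8, hr, hbase]
      · intro a ha
        funext i
        simp [upd, topNode, topRank, top, h8, hr, hbase]
        grind
      · intro a h1 h2 h3
        funext i
        simp [upd, topNode, topRank, top, h8, hr, hbase]
        grind
      · intro i h1 h2
        simp [upd, topNode, topRank, top, h8, hr, hbase]
        grind
      · simp [upd, topNode, topRank, top, h8, hr, hbase]
      · funext i
        simp [upd, topNode, topRank, top, h8, hr, hbase]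
      · simp [upd, topNode, topRank, top, h8, hr, hbase]
      · simp [upd, topNode, topRank, top, h8, hr, hbase]
      · simp [upd, topNode, topRank, top, h8, hr, hbase, hne]
    · rintro k m' ⟨⟨g1, g2⟩, g3, g4, g5, g6, g7, g8, g9⟩
      exact ⟨⟨g1, h2.trans g3, by omega, by omega, g6.trans h5, g7.trans h6, by omega, g9⟩,
        by omega⟩
  · rintro k m' ⟨⟨h1, h2, h3, h4, h5, h6, h7, h8⟩, hc, hk⟩
    simp [topRank, topNode, top, h8] at hc
    exact ⟨h1, h2, by omega, by omega, h5, h6, h7, h8, hc⟩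

theorem ends_pop (h : HeapInv N W m.int (m.real 2)) {x v : ℕ} (ht : 0 < m.int 7 0)
    (hx : m.int 10 (m.int 7 0 - 1) = x) (hr : m.int 16 x = 0) (hv : m.int 15 x = v)
    (hfull : m.int 17 v = x) (hA : ∀ j, m.int 11 j = 0) :
    Ends pop m fun k m' => (HeapInv N W m'.int (m'.real 2) ∧
      heapPot W m'.int < heapPot W m.int) ∧ k ≤ 6 ∧
      (∀ a, a < 7 ∨ a = 9 ∨ 18 ≤ a → m'.int a = m.int a) ∧ m'.real = m.real ∧
      (∀ u, m'.int 17 u = if u = v then 0 else m.int 17 u) ∧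
      m'.int 11 = m.int 11 ∧ m'.int 7 1 = m.int 7 1 ∧ m'.int 7 2 = m.int 7 2 ∧
      m'.int 8 3 = v := by
  simp only [pop, Prog.block, ends_seq_iff, ends_setNat_iff, ends_skip_iff]
  refine ⟨h.remove ht hx hr hv hfull ?_ ?_ hA ?_ ?_ ?_, by norm_num, ?_, rfl, ?_, ?_, ?_, ?_, ?_⟩
  · intro i
    simp [upd, topNode, topRank, top, hx, hv]
  · intro i
    simp [upd, topNode, topRank, top, hx, hv]
  · simp [upd, topNode, topRank, top, hx, hv]
  · simp [upd, topNode, topRank, top, hx, hv]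
  · intro a ha ha'
    funext i
    simp [upd, topNode, topRank, top, hx, hv]
    grind
  · intro a ha
    funext i
    simp [upd, topNode, topRank, top, hx, hv]
    grind
  · intro i
    simp [upd, topNode, topRank, top, hx, hv]
  · funext i
    simp [upd, topNode, topRank, top, hx, hv]
  · simp [upd, topNode, topRank, top, hx, hv]
  · simp [upd, topNode, topRank, top, hx, hv]
  · simp [upd, topNode, topRank, top, hx, hv]

/-- Remove the root of rank `(8, 2) - 1` from the queue. -/
def HeapProg.takeMin : Prog := .seq collect (.seq release pop)

/-- The rise `3 L + 2` consists of at most `L + 2` for moving the roots back and `2 L` for releasing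
children, with all ranks of roots bounded by `L`; the removal itself only lowers the potential. -/
theorem ends_takeMin (h : HeapInv N W m.int (m.real 2)) (hb : ∀ v < N, m.int 18 v = v * W)
    {x b v L : ℕ} (hb2 : m.int 8 2 = b) (hb0 : b ≠ 0) (hx : m.int 11 (b - 1) = x) (hx0 : x ≠ 0)
    (hv : m.int 15 x = v) (hL : m.int 7 2 ≤ L) :
    Ends takeMin m fun k m' => HeapInv N W m'.int (m'.real 2) ∧
      heapPot W m'.int ≤ heapPot W m.int + 3 * L + 2 ∧ k ≤ 20 * L + 60 ∧
      (∀ a, a < 7 ∨ a = 9 ∨ 18 ≤ a → m'.int a = m.int a) ∧ m'.real = m.real ∧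
      (∀ u, m'.int 17 u = if u = v then 0 else m.int 17 u) ∧
      (∀ j, m'.int 11 j = 0) ∧ m'.int 7 1 = m.int 7 1 ∧ m'.int 7 2 = m.int 7 2 ∧
      m'.int 8 3 = v := by
  obtain ⟨hxr, hxf, hx2, -⟩ := h.root (b - 1) (hx ▸ hx0)
  rw [hx] at hxr hxf
  refine ends_seq ((ends_collect h hb2 hb0 hx hx0).mono ?_)
  rintro k₁ m₁ ⟨h1, h2, h3, h4, h5, h6, h7, h8, h9⟩
  have e15 := h2.int 15 (by omega) (by omega) (by omega)
  have e17 := h2.int 17 (by omega) (by omega) (by omega)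
  have e18 := h2.int 18 (by omega) (by omega) (by omega)
  refine ends_seq ((ends_release h1 (by rwa [e18]) h8 h9 (by rw [e17, e15, hxf])).mono ?_)
  rintro k₂ m₂ ⟨g1, g2, g3, g4, g5, g6, g7, g8, g9⟩
  have f15 := g2.int 15 (by omega) (by omega) (by omega)
  have f17 := g2.int 17 (by omega) (by omega) (by omega)
  refine (ends_pop g1 g7 g8 g9 (v := v) (by rw [f15, e15, hv]) (by rw [f17, e17, ← hv, hxf])
    (by rwa [g5])).mono ?_
  rintro k₃ m₃ ⟨⟨i1, i2⟩, i3, i4, i5, i6, i7, i8, i9, i10⟩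
  rw [h5] at g3 g4
  refine ⟨i1, by omega, by omega, ?_, ?_, ?_, ?_, ?_, ?_, i10⟩
  · intro a ha
    rw [i4 a ha, g2.int a (by omega) (by omega) (by omega),
      h2.int a (by omega) (by omega) (by omega)]
  · rw [i5, g2.real, h2.real]
  · intro u
    rw [i6, f17, e17]
  · rw [i7, g5]
    exact h7
  · rw [i8, g2.count 1 (by omega) (by omega), h2.count 1 (by omega) (by omega)]
  · rw [i9, g6, h6]

theorem ends_newNode {u : ℕ} (hu : m.int 8 4 = u) :
    Ends newNode m fun k m' => (∀ a i, m'.int a i =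
      if a = 7 then (if i = 0 then m.int 7 0 + 1 else if i = 1 then m.int 7 1 + 1 else m.int 7 i)
      else if a = 8 then (if i = 6 then m.int 16 (m.int 17 u) else if i = 5 then m.int 17 u
        else m.int 8 i)
      else if a = 10 then (if i = m.int 7 0 then m.int 7 1 + 1 else m.int 10 i)
      else if a = 15 then (if i = m.int 7 1 + 1 then u else m.int 15 i)
      else if a = 16 then (if i = m.int 7 1 + 1 then m.int 16 (m.int 17 u) - 2 else m.int 16 i)
      else if a = 17 then (if i = u then m.int 7 1 + 1 else m.int 17 i)
      else m.int a i) ∧ (∀ b y, m'.real b y =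
        if b = 2 ∧ y = m.int 7 1 + 1 then m.real 4 0 else m.real b y) ∧ k ≤ 10 := by
  have hcase : ∀ a : ℕ, a = 7 ∨ a = 8 ∨ a = 10 ∨ a = 15 ∨ a = 16 ∨
      a = 17 ∨ (a ≠ 7 ∧ a ≠ 8 ∧ a ≠ 10 ∧ a ≠ 15 ∧ a ≠ 16 ∧ a ≠ 17) := by omega
  simp only [newNode, Prog.block, ends_seq_iff, ends_setNat_iff, ends_setReal_iff, ends_skip_iff]
  refine ⟨fun a i => ?_, fun b y => ?_, by norm_num⟩
  · rcases hcase a with rfl | rfl | rfl | rfl | rfl | rfl | hn <;> simp [upd, top, hu]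
    simp [hn]
  · simp [upd, top, hu]

theorem ends_keepChild {a c : ℕ} (ha : 13 ≤ a) (ha' : a ≤ 14) :
    Ends (keepChild a c) m fun k m' => (∀ b i, m'.int b i =
      if b = 12 ∧ c ≤ m.int 8 6 ∧ i = m.int 18 (m.int 8 4) + (m.int 8 6 - c) then 0
      else if b = a ∧ c ≤ m.int 8 6 ∧ i = m.int 8 5 then
        m.int 12 (m.int 18 (m.int 8 4) + (m.int 8 6 - c)) else m.int b i) ∧
      m'.real = m.real ∧ k ≤ 3 := by
  refine ends_cond (fun hc => ends_skip ?_) fun hc => ?_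
  · simp at hc
    exact ⟨fun b i => by rw [if_neg (by omega), if_neg (by omega)], rfl, by omega⟩
  · simp at hc
    simp only [ends_seq_iff, ends_setNat_iff]
    refine ⟨fun b i => ?_, rfl, by norm_num⟩
    simp [upd, hc, show (18 : ℕ) ≠ a by omega, show (8 : ℕ) ≠ a by omega]

/-- The array of roots has to be empty: a root standing there must be full, but a decrease of its
key would make it hollow. -/
theorem ends_create (h : HeapInv N W m.int (m.real 2)) (hb : ∀ v < N, m.int 18 v = v * W)
    {u : ℕ} (hu : m.int 8 4 = u) (huN : u < N) (hW : m.int 7 1 + 3 ≤ W)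
    (hA : ∀ j, m.int 11 j = 0)
    (hd : m.int 17 u ≠ 0 → m.real 4 0 ≤ m.real 2 (m.int 17 u)) :
    Ends create m fun k m' => (HeapInv N W m'.int (m'.real 2) ∧
      heapPot W m'.int ≤ heapPot W m.int + 6) ∧ k ≤ 20 ∧
      (∀ a, a < 7 ∨ a = 9 ∨ 18 ≤ a → m'.int a = m.int a) ∧
      (∀ b, b ≠ 2 → m'.real b = m.real b) ∧
      (∀ w, m'.int 17 w = if w = u then m.int 7 1 + 1 else m.int 17 w) ∧
      (∀ y, m'.real 2 y = if y = m.int 7 1 + 1 then m.real 4 0 else m.real 2 y) ∧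
      m'.int 11 = m.int 11 ∧ m'.int 7 0 = m.int 7 0 + 1 ∧ m'.int 7 1 = m.int 7 1 + 1 ∧
      m'.int 7 2 = m.int 7 2 ∧ (∀ i, i < 5 → m'.int 8 i = m.int 8 i) := by
  have hbase := hb u huN
  have hrx : 1 ≤ m.int 16 (m.int 17 u) → m.int 17 u ≠ 0 := by
    intro h1 h0
    rw [h0, h.rank_zero] at h1
    omega
  have hxz : m.int 17 u ≠ m.int 7 1 + 1 := by
    intro he
    have := h.le_of_located (h.node u (by omega)).2.2
    omega
  -- The final memory is first written out cell by cell, so that the abstract lemma `HeapInv.create`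
  -- applies with every hypothesis read off.
  refine Ends.mono (Q := fun k m' => (∀ a i, m'.int a i =
    if a = 7 then (if i = 0 then m.int 7 0 + 1 else if i = 1 then m.int 7 1 + 1 else m.int 7 i)
    else if a = 8 then (if i = 6 then m.int 16 (m.int 17 u) else if i = 5 then m.int 17 u
      else m.int 8 i)
    else if a = 10 then (if i = m.int 7 0 then m.int 7 1 + 1 else m.int 10 i)
    else if a = 12 then (if 1 ≤ m.int 16 (m.int 17 u) ∧ i = u * W + (m.int 16 (m.int 17 u) - 1)
      then 0 else if 2 ≤ m.int 16 (m.int 17 u) ∧ i = u * W + (m.int 16 (m.int 17 u) - 2)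
      then 0 else m.int 12 i)
    else if a = 13 then (if 1 ≤ m.int 16 (m.int 17 u) ∧ i = m.int 17 u
      then m.int 12 (u * W + (m.int 16 (m.int 17 u) - 1)) else m.int 13 i)
    else if a = 14 then (if 2 ≤ m.int 16 (m.int 17 u) ∧ i = m.int 17 u
      then m.int 12 (u * W + (m.int 16 (m.int 17 u) - 2)) else m.int 14 i)
    else if a = 15 then (if i = m.int 7 1 + 1 then u else m.int 15 i)
    else if a = 16 then (if i = m.int 7 1 + 1 then m.int 16 (m.int 17 u) - 2 else m.int 16 i)
    else if a = 17 then (if i = u then m.int 7 1 + 1 else m.int 17 i)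
    else m.int a i) ∧ (∀ b y, m'.real b y =
      if b = 2 ∧ y = m.int 7 1 + 1 then m.real 4 0 else m.real b y) ∧ k ≤ 20) ?_ ?_
  · refine ends_seq ((ends_newNode hu).mono ?_)
    rintro k₁ m₁ ⟨g1, g2, g3⟩
    refine ends_seq ((ends_keepChild (a := 13) (c := 1) (by omega) (by omega)).mono ?_)
    rintro k₂ m₂ ⟨g4, g5, g6⟩
    refine (ends_keepChild (a := 14) (c := 2) (by omega) (by omega)).mono ?_
    rintro k₃ m₃ ⟨g7, g8, g9⟩
    have hcase : ∀ a : ℕ, a = 7 ∨ a = 8 ∨ a = 10 ∨ a = 12 ∨ a = 13 ∨ a = 14 ∨ a = 15 ∨ a = 16 ∨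
        a = 17 ∨ (a ≠ 7 ∧ a ≠ 8 ∧ a ≠ 10 ∧ a ≠ 12 ∧ a ≠ 13 ∧ a ≠ 14 ∧ a ≠ 15 ∧ a ≠ 16 ∧
        a ≠ 17) := by omega
    refine ⟨fun a i => ?_, fun b y => ?_, by omega⟩
    · have e : ∀ i, m₂.int 8 i = m₁.int 8 i := fun i => by simp [g4]
      have e' : ∀ i, m₂.int 18 i = m.int 18 i := fun i => by simp [g4, g1]
      have e8 : ∀ i, m₁.int 18 i = m.int 18 i := fun i => by simp [g1]
      have e12 : ∀ i, m₁.int 12 i = m.int 12 i := fun i => by simp [g1]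
      have e4 : m₁.int 8 4 = u := by simp [g1, hu]
      have e5 : m₁.int 8 5 = m.int 17 u := by simp [g1]
      have e6 : m₁.int 8 6 = m.int 16 (m.int 17 u) := by simp [g1]
      simp only [e, e', e4, e5, e6, hbase] at g7
      simp only [e8, e12, e4, e5, e6, hbase] at g4
      rw [g7, g4 a, g4 12]
      rcases hcase a with rfl | rfl | rfl | rfl | rfl | rfl | rfl | rfl | rfl | hn
      · simp [g1]
      · simp [g1]
      · simp [g1]
      · simp [g1]
        split_ifs <;> rfl
      · simp [g1]
      · simp [g1, e12]
        split_ifs <;> first | rfl | omega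
      · simp [g1]
      · simp [g1]
      · simp [g1]
      · simp [g1, hn]
    · rw [g8, g5, g2]
  · rintro k m' ⟨h1, h2, h3⟩
    refine ⟨h.create huN rfl rfl rfl hW hA hd ?_ ?_ ?_ ?_ ?_ ?_ ?_ ?_ ?_ ?_ ?_, h3, ?_, ?_, ?_, ?_,
      ?_, ?_, ?_, ?_, ?_⟩
    · intro y
      simp [h2]
    · intro i
      simp [h1]
    · intro i
      simp [h1]
    · intro i
      simp [h1]
    · intro i
      simp [h1]
    · intro i
      simp [h1]
    · intro i
      simp [h1]
    · intro i
      simp [h1]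
    · simp [h1]
    · simp [h1]
    · funext i
      simp [h1]
    · intro a ha
      funext i
      rw [h1]
      grind
    · intro b hb
      funext y
      simp [h2, hb]
    · intro w
      simp [h1]
    · intro y
      simp [h2]
    · funext i
      simp [h1]
    · simp [h1]
    · simp [h1]
    · simp [h1]
    · intro i hi
      simp [h1, show i ≠ 6 by omega, show i ≠ 5 by omega]

end

/-! ## Shortest paths by Dijkstra's method -/

section

variable {N M : ℕ} {G : Instance N M}

/-- The walk `vs`, `es` to the target node that starts at `u` and follows the pointers `ne` (next
edge) and `nv` (next node). -/
inductive Pointer (G : Instance N M) (ne nv : ℕ → ℕ) :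
    Fin N → List (Fin N) → List (Fin M) → Prop
  | nil : Pointer G ne nv G.target [G.target] []
  | cons {u w : Fin N} {e : Fin M} {vs : List (Fin N)} {es : List (Fin M)} :
      ne u = e → nv u = w → G.Joins e u w → Pointer G ne nv w vs es →
        Pointer G ne nv u (u :: vs) (e :: es)

namespace Pointer

variable {ne nv ne' nv' : ℕ → ℕ} {u : Fin N} {vs : List (Fin N)} {es : List (Fin M)}

theorem trace (h : Pointer G ne nv u vs es) : G.Trace u G.target vs es := by
  induction h with
  | nil => exact .nil _
  | cons _ _ hj _ ih => exact .cons hj ih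

theorem congr (h : Pointer G ne nv u vs es) (he : ∀ w ∈ vs, ne' w = ne w)
    (hv : ∀ w ∈ vs, nv' w = nv w) : Pointer G ne' nv' u vs es := by
  induction h with
  | nil => exact .nil
  | cons h1 h2 hj _ ih =>
    simp only [List.mem_cons, forall_eq_or_imp] at he hv
    exact .cons (he.1.trans h1) (hv.1.trans h2) hj (ih he.2 hv.2)

end Pointer

/-- The state of a search from the target node along the edges of weight at most `θ`: the nodes
in `done` are finished, those in `queued` have a tentative distance, and `proc e u w` says that
the passage from `u` to `w` along `e` was examined. -/
structure Search (G : Instance N M) (θ : ℝ) (proc : Fin M → Fin N → Fin N → Prop)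
    (done queued : Fin N → Prop) (ne nv : ℕ → ℕ) (dist : ℕ → ℝ) : Prop where
  disjoint : ∀ v, done v → ¬ queued v
  target : done G.target ∨ queued G.target
  target_dist : dist G.target = 0
  nonneg : ∀ v, done v ∨ queued v → 0 ≤ dist v
  le : ∀ w v, done w → queued v → dist w ≤ dist v
  arcs : ∀ e u w, proc e u w → done w ∧
    (G.weight e ≤ θ → (done u ∨ queued u) ∧ dist u ≤ dist w + G.nominal e)
  path : ∀ u, done u ∨ queued u → ∃ vs es, vs.Nodup ∧ (∀ w ∈ vs.tail, done w) ∧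
    Pointer G ne nv u vs es ∧ (∀ e ∈ es, G.weight e ≤ θ) ∧ dist u = (es.map G.nominal).sum

namespace Search

variable {θ : ℝ} {proc proc' : Fin M → Fin N → Fin N → Prop}
  {done queued done' queued' : Fin N → Prop} {ne nv ne' nv' : ℕ → ℕ} {dist dist' : ℕ → ℝ}

theorem init (hp : ∀ e u w, ¬ proc e u w) (hd : ∀ v, ¬ done v)
    (hq : ∀ v, queued v ↔ v = G.target) (h0 : dist G.target = 0) :
    Search G θ proc done queued ne nv dist where
  disjoint v h := absurd h (hd v)
  target := Or.inr ((hq _).2 rfl)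
  target_dist := h0
  nonneg v h := by
    have : v = G.target := by simpa [hd, hq] using h
    rw [this, h0]
  le w v h := absurd h (hd w)
  arcs e u w h := absurd h (hp e u w)
  path u h := by
    have : u = G.target := by simpa [hd, hq] using h
    subst this
    exact ⟨_, _, List.nodup_singleton _, by simp, .nil, by simp, by simp [h0]⟩

theorem pop (h : Search G θ proc done queued ne nv dist) {v : Fin N} (hv : queued v)
    (hmin : ∀ u, queued u → dist v ≤ dist u)
    (hp : ∀ e u w, proc' e u w → proc e u w)
    (hd : ∀ u, done' u ↔ u = v ∨ done u) (hq : ∀ u, queued' u ↔ queued u ∧ u ≠ v) :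
    Search G θ proc' done' queued' ne nv dist ∧ ∀ u, done' u → dist u ≤ dist v := by
  have hdq : ∀ u, done' u ∨ queued' u ↔ done u ∨ queued u := by
    intro u
    rw [hd, hq]
    by_cases hu : u = v
    · subst hu
      simp [hv]
    · simp [hu]
  refine ⟨⟨?_, ?_, h.target_dist, ?_, ?_, ?_, ?_⟩, ?_⟩
  · intro u hu hu'
    rw [hq] at hu'
    rcases (hd u).1 hu with he | he
    · exact hu'.2 he
    · exact h.disjoint u he hu'.1
  · exact (hdq _).2 h.target
  · exact fun u hu => h.nonneg u ((hdq u).1 hu)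
  · intro w u hw hu
    rcases (hd w).1 hw with rfl | hw
    · exact hmin u ((hq u).1 hu).1
    · exact h.le w u hw ((hq u).1 hu).1
  · intro e u w hw
    obtain ⟨h1, h2⟩ := h.arcs e u w (hp e u w hw)
    exact ⟨(hd w).2 (Or.inr h1), fun ht => ⟨(hdq u).2 (h2 ht).1, (h2 ht).2⟩⟩
  · intro u hu
    obtain ⟨vs, es, h1, h2, h3⟩ := h.path u ((hdq u).1 hu)
    exact ⟨vs, es, h1, fun w hw => (hd w).2 (Or.inr (h2 w hw)), h3⟩
  · intro u hu
    rcases (hd u).1 hu with rfl | hu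
    · exact le_rfl
    · exact h.le u v hu hv

/-- An examined passage that does not improve the tentative distance. -/
theorem skip (h : Search G θ proc done queued ne nv dist) {v u : Fin N} {e : Fin M}
    (hv : done v) (hmax : ∀ x, done x → dist x ≤ dist v)
    (hp : ∀ e' u' w', proc' e' u' w' → proc e' u' w' ∨ (e' = e ∧ u' = u ∧ w' = v))
    (hno : θ < G.weight e ∨ done u ∨ (queued u ∧ dist u ≤ dist v + G.nominal e)) :
    Search G θ proc' done queued ne nv dist :=
  { h with
    arcs := by
      intro e' u' w' hpr
      rcases hp e' u' w' hpr with ho | ⟨rfl, rfl, rfl⟩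
      · exact h.arcs e' u' w' ho
      · refine ⟨hv, fun ht => ?_⟩
        rcases hno with hn | hn | hn
        · exact absurd ht (not_le.2 hn)
        · exact ⟨Or.inl hn, (hmax _ hn).trans (by linarith [G.nominal_nonneg e'])⟩
        · exact ⟨Or.inr hn.1, hn.2⟩ }

/-- An examined passage that improves the tentative distance of `u`. -/
theorem relax (h : Search G θ proc done queued ne nv dist) {v u : Fin N} {e : Fin M}
    (hv : done v) (hmax : ∀ x, done x → dist x ≤ dist v) (hj : G.Joins e u v)
    (ht : G.weight e ≤ θ) (hu : ¬ done u) (hlt : queued u → dist v + G.nominal e < dist u)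
    (hp : ∀ e' u' w', proc' e' u' w' → proc e' u' w' ∨ (e' = e ∧ u' = u ∧ w' = v))
    (hd : ∀ x, done' x ↔ done x) (hq : ∀ x, queued' x ↔ x = u ∨ queued x)
    (hdist : ∀ x : ℕ, dist' x = if x = u then dist v + G.nominal e else dist x)
    (hne : ∀ x : ℕ, ne' x = if x = u then (e : ℕ) else ne x)
    (hnv : ∀ x : ℕ, nv' x = if x = u then (v : ℕ) else nv x) :
    Search G θ proc' done' queued' ne' nv' dist' ∧ ∀ x, done' x → dist' x ≤ dist' v := by
  obtain rfl : done' = done := by funext x; simp [hd]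
  have hvu : v ≠ u := fun he => hu (he ▸ hv)
  have hv0 := h.nonneg v (Or.inl hv)
  have he0 := G.nominal_nonneg e
  have hoff : ∀ x : Fin N, x ≠ u → dist' x = dist x := fun x hx => by
    rw [hdist, if_neg (by simpa [Fin.ext_iff] using hx)]
  have hat : dist' u = dist v + G.nominal e := by rw [hdist, if_pos rfl]
  have hdone : ∀ x, done' x → dist' x = dist x := fun x hx => hoff x fun he => hu (he ▸ hx)
  -- The end node has distance `0`, which no passage can improve.
  have htu : G.target ≠ u := by
    rintro rfl
    rcases h.target with h1 | h1
    · exact hu h1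
    · have := hlt h1
      rw [h.target_dist] at this
      linarith
  have hdec : ∀ x, done' x ∨ queued x → dist' x ≤ dist x := by
    intro x hx
    by_cases hxu : x = u
    · subst hxu
      rw [hat]
      exact (hlt (hx.resolve_left hu)).le
    · rw [hoff x hxu]
  refine ⟨⟨?_, ?_, ?_, ?_, ?_, ?_, ?_⟩, ?_⟩
  · intro x hx hx'
    rcases (hq x).1 hx' with rfl | hx'
    · exact hu hx
    · exact h.disjoint x hx hx'
  · exact h.target.imp id fun h' => (hq _).2 (Or.inr h')
  · rw [hoff _ htu, h.target_dist]
  · intro x hx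
    by_cases hxu : x = u
    · subst hxu
      rw [hat]
      linarith
    · rw [hoff x hxu]
      exact h.nonneg x (hx.imp id fun h' => ((hq x).1 h').resolve_left hxu)
  · intro w x hw hx
    rw [hdone w hw]
    by_cases hxu : x = u
    · subst hxu
      rw [hat]
      linarith [hmax w hw]
    · rw [hoff x hxu]
      exact h.le w x hw (((hq x).1 hx).resolve_left hxu)
  · intro e' u' w' hpr
    rcases hp e' u' w' hpr with ho | ⟨rfl, rfl, rfl⟩
    · obtain ⟨h1, h2⟩ := h.arcs e' u' w' ho
      refine ⟨h1, fun hw => ?_⟩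
      obtain ⟨h3, h4⟩ := h2 hw
      rw [hdone w' h1]
      exact ⟨h3.imp id fun h' => (hq _).2 (Or.inr h'), (hdec u' h3).trans h4⟩
    · refine ⟨hv, fun _ => ⟨Or.inr ((hq _).2 (Or.inl rfl)), ?_⟩⟩
      rw [hat, hdone _ hv]
  -- Only the pointers at `u` change, and `u` is not finished, whereas all later nodes of a pointer
  -- path are. So the other pointer paths persist.
  · have hcongr : ∀ {x vs es}, (∀ w ∈ vs, w ≠ u) → Pointer G ne nv x vs es →
        Pointer G ne' nv' x vs es := by
      intro x vs es hvs hpt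
      refine hpt.congr (fun w hw => ?_) fun w hw => ?_
      · rw [hne, if_neg (by simpa [Fin.ext_iff] using hvs w hw)]
      · rw [hnv, if_neg (by simpa [Fin.ext_iff] using hvs w hw)]
    intro x hx
    by_cases hxu : x = u
    · subst hxu
      obtain ⟨vs, es, h1, h2, h3, h4, h5⟩ := h.path v (Or.inl hv)
      have hall : ∀ w ∈ vs, done' w := by
        cases h3 with
        | nil => simpa using hv
        | cons => simpa using ⟨hv, h2⟩
      refine ⟨x :: vs, e :: es, ?_, hall, .cons (by simp [hne]) (by simp [hnv]) hj
        (hcongr (fun w hw he => hu (he ▸ hall w hw)) h3), ?_, ?_⟩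
      · exact List.nodup_cons.2 ⟨fun hm => hu (hall x hm), h1⟩
      · simpa using ⟨ht, h4⟩
      · rw [hat, h5]
        simp [add_comm]
    · obtain ⟨vs, es, h1, h2, h3, h4, h5⟩ :=
        h.path x (hx.imp id fun h' => ((hq x).1 h').resolve_left hxu)
      refine ⟨vs, es, h1, h2, hcongr ?_ h3, h4, by rw [hoff x hxu, h5]⟩
      intro w hw he
      subst he
      cases h3 with
      | nil => exact hxu (by simpa using (List.mem_singleton.1 hw).symm)
      | cons =>
        rcases List.mem_cons.1 hw with hw | hw
        · exact hxu hw.symm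
        · exact hu (h2 _ hw)
  · intro x hx
    rw [hdone x hx, hdone v hv]
    exact hmax x hx

/-- When the queue is empty, the finished nodes are those from which the target node can be
reached, and no walk is shorter than the computed distance. -/
theorem dist_le (h : Search G θ proc done queued ne nv dist) (hq : ∀ v, ¬ queued v)
    (hp : ∀ e u w, G.Joins e u w → done w → proc e u w) {u : Fin N} {vs : List (Fin N)}
    {es : List (Fin M)} (ht : G.Trace u G.target vs es) (hw : ∀ e ∈ es, G.weight e ≤ θ) :
    done u ∧ dist u ≤ (es.map G.nominal).sum := by
  generalize hv : G.target = v at ht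
  -- Induction along the walk: if its rest starts at a finished node, all passages into that node
  -- were examined, which bounds the distance of the node before it.
  induction ht with
  | nil =>
    subst hv
    exact ⟨h.target.resolve_right (hq _), by simp [h.target_dist]⟩
  | @cons u w _ e vs es hj _ ih =>
    simp only [List.mem_cons, forall_eq_or_imp] at hw
    obtain ⟨h1, h2⟩ := ih hw.2 hv
    obtain ⟨-, h3⟩ := h.arcs e u w (hp e u w hj h1)
    obtain ⟨h4, h5⟩ := h3 hw.1
    refine ⟨h4.resolve_right (hq _), ?_⟩
    simp only [List.map_cons, List.sum_cons]
    linarith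

end Search

end

/-! ### Dijkstra's method as a program -/

namespace SearchProg

/-- The number of the current search. -/
def stamp : NatExp := .cell 9 0

/-- The arc that is examined. -/
def arc : NatExp := .cell 9 1 - 1

/-- The node that was finished last. -/
def cur : NatExp := .cell 9 2

/-- The first node of the arc. -/
def src : NatExp := .cell 20 arc

/-- The edge of the arc. -/
def edge : NatExp := .cell 22 arc

/-- The arc may be used and improves a tentative distance. -/
def useful : Test :=
  .conj (.neg (.realLt (.cell 1 (stamp - 1)) (.cell 1 edge)))
    (.conj (.neg (.natEq (.cell 19 src) stamp))
      (.neg (.conj (.neg (.natEq (.cell 17 src) 0)) (.neg (.realLt (.cell 4 0) (.cell 3 src))))))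

/-- Record the improved distance. -/
def improve : Prog := .block [
  .setNat 8 4 src,
  .setReal 3 src (.cell 4 0),
  .setNat 25 src edge,
  .setNat 26 src cur,
  HeapProg.create]

/-- Examine an arc and go to the next one. -/
def examine : Prog := .block [
  .setReal 4 0 (.cell 3 cur + .cell 0 edge),
  .cond useful improve .skip,
  .setNat 9 1 (.cell 23 arc)]

/-- Finish the node of smallest tentative distance. -/
def finish : Prog := .block [
  HeapProg.takeMin,
  .setNat 9 2 (.cell 8 3),
  .setNat 19 cur stamp,
  .setNat 9 1 (.cell 24 cur),
  .loop (.natLt 0 (.cell 9 1)) examine]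

/-- Finish one more node, if there is one in the queue. -/
def round : Prog := .block [
  HeapProg.drain,
  HeapProg.scan,
  .cond (.natEq (.cell 8 2) 0) .skip finish]

/-- Put the target node into an empty queue. -/
def start : Prog := .block [
  .setNat 7 1 0,
  .setNat 7 2 0,
  .setNat 8 4 (.cell 0 3),
  .setReal 4 0 0,
  .setReal 3 (.cell 0 3) 0,
  HeapProg.create]

/-- The search from the target node. -/
def search : Prog := .seq start (.loop (.natLt 0 HeapProg.top) round)

end SearchProg

open SearchProg HeapProg

/-! ### The graph in memory, and the examination of one arc -/

section

variable {N M : ℕ} {G : Instance N M}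

/-- The arrays `20`, `21`, `22` list `K` arcs (first node, second node, edge), the arcs with the
same second node are chained by the arrays `23` and `24`, and array `18` holds the starts of the
blocks of children. -/
structure GraphData (G : Instance N M) (K : ℕ) (f : ℕ → ℕ → ℕ) (g : ℕ → ℕ → ℝ) : Prop where
  edges : f 0 1 = M
  source : f 0 2 = G.source
  target : f 0 3 = G.target
  base : ∀ v, v < N → f 18 v = v * (K + 3)
  arc : ∀ a, a < K → ∃ (e : Fin M) (u w : Fin N),
    f 20 a = u ∧ f 21 a = w ∧ f 22 a = e ∧ G.Joins e u w
  joins : ∀ e u w, G.Joins e u w → ∃ a, a < K ∧ f 20 a = u ∧ f 21 a = w ∧ f 22 a = e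
  next_le : ∀ a, a < K → f 23 a ≤ a
  next_dst : ∀ a, a < K → f 23 a ≠ 0 → f 21 (f 23 a - 1) = f 21 a
  next_lt : ∀ a, a < K → ∀ b, b < a → f 21 b = f 21 a → b < f 23 a
  first_le : ∀ v, v < N → f 24 v ≤ K
  first_dst : ∀ v, v < N → f 24 v ≠ 0 → f 21 (f 24 v - 1) = v
  first_lt : ∀ b, b < K → b < f 24 (f 21 b)
  nominal : ∀ e : Fin M, g 0 e = G.nominal e
  weight : ∀ e : Fin M, g 1 e = G.weight e

theorem GraphData.congr {K : ℕ} {f f' : ℕ → ℕ → ℕ} {g g' : ℕ → ℕ → ℝ} (h : GraphData G K f g)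
    (h0 : f' 0 = f 0) (h18 : f' 18 = f 18) (hf : ∀ a, 20 ≤ a → a ≤ 24 → f' a = f a)
    (hg : ∀ b, b ≤ 1 → g' b = g b) : GraphData G K f' g' := by
  have e20 := hf 20 (by omega) (by omega)
  have e21 := hf 21 (by omega) (by omega)
  have e22 := hf 22 (by omega) (by omega)
  have e23 := hf 23 (by omega) (by omega)
  have e24 := hf 24 (by omega) (by omega)
  have g0 := hg 0 (by omega)
  have g1 := hg 1 (by omega)
  obtain ⟨i1, i2, i3, i4, i5, i6, i7, i8, i9, i10, i11, i12, i13, i14⟩ := h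
  constructor <;> simp only [h0, h18, e20, e21, e22, e23, e24, g0, g1] <;> assumption

/-- The heap arrays in their initial state. -/
structure HeapEmpty (f : ℕ → ℕ → ℕ) : Prop where
  top : f 7 0 = 0
  rank : f 16 0 = 0
  zero : ∀ a i, 10 ≤ a → a ≤ 14 → f a i = 0
  node : ∀ v, f 17 v = 0

theorem HeapEmpty.pot {f : ℕ → ℕ → ℕ} (h : HeapEmpty f) (W : ℕ) : heapPot W f = 0 := by
  simp [heapPot, h.top, h.zero]

/-- Arrays `15` and `16` may keep values of earlier searches, because only their entries at present
nodes matter and new nodes overwrite them. This makes restarting cheap: resetting counters replaces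
clearing arrays. -/
theorem HeapEmpty.inv {f : ℕ → ℕ → ℕ} (h : HeapEmpty f) {N W : ℕ} (hW : 2 ≤ W) (h1 : f 7 1 = 0)
    (key : ℕ → ℝ) : HeapInv N W f key where
  stack i := by simp [h.top, h.zero]
  root i hi := absurd (h.zero 11 i (by omega) (by omega)) hi
  kid i hi := absurd (h.zero 12 i (by omega) (by omega)) hi
  kids v i hv := absurd (h.node v) hv
  hollow₁ i hi := absurd (h.zero 13 i (by omega) (by omega)) hi
  hollow₂ i hi := absurd (h.zero 14 i (by omega) (by omega)) hi
  node v hv := absurd (h.node v) hv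
  le a i ha ha' := by simp [h.zero a i ha ha']
  placed a i b j ha ha' hb hb' he hn := absurd (h.zero a i ha ha') hn
  rank_zero := h.rank
  count := by omega
  weight := by simp [heapWeight, h.top, h.zero, h.node, h.rank]

/-- What a search does not change. -/
structure SearchFrame (m m' : Memory) : Prop where
  int : ∀ a, a < 7 ∨ a = 18 ∨ (20 ≤ a ∧ a ≤ 24) ∨ 27 ≤ a → m'.int a = m.int a
  register : ∀ i, i ≠ 1 → i ≠ 2 → m'.int 9 i = m.int 9 i
  real : ∀ b, b ≠ 2 → b ≠ 3 → b ≠ 4 → m'.real b = m.real b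

theorem SearchFrame.refl (m : Memory) : SearchFrame m m :=
  ⟨fun _ _ => rfl, fun _ _ _ => rfl, fun _ _ _ _ => rfl⟩

theorem SearchFrame.trans {m m' m'' : Memory} (h : SearchFrame m m') (h' : SearchFrame m' m'') :
    SearchFrame m m'' where
  int a ha := (h'.int a ha).trans (h.int a ha)
  register i h1 h2 := (h'.register i h1 h2).trans (h.register i h1 h2)
  real b h1 h2 h3 := (h'.real b h1 h2 h3).trans (h.real b h1 h2 h3)

theorem GraphData.frame {K : ℕ} {m m' : Memory} (h : GraphData G K m.int m.real)
    (hf : SearchFrame m m') : GraphData G K m'.int m'.real :=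
  h.congr (hf.int 0 (by omega)) (hf.int 18 (by omega)) (fun a _ _ => hf.int a (by omega))
    fun b _ => hf.real b (by omega) (by omega) (by omega)

/-- The number of the arcs that were not examined, when those into the node `v` with an index
below `j` are still to come. -/
def arcsLeft (K s v j : ℕ) (f : ℕ → ℕ → ℕ) : ℕ :=
  ((Finset.range K).filter fun a => f 19 (f 21 a) ≠ s).card +
    ((Finset.range j).filter fun a => f 21 a = v).card

/-- The number of the nodes that are not finished. -/
def nodesLeft (N s : ℕ) (f : ℕ → ℕ → ℕ) : ℕ :=
  ((Finset.range N).filter fun v => f 19 v ≠ s).card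

/-- The state of the search for the edge `e₀`, where the arcs into the node `v` with an index
below `j` are still to be examined. -/
structure SearchState (G : Instance N M) (K : ℕ) (e₀ : Fin M) (v j : ℕ) (m : Memory) : Prop where
  data : GraphData G K m.int m.real
  heap : HeapInv N (K + 3) m.int (m.real 2)
  stamp : m.int 9 0 = e₀ + 1
  stamps : ∀ u, m.int 19 u ≤ e₀ + 1
  key : ∀ u, m.int 17 u ≠ 0 → m.real 2 (m.int 17 u) = m.real 3 u
  count : m.int 7 1 + arcsLeft K (e₀ + 1) v j m.int ≤ K + 1
  rank : Nat.fib (m.int 7 2 + 1) ≤ K + 2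
  search : Search G (G.weight e₀) (fun e u w => ∃ a, a < K ∧ m.int 20 a = u ∧ m.int 21 a = w ∧
      m.int 22 a = e ∧ m.int 19 w = e₀ + 1 ∧ ¬ ((w : ℕ) = v ∧ a < j))
    (fun u => m.int 19 u = e₀ + 1) (fun u => m.int 17 u ≠ 0) (m.int 25) (m.int 26) (m.real 3)

/-- The state of the search while the arcs into the node `v` are examined. -/
structure ExamineState (G : Instance N M) (K : ℕ) (e₀ : Fin M) (v : Fin N) (j : ℕ)
    (m : Memory) : Prop extends SearchState G K e₀ v j m where
  finished : m.int 19 v = e₀ + 1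
  max : ∀ u : Fin N, m.int 19 u = e₀ + 1 → m.real 3 u ≤ m.real 3 v
  roots : ∀ i, m.int 11 i = 0
  arc_eq : m.int 9 1 = j
  cur_eq : m.int 9 2 = v
  le : j ≤ K
  dst : j ≠ 0 → m.int 21 (j - 1) = v

/-- The chain of a node lists its arcs by decreasing index, and positions are stored as index plus
one so that `0` ends the chain. Going from `j` to `j'` thus passes exactly the arc `j - 1`. -/
theorem arcsLeft_succ {K s v j j' : ℕ} {f f' : ℕ → ℕ → ℕ} (h19 : f' 19 = f 19)
    (h21 : f' 21 = f 21) (hj : j ≠ 0) (hv : f 21 (j - 1) = v) (hle : j' ≤ j - 1)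
    (hlt : ∀ b, b < j - 1 → f 21 b = v → b < j') :
    arcsLeft K s v j f = arcsLeft K s v j' f' + 1 := by
  have : (Finset.range j).filter (fun a => f 21 a = v) =
      insert (j - 1) ((Finset.range j').filter fun a => f 21 a = v) := by
    ext b
    simp only [Finset.mem_filter, Finset.mem_range, Finset.mem_insert]
    constructor
    · rintro ⟨h1, h2⟩
      by_cases hb : b = j - 1
      · exact Or.inl hb
      · exact Or.inr ⟨hlt b (by omega) h2, h2⟩
    · rintro (rfl | ⟨h1, h2⟩)
      · exact ⟨by omega, hv⟩
      · exact ⟨by omega, h2⟩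
  rw [arcsLeft, arcsLeft, h19, h21, this, Finset.card_insert_of_notMem]
  · omega
  · simp only [Finset.mem_filter, Finset.mem_range]
    omega

variable {K : ℕ} {e₀ : Fin M} {m : Memory}

/-- An examined arc releases `200` units. A new node raises the potential by at most `6`, that is
`126` after the factor `21`, and the rest covers the steps. -/
theorem ends_examine {v : Fin N} {j : ℕ} (h : ExamineState G K e₀ v j m) (hj : j ≠ 0) :
    Ends examine m fun k m' => (∃ j', ExamineState G K e₀ v j' m' ∧
      k + 1 + 21 * heapPot (K + 3) m'.int + 200 * arcsLeft K (e₀ + 1) v j' m'.int ≤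
        21 * heapPot (K + 3) m.int + 200 * arcsLeft K (e₀ + 1) v j m.int) ∧
      SearchFrame m m' ∧ m'.int 19 = m.int 19 := by
  have hD := h.data
  have hjK : j - 1 < K := by have := h.le; omega
  have hdst := h.dst hj
  obtain ⟨e, u, w, ha1, ha2, ha3, hjo⟩ := hD.arc (j - 1) hjK
  obtain rfl : w = v := Fin.ext (ha2.symm.trans hdst)
  have hnle := hD.next_le (j - 1) hjK
  have hndst : m.int 23 (j - 1) ≠ 0 → m.int 21 (m.int 23 (j - 1) - 1) = w := fun h0 =>
    (hD.next_dst (j - 1) hjK h0).trans ha2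
  have hnlt : ∀ b, b < j - 1 → m.int 21 b = w → b < m.int 23 (j - 1) := fun b hb hb' =>
    hD.next_lt (j - 1) hjK b hb (hb'.trans ha2.symm)
  have hs := h.stamp
  have hc := h.cur_eq
  have hjj := h.arc_eq
  -- Of all passages, only the one along the arc `j - 1` can be newly examined.
  have hproc : ∀ (f : ℕ → ℕ → ℕ), f 19 = m.int 19 → f 20 = m.int 20 → f 21 = m.int 21 →
      f 22 = m.int 22 → ∀ (e' : Fin M) (u' w' : Fin N), (∃ a, a < K ∧ f 20 a = u' ∧ f 21 a = w' ∧
      f 22 a = e' ∧ f 19 w' = e₀ + 1 ∧ ¬ ((w' : ℕ) = w ∧ a < m.int 23 (j - 1))) →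
      (∃ a, a < K ∧ m.int 20 a = u' ∧ m.int 21 a = w' ∧
      m.int 22 a = e' ∧ m.int 19 w' = e₀ + 1 ∧ ¬ ((w' : ℕ) = w ∧ a < j)) ∨
      (e' = e ∧ u' = u ∧ w' = w) := by
    rintro f f19 f20 f21 f22 e' u' w' ⟨a, h1, h2, h3, h4, h5, h6⟩
    rw [f20] at h2
    rw [f21] at h3
    rw [f22] at h4
    rw [f19] at h5
    by_cases hx : (w' : ℕ) = w ∧ a < j
    · have haj : a = j - 1 := by
        by_contra hne
        exact h6 ⟨hx.1, hnlt a (by omega) (by rw [h3, hx.1])⟩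
      subst haj
      exact Or.inr ⟨Fin.ext (h4.symm.trans ha3), Fin.ext (h2.symm.trans ha1),
        Fin.ext (h3.symm.trans ha2)⟩
    · exact Or.inl ⟨a, h1, h2, h3, h4, h5, hx⟩
  rw [examine, Prog.block, Prog.block, Prog.block, Prog.block]
  refine ends_seq (ends_setReal (ends_seq (ends_cond (fun ht => ?_) fun ht => ?_)))
  · simp [useful, SearchProg.stamp, SearchProg.edge, SearchProg.arc, SearchProg.src,
      SearchProg.cur, upd, hs, hc, hjj, ha1, ha2, ha3, hD.weight, hD.nominal] at ht
    obtain ⟨ht1, ht2, ht3⟩ := ht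
    rw [improve, Prog.block, Prog.block, Prog.block, Prog.block, Prog.block, Prog.block]
    refine ends_seq (ends_setNat (ends_seq (ends_setReal (ends_seq (ends_setNat (ends_seq
      (ends_setNat (ends_seq ?_))))))))
    generalize hm₁ : Memory.setNat (Memory.setNat (Memory.setReal _ _ _ _) _ _ _) _ _ _ = m₁
    have i8 : m₁.int 8 4 = u := by
      simp [← hm₁, SearchProg.edge, SearchProg.arc, SearchProg.src, SearchProg.cur, upd, hjj, ha1]
    have ioff : ∀ a, a ≠ 8 → a ≠ 25 → a ≠ 26 → m₁.int a = m.int a := by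
      intro a h1 h2 h3
      funext i
      simp [← hm₁, SearchProg.edge, SearchProg.arc, SearchProg.src, SearchProg.cur, upd, h1, h2, h3]
    have i25 : ∀ x, m₁.int 25 x = if x = u then (e : ℕ) else m.int 25 x := by
      intro x
      simp [← hm₁, SearchProg.edge, SearchProg.arc, SearchProg.src, SearchProg.cur, upd, hjj, ha1,
        ha3]
    have i26 : ∀ x, m₁.int 26 x = if x = u then (w : ℕ) else m.int 26 x := by
      intro x
      simp [← hm₁, SearchProg.edge, SearchProg.arc, SearchProg.src, SearchProg.cur, upd, hjj, ha1,
        hc]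
    have ir4 : m₁.real 4 0 = m.real 3 w + G.nominal e := by
      simp [← hm₁, SearchProg.edge, SearchProg.arc, SearchProg.src, SearchProg.cur, upd, hjj, ha1,
        ha3, hc, hD.nominal]
    have ir3 : ∀ x, m₁.real 3 x = if x = u then m.real 3 w + G.nominal e else m.real 3 x := by
      intro x
      simp [← hm₁, SearchProg.edge, SearchProg.arc, SearchProg.src, SearchProg.cur, upd, hjj, ha1,
        ha3, hc, hD.nominal]
    have iroff : ∀ b, b ≠ 3 → b ≠ 4 → m₁.real b = m.real b := by
      intro b h1 h2
      funext i
      simp [← hm₁, upd, h1, h2]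
    clear hm₁
    have e7 := ioff 7 (by omega) (by omega) (by omega)
    have e11 := ioff 11 (by omega) (by omega) (by omega)
    have e17 := ioff 17 (by omega) (by omega) (by omega)
    have e18 := ioff 18 (by omega) (by omega) (by omega)
    have e19 := ioff 19 (by omega) (by omega) (by omega)
    obtain ⟨g1, g2⟩ := h.heap.congr (f' := m₁.int) (fun i _ => by rw [e7])
      (fun a _ _ => ioff a (by omega) (by omega) (by omega))
    rw [← iroff 2 (by omega) (by omega)] at g1
    -- There is room for one more node: the current arc is still counted among those left, and
    -- created nodes plus arcs left are at most `K + 1`.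
    have hleft := arcsLeft_succ (K := K) (s := e₀ + 1) (f' := m.int) rfl rfl hj hdst hnle hnlt
    have hcnt := h.count
    refine (ends_create g1 (by rw [e18]; exact hD.base) i8 u.2 (by rw [e7]; omega)
      (by rw [e11]; exact h.roots) ?_).mono ?_
    · intro hq
      rw [e17] at hq ⊢
      rw [iroff 2 (by omega) (by omega), h.key u hq, ir4]
      exact (ht3 hq).le
    rintro k m₂ ⟨⟨q1, q2⟩, q3, q4, q5, q6, q7, q8, q9, q10, q11, q12⟩
    refine ends_skip (ends_seq (ends_setNat (ends_skip ?_)))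
    generalize hm₃ : Memory.setNat m₂ _ _ _ = m₃
    have p9 : ∀ i, m₃.int 9 i = if i = 1 then m.int 23 (j - 1) else m.int 9 i := by
      intro i
      simp [← hm₃, SearchProg.arc, upd, q4, ioff, hjj]
    have poff : ∀ a, a ≠ 9 → m₃.int a = m₂.int a := by
      intro a h1
      funext i
      simp [← hm₃, upd, h1]
    have pr : m₃.real = m₂.real := by simp [← hm₃]
    clear hm₃
    obtain ⟨o1, o2⟩ := q1.congr (f' := m₃.int) (fun i _ => by rw [poff 7 (by omega)])
      (fun a _ _ => poff a (by omega))
    rw [← pr] at o1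
    have hst : ∀ a, a < 7 ∨ 18 ≤ a → a ≠ 25 → a ≠ 26 → m₃.int a = m.int a := by
      intro a h1 h2 h3
      rw [poff a (by omega), q4 a (by omega), ioff a (by omega) h2 h3]
    have hstr : ∀ b, b ≠ 2 → b ≠ 3 → b ≠ 4 → m₃.real b = m.real b := by
      intro b h1 h2 h3
      rw [pr, q5 b h1, iroff b h2 h3]
    have hfr : SearchFrame m m₃ := by
      refine ⟨fun a ha => hst a (by omega) (by omega) (by omega), fun i h1 h2 => ?_, hstr⟩
      rw [p9, if_neg h1]
    have s19 := hst 19 (by omega) (by omega) (by omega)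
    have s20 := hst 20 (by omega) (by omega) (by omega)
    have s21 := hst 21 (by omega) (by omega) (by omega)
    have s22 := hst 22 (by omega) (by omega) (by omega)
    have s17 : ∀ x, m₃.int 17 x = if x = u then m.int 7 1 + 1 else m.int 17 x := by
      intro x
      rw [poff 17 (by omega), q6, e7, e17]
    have s3 : ∀ x, m₃.real 3 x = if x = u then m.real 3 w + G.nominal e else m.real 3 x := by
      intro x
      rw [pr, q5 3 (by omega), ir3]
    have hleft' := arcsLeft_succ (K := K) (s := e₀ + 1) (f' := m₃.int) s19 s21 hj hdst hnle hnlt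
    obtain ⟨t1, t2⟩ := h.search.relax h.finished h.max hjo ht1 ht2 ht3
      (hproc m₃.int s19 s20 s21 s22) (done' := fun x => m₃.int 19 x = e₀ + 1)
      (fun x => by rw [s19]) (queued' := fun x => m₃.int 17 x ≠ 0) (ne' := m₃.int 25) (nv' := m₃.int 26)
      (dist' := m₃.real 3)
      (fun x => by
        rw [s17]
        by_cases hx : x = u
        · simp [hx]
        · have hx' : (x : ℕ) ≠ u := fun he => hx (Fin.ext he)
          simp [hx, hx'])
      s3 (fun x => by rw [poff 25 (by omega), q4 25 (by omega), i25])
      (fun x => by rw [poff 26 (by omega), q4 26 (by omega), i26])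
    refine ⟨⟨m.int 23 (j - 1), ⟨⟨hD.frame hfr, o1, ?_, ?_, ?_, ?_, ?_, t1⟩, ?_, t2, ?_, ?_, ?_, ?_,
      ?_⟩, ?_⟩, hfr, s19⟩
    · rw [p9, if_neg (by omega), hs]
    · rw [s19]
      exact h.stamps
    · intro x hx
      rw [pr, q7, ← pr, s3, s17, e7]
      rw [s17] at hx
      by_cases hxu : x = u
      · simp [hxu, ir4]
      · rw [if_neg hxu] at hx
        have := h.heap.le_of_located (h.heap.node x hx).2.2
        rw [if_neg hxu, if_neg hxu, if_neg (by omega), iroff 2 (by omega) (by omega), h.key x hx]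
    · rw [poff 7 (by omega), q10, e7]
      omega
    · rw [poff 7 (by omega), q11, e7]
      exact h.rank
    · rw [s19]
      exact h.finished
    · rw [poff 11 (by omega), q8, e11]
      exact h.roots
    · simp [p9]
    · rw [p9, if_neg (by omega), hc]
    · omega
    · rw [s21]
      exact hndst
    · rw [o2]
      omega
  · simp [useful, SearchProg.stamp, SearchProg.edge, SearchProg.arc, SearchProg.src,
      SearchProg.cur, upd, hs, hc, hjj, ha1, ha2, ha3, hD.weight, hD.nominal] at ht
    refine ends_skip (ends_seq (ends_setNat (ends_skip ?_)))
    generalize hm₃ : Memory.setNat _ _ _ _ = m₃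
    have p9 : ∀ i, m₃.int 9 i = if i = 1 then m.int 23 (j - 1) else m.int 9 i := by
      intro i
      simp [← hm₃, SearchProg.arc, upd, hjj]
    have poff : ∀ a, a ≠ 9 → m₃.int a = m.int a := by
      intro a h1
      funext i
      simp [← hm₃, upd, h1]
    have pr : ∀ b, b ≠ 4 → m₃.real b = m.real b := by
      intro b hb
      funext i
      simp [← hm₃, upd, hb]
    clear hm₃
    obtain ⟨o1, o2⟩ := h.heap.congr (f' := m₃.int) (fun i _ => by rw [poff 7 (by omega)])
      (fun a _ _ => poff a (by omega))
    rw [← pr 2 (by omega)] at o1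
    have hfr : SearchFrame m m₃ := by
      refine ⟨fun a ha => poff a (by omega), fun i h1 h2 => ?_, fun b _ _ hb => pr b hb⟩
      rw [p9, if_neg h1]
    have hleft' := arcsLeft_succ (K := K) (s := e₀ + 1) (f' := m₃.int) (poff 19 (by omega))
      (poff 21 (by omega)) hj hdst hnle hnlt
    have hcnt := h.count
    have e7 := poff 7 (by omega)
    have e11 := poff 11 (by omega)
    have e17 := poff 17 (by omega)
    have e19 := poff 19 (by omega)
    have e20 := poff 20 (by omega)
    have e21 := poff 21 (by omega)
    have e22 := poff 22 (by omega)
    have e25 := poff 25 (by omega)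
    have e26 := poff 26 (by omega)
    have e2 := pr 2 (by omega)
    have e3 := pr 3 (by omega)
    have t1 := h.search.skip h.finished h.max (hproc m₃.int e19 e20 e21 e22) (by
      by_cases h1 : G.weight e ≤ G.weight e₀
      · refine Or.inr ?_
        by_cases h2 : m.int 19 u = e₀ + 1
        · exact Or.inl h2
        · exact Or.inr (ht h1 h2)
      · exact Or.inl (not_le.1 h1))
    refine ⟨⟨m.int 23 (j - 1), ⟨⟨hD.frame hfr, o1, ?_, ?_, ?_, ?_, ?_, ?_⟩, ?_, ?_, ?_, ?_, ?_, ?_,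
      ?_⟩, ?_⟩, hfr, e19⟩
    · rw [p9, if_neg (by omega), hs]
    · rw [e19]
      exact h.stamps
    · rw [e2, e3, e17]
      exact h.key
    · rw [e7]
      omega
    · rw [e7]
      exact h.rank
    · rw [e17, e25, e26, e3]
      rw [e19] at t1 ⊢
      exact t1
    · rw [e19]
      exact h.finished
    · rw [e19, e3]
      exact h.max
    · rw [e11]
      exact h.roots
    · simp [p9]
    · rw [p9, if_neg (by omega), hc]
    · omega
    · rw [e21]
      exact hndst
    · rw [o2]
      omega

end

open SearchProg HeapProg

/-! ### The rounds of a search and its total cost -/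

section

variable {N M : ℕ} {G : Instance N M}

theorem arcsLeft_zero (K s v w : ℕ) (f : ℕ → ℕ → ℕ) : arcsLeft K s v 0 f = arcsLeft K s w 0 f := by
  simp [arcsLeft]

/-- Finishing `v` takes the arcs into `v` out of the first count and puts all of them into the
second, as each has an index below the head of the chain. -/
theorem arcsLeft_finish {K s v j : ℕ} {f f' : ℕ → ℕ → ℕ} (h21 : f' 21 = f 21)
    (h19 : ∀ x, f' 19 x = if x = v then s else f 19 x) (hv : f 19 v ≠ s) (hj : j ≤ K)
    (hlt : ∀ b, b < K → f 21 b = v → b < j) : arcsLeft K s v j f' = arcsLeft K s v 0 f := by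
  have : (Finset.range K).filter (fun a => f 19 (f 21 a) ≠ s) =
      (Finset.range K).filter (fun a => f' 19 (f' 21 a) ≠ s) ∪
        (Finset.range j).filter fun a => f' 21 a = v := by
    ext b
    simp only [Finset.mem_filter, Finset.mem_range, Finset.mem_union, h21, h19]
    constructor
    · rintro ⟨h1, h2⟩
      by_cases hb : f 21 b = v
      · exact Or.inr ⟨hlt b h1 hb, hb⟩
      · exact Or.inl ⟨h1, by rwa [if_neg hb]⟩
    · rintro (⟨h1, h2⟩ | ⟨h1, h2⟩)
      · by_cases hb : f 21 b = v
        · simp [hb] at h2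
        · exact ⟨h1, by rwa [if_neg hb] at h2⟩
      · exact ⟨by omega, by rwa [h2]⟩
  rw [arcsLeft, arcsLeft, this, Finset.card_union_of_disjoint]
  · simp
  · rw [Finset.disjoint_left]
    simp only [Finset.mem_filter, Finset.mem_range, h21, h19]
    rintro b ⟨-, h1⟩ ⟨-, h2⟩
    simp [h2] at h1

theorem nodesLeft_finish {N s v : ℕ} {f f' : ℕ → ℕ → ℕ} (hN : v < N)
    (h19 : ∀ x, f' 19 x = if x = v then s else f 19 x) (hv : f 19 v ≠ s) :
    nodesLeft N s f = nodesLeft N s f' + 1 := by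
  have : (Finset.range N).filter (fun x => f 19 x ≠ s) =
      insert v ((Finset.range N).filter fun x => f' 19 x ≠ s) := by
    ext x
    simp only [Finset.mem_filter, Finset.mem_range, Finset.mem_insert, h19]
    by_cases hx : x = v
    · subst hx
      simp [hN, hv]
    · simp [hx]
  rw [nodesLeft, nodesLeft, this, Finset.card_insert_of_notMem]
  simp [h19]

/-- With no arc pending, the name of the current node is irrelevant. Between rounds the dummy `0` is
used. -/
theorem SearchState.of_zero {K : ℕ} {e₀ : Fin M} {v w : ℕ} {m : Memory}
    (h : SearchState G K e₀ v 0 m) : SearchState G K e₀ w 0 m :=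
  { h with
    count := arcsLeft_zero K (e₀ + 1) v w m.int ▸ h.count
    search := by simpa using h.search }

theorem HeapFrame.searchFrame {m m' : Memory} (h : HeapFrame m m') : SearchFrame m m' :=
  ⟨fun a _ => h.int a (by omega) (by omega) (by omega),
    fun i _ _ => by rw [h.int 9 (by omega) (by omega) (by omega)], fun b _ _ _ => by rw [h.real]⟩

/-- The state of the search only depends on the heap and the arrays of the search. -/
theorem SearchState.of_eq {K : ℕ} {e₀ : Fin M} {v j : ℕ} {m m' : Memory}
    (h : SearchState G K e₀ v j m) (hh : HeapInv N (K + 3) m'.int (m'.real 2))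
    (hi : ∀ a, a = 0 ∨ a = 9 ∨ 17 ≤ a → m'.int a = m.int a) (hr : m'.real = m.real)
    (h7 : m'.int 7 1 = m.int 7 1) (hrank : Nat.fib (m'.int 7 2 + 1) ≤ K + 2) :
    SearchState G K e₀ v j m' := by
  have e19 := hi 19 (by omega)
  have e21 := hi 21 (by omega)
  refine ⟨h.data.congr (hi 0 (by omega)) (hi 18 (by omega)) (fun a _ _ => hi a (by omega))
    fun b _ => by rw [hr], hh, ?_, ?_, ?_, ?_, hrank, ?_⟩
  · rw [hi 9 (by omega)]
    exact h.stamp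
  · rw [e19]
    exact h.stamps
  · rw [hi 17 (by omega), hr]
    exact h.key
  · have := h.count
    simp only [arcsLeft] at this ⊢
    rwa [e19, e21, h7]
  · rw [hi 17 (by omega), hi 20 (by omega), hi 22 (by omega), hi 25 (by omega), hi 26 (by omega),
      e19, e21, hr]
    exact h.search

variable {K L : ℕ} {e₀ : Fin M} {m : Memory}

/-- The term `83 L` is `21 · 3 L` for the rise of the potential plus `20 L` for the steps of
`takeMin`; the arcs are paid by `arcsLeft`. -/
theorem ends_finish (hL : ∀ r, Nat.fib (r + 1) ≤ K + 2 → r ≤ L) (h : SearchState G K e₀ 0 0 m)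
    (ht : m.int 7 0 = 0) (hb0 : m.int 8 2 ≠ 0) (hx0 : m.int 11 (m.int 8 2 - 1) ≠ 0)
    (hmin : ∀ i, m.int 11 i ≠ 0 →
      m.real 2 (m.int 11 (m.int 8 2 - 1)) ≤ m.real 2 (m.int 11 i)) :
    Ends finish m fun k m' => SearchState G K e₀ 0 0 m' ∧ (∀ i, m'.int 11 i = 0) ∧
      SearchFrame m m' ∧
      k + 21 * heapPot (K + 3) m'.int + 200 * arcsLeft K (e₀ + 1) 0 0 m'.int ≤
        21 * heapPot (K + 3) m.int + 200 * arcsLeft K (e₀ + 1) 0 0 m.int + 83 * L + 120 ∧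
      nodesLeft N (e₀ + 1) m.int = nodesLeft N (e₀ + 1) m'.int + 1 := by
  have hD := h.data
  obtain ⟨-, hxf, -, -⟩ := h.heap.root _ hx0
  set x := m.int 11 (m.int 8 2 - 1) with hx
  obtain ⟨v, hv⟩ : ∃ v : Fin N, m.int 15 x = v :=
    ⟨⟨_, (h.heap.node (m.int 15 x) (by rwa [hxf])).1⟩, rfl⟩
  rw [hv] at hxf
  have hqv : m.int 17 v ≠ 0 := by rwa [hxf]
  have hndone : m.int 19 v ≠ e₀ + 1 := fun hd => h.search.disjoint v hd hqv
  -- Every queued node lies below some root with no larger key, so the minimum over the roots is the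
  -- minimum over the queue.
  have hmindist : ∀ u : Fin N, m.int 17 u ≠ 0 → m.real 3 v ≤ m.real 3 u := by
    intro u hu
    obtain ⟨i, hi, hi'⟩ := h.heap.exists_root ht hu (h.heap.node u hu).2.2
    rw [← h.key v hqv, ← h.key u hu, hxf]
    exact (hmin i hi).trans hi'
  rw [finish, Prog.block, Prog.block, Prog.block, Prog.block, Prog.block, Prog.block]
  refine ends_seq ((ends_takeMin h.heap hD.base rfl hb0 hx.symm hx0 hv (hL _ h.rank)).mono ?_)
  rintro k₁ m₁ ⟨q1, q2, q3, q4, q5, q6, q7, q8, q9, q10⟩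
  refine ends_seq (ends_setNat (ends_seq (ends_setNat (ends_seq (ends_setNat (ends_seq ?_))))))
  generalize hm₂ : Memory.setNat (Memory.setNat (Memory.setNat _ _ _ _) _ _ _) _ _ _ = m₂
  have e9 := q4 9 (by omega)
  have f9 : ∀ i, m₂.int 9 i =
      if i = 1 then m.int 24 v else if i = 2 then (v : ℕ) else m.int 9 i := by
    intro i
    simp [← hm₂, cur, stamp, upd, q10, q4]
  have f19 : ∀ i, m₂.int 19 i = if i = v then (e₀ : ℕ) + 1 else m.int 19 i := by
    intro i
    simp [← hm₂, cur, stamp, upd, q10, q4, h.stamp]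
  have foff : ∀ a, a ≠ 9 → a ≠ 19 → m₂.int a = m₁.int a := by
    intro a h1 h2
    funext i
    simp [← hm₂, upd, h1, h2]
  have fr : m₂.real = m₁.real := by simp [← hm₂]
  clear hm₂
  obtain ⟨o1, o2⟩ := q1.congr (f' := m₂.int) (fun i _ => by rw [foff 7 (by omega) (by omega)])
    (fun a _ _ => foff a (by omega) (by omega))
  rw [← fr] at o1
  have e20 : m₂.int 20 = m.int 20 := by rw [foff 20 (by omega) (by omega), q4 20 (by omega)]
  have e21 : m₂.int 21 = m.int 21 := by rw [foff 21 (by omega) (by omega), q4 21 (by omega)]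
  have e22 : m₂.int 22 = m.int 22 := by rw [foff 22 (by omega) (by omega), q4 22 (by omega)]
  have e25 : m₂.int 25 = m.int 25 := by rw [foff 25 (by omega) (by omega), q4 25 (by omega)]
  have e26 : m₂.int 26 = m.int 26 := by rw [foff 26 (by omega) (by omega), q4 26 (by omega)]
  have e17 : ∀ u, m₂.int 17 u = if u = v then 0 else m.int 17 u := by
    rw [foff 17 (by omega) (by omega)]
    exact q6
  have er : m₂.real = m.real := fr.trans q5
  have hfr : SearchFrame m m₂ := by
    refine ⟨fun a ha => ?_, fun i h1 h2 => ?_, fun b _ _ _ => by rw [er]⟩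
    · rw [foff a (by omega) (by omega), q4 a (by omega)]
    · rw [f9, if_neg h1, if_neg h2]
  have hleft := arcsLeft_finish (j := m.int 24 v) (K := K) e21 f19 hndone (hD.first_le v v.2)
    fun b hb hbv => hbv ▸ hD.first_lt b hb
  obtain ⟨t1, t2⟩ := h.search.pop hqv hmindist
    (proc' := fun e u w => ∃ a, a < K ∧ m₂.int 20 a = u ∧ m₂.int 21 a = w ∧
      m₂.int 22 a = e ∧ m₂.int 19 w = e₀ + 1 ∧ ¬ ((w : ℕ) = v ∧ a < m.int 24 v))
    (done' := fun u => m₂.int 19 u = e₀ + 1) (queued' := fun u => m₂.int 17 u ≠ 0) (by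
      rintro e u w ⟨a, h1, h2, h3, h4, h5, h6⟩
      rw [e20] at h2
      rw [e21] at h3
      rw [e22] at h4
      -- All arcs into `v` are still pending, so finishing `v` creates no examined passage.
      by_cases hw : (w : ℕ) = v
      · exact absurd ⟨hw, by have := hD.first_lt a h1; rwa [h3, hw] at this⟩ h6
      · rw [f19, if_neg hw] at h5
        exact ⟨a, h1, h2, h3, h4, h5, by omega⟩) (by
      intro u
      rw [f19]
      by_cases hu : u = v
      · simp [hu]
      · have : (u : ℕ) ≠ v := fun he => hu (Fin.ext he)
        simp [hu, this]) (by
      intro u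
      rw [e17]
      by_cases hu : u = v
      · simp [hu]
      · have : (u : ℕ) ≠ v := fun he => hu (Fin.ext he)
        simp [hu, this])
  have hinit : ExamineState G K e₀ v (m.int 24 v) m₂ := by
    refine ⟨⟨hD.frame hfr, o1, ?_, ?_, ?_, ?_, ?_, ?_⟩, ?_, ?_, ?_, ?_, ?_, ?_, ?_⟩
    · rw [f9, if_neg (by omega), if_neg (by omega), h.stamp]
    · intro u
      rw [f19]
      split_ifs
      · exact le_rfl
      · exact h.stamps u
    · intro u hu
      rw [e17] at hu ⊢
      by_cases huv : u = v
      · simp [huv] at hu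
      · rw [if_neg huv] at hu ⊢
        rw [er, h.key u hu]
    · rw [foff 7 (by omega) (by omega), q8, hleft, arcsLeft_zero _ _ _ 0]
      exact h.count
    · rw [foff 7 (by omega) (by omega), q9]
      exact h.rank
    · rw [er, e25, e26]
      exact t1
    · simp [f19]
    · rw [er]
      exact t2
    · rw [foff 11 (by omega) (by omega)]
      exact q7
    · simp [f9]
    · simp [f9]
    · exact hD.first_le v v.2
    · rw [e21]
      exact hD.first_dst v v.2
  have key := ends_loop (c := .natLt 0 (.cell 9 1)) (p := examine)
    (fun m' => (∃ j, ExamineState G K e₀ v j m') ∧ SearchFrame m₂ m' ∧ m'.int 19 = m₂.int 19)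
    (fun m' => 21 * heapPot (K + 3) m'.int + 200 * arcsLeft K (e₀ + 1) v (m'.int 9 1) m'.int)
    (m := m₂) (by
      rintro m₃ ⟨⟨j, g1⟩, g2, g3⟩ hc
      have hc' : 0 < m₃.int 9 1 := hc
      have hj : j ≠ 0 := by
        have := g1.arc_eq
        omega
      refine (ends_examine g1 hj).mono ?_
      rintro k m₄ ⟨⟨j', i1, i2⟩, i3, i4⟩
      refine ⟨⟨⟨j', i1⟩, g2.trans i3, i4.trans g3⟩, ?_⟩
      rw [i1.arc_eq, g1.arc_eq]
      omega) ⟨⟨_, hinit⟩, .refl m₂, rfl⟩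
  refine key.mono ?_
  rintro k m₃ ⟨⟨⟨j, g1⟩, g2, g3⟩, hc, hk⟩
  have hj : j = 0 := by
    have hc' : ¬ 0 < m₃.int 9 1 := hc
    have := g1.arc_eq
    omega
  subst hj
  refine ends_skip ⟨g1.toSearchState.of_zero, g1.roots, hfr.trans g2, ?_, ?_⟩
  · have z₁ := arcsLeft_zero K (e₀ + 1) v 0 m.int
    have z₃ := arcsLeft_zero K (e₀ + 1) v 0 m₃.int
    rw [hinit.arc_eq, g1.arc_eq, hleft, o2] at hk
    omega
  · refine nodesLeft_finish v.2 (fun y => ?_) hndone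
    rw [g3, f19]

/-- The time that the search has left. -/
def searchTime (N K L s : ℕ) (m : Memory) : ℕ :=
  21 * heapPot (K + 3) m.int + 200 * arcsLeft K s 0 0 m.int + 300 * ((L + 1) * nodesLeft N s m.int)
    + if m.int 7 0 = 0 then 0 else 30 * (L + 1)

/-- A round that finishes a node is paid by the decrease of `nodesLeft`. A round may also find only
hollow nodes, and this happens with an empty stack as result; the extra term of `searchTime` for a
nonempty stack pays for it. -/
theorem ends_round (hL : ∀ r, Nat.fib (r + 1) ≤ K + 2 → r ≤ L) (h : SearchState G K e₀ 0 0 m)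
    (ht : 0 < m.int 7 0) :
    Ends round m fun k m' => (SearchState G K e₀ 0 0 m' ∧ (∀ i, m'.int 11 i = 0) ∧
      SearchFrame m m') ∧ k + 1 + searchTime N K L (e₀ + 1) m' ≤ searchTime N K L (e₀ + 1) m := by
  have hD := h.data
  rw [SearchProg.round, Prog.block, Prog.block, Prog.block, Prog.block]
  refine ends_seq ((ends_drain h.heap hD.base).mono ?_)
  rintro k₁ m₁ ⟨g1, g2, g3, g4, g5⟩
  have hs₁ : SearchState G K e₀ 0 0 m₁ := by
    refine h.of_eq g1 (fun a ha => g2.int a (by omega) (by omega) (by omega)) g2.real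
      (g2.count 1 (by omega) (by omega)) (g5 _ h.rank ?_)
    have := h.count
    omega
  refine ends_seq ((ends_scan g1).mono ?_)
  rintro k₂ m₂ ⟨i1, i2, i3, i4, i5⟩
  obtain ⟨o1, o2⟩ := g1.of_eq_off i1 i2
  have hs₂ : SearchState G K e₀ 0 0 m₂ :=
    hs₁.of_eq o1 (fun a ha => i1 a (by omega)) i2 (by rw [i1 7 (by omega)])
      (by rw [i1 7 (by omega)]; exact hs₁.rank)
  have hf₂ : SearchFrame m m₂ := g2.searchFrame.trans ⟨fun a ha => i1 a (by omega),
    fun i _ _ => by rw [i1 9 (by omega)], fun b _ _ _ => by rw [i2]⟩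
  have hrk := hL _ hs₁.rank
  have e7 := i1 7 (by omega)
  have e11 := i1 11 (by omega)
  have e19 : m₂.int 19 = m.int 19 := by
    rw [i1 19 (by omega), g2.int 19 (by omega) (by omega) (by omega)]
  have e21 : m₂.int 21 = m.int 21 := by
    rw [i1 21 (by omega), g2.int 21 (by omega) (by omega) (by omega)]
  have hal : arcsLeft K (e₀ + 1) 0 0 m₂.int = arcsLeft K (e₀ + 1) 0 0 m.int := by
    simp only [arcsLeft, e19, e21]
  have hnl : nodesLeft N (e₀ + 1) m₂.int = nodesLeft N (e₀ + 1) m.int := by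
    simp only [nodesLeft, e19]
  refine ends_seq (ends_cond (fun hc => ends_skip (ends_skip ?_)) fun hc => ?_)
  · replace hc : m₂.int 8 2 = 0 := hc
    refine ⟨⟨hs₂, ?_, hf₂⟩, ?_⟩
    · rw [e11]
      exact i4 hc
    · rw [searchTime, searchTime, hal, hnl, e7, g3, o2, if_pos rfl, if_neg (by omega)]
      omega
  · replace hc : m₂.int 8 2 ≠ 0 := hc
    obtain ⟨j1, j2⟩ := i5 hc
    refine (ends_finish hL hs₂ (by rw [e7, g3]) hc (by rwa [e11])
      (by rw [e11, i2]; exact j2)).mono ?_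
    rintro k₃ m₃ ⟨n1, n2, n3, n4, n5⟩
    refine ends_skip ⟨⟨n1, n2, hf₂.trans n3⟩, ?_⟩
    rw [searchTime, searchTime, ← hnl, ← hal, n5, if_neg ht.ne',
      Nat.mul_add_one (L + 1)]
    split_ifs <;> omega

/-- The result of the search for the edge `e₀`: the array `19` marks the nodes from which the
target node can be reached along edges of weight at most that of `e₀`, and the real array `3`
holds their distances, which are attained by following the arrays `25` and `26`. -/
structure SearchDone (G : Instance N M) (e₀ : Fin M) (m : Memory) : Prop where
  le : ∀ (u : Fin N) vs es, G.Trace u G.target vs es →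
    (∀ e ∈ es, G.weight e ≤ G.weight e₀) →
      m.int 19 u = e₀ + 1 ∧ m.real 3 u ≤ (es.map G.nominal).sum
  path : ∀ u : Fin N, m.int 19 u = e₀ + 1 → ∃ vs es, vs.Nodup ∧
    Pointer G (m.int 25) (m.int 26) u vs es ∧ (∀ e ∈ es, G.weight e ≤ G.weight e₀) ∧
      m.real 3 u = (es.map G.nominal).sum

/-- Stamps of earlier searches are at most `e₀`, so with the new stamp `e₀ + 1` every node counts as
unfinished without any clearing. -/
theorem ends_start (hD : GraphData G K m.int m.real) (hH : HeapEmpty m.int)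
    (hs : m.int 9 0 = e₀ + 1) (hst : ∀ u, m.int 19 u ≤ e₀) :
    Ends start m fun k m' => SearchState G K e₀ 0 0 m' ∧ (∀ i, m'.int 11 i = 0) ∧
      SearchFrame m m' ∧ k + heapPot (K + 3) m'.int ≤ 40 := by
  rw [SearchProg.start, Prog.block, Prog.block, Prog.block, Prog.block, Prog.block, Prog.block,
    Prog.block]
  refine ends_seq (ends_setNat (ends_seq (ends_setNat (ends_seq (ends_setNat (ends_seq
    (ends_setReal (ends_seq (ends_setReal (ends_seq ?_))))))))))
  generalize hm₁ : Memory.setReal (Memory.setReal (Memory.setNat (Memory.setNat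
    (Memory.setNat _ _ _ _) _ _ _) _ _ _) _ _ _) _ _ _ = m₁
  have e7 : ∀ i, m₁.int 7 i = if i = 1 then 0 else if i = 2 then 0 else m.int 7 i := by
    intro i
    simp [← hm₁, upd]
    grind
  have e8 : m₁.int 8 4 = G.target := by
    simp [← hm₁, upd, hD.target]
  have eoff : ∀ a, a ≠ 7 → a ≠ 8 → m₁.int a = m.int a := by
    intro a h1 h2
    funext i
    simp [← hm₁, upd, h1, h2]
  have r4 : m₁.real 4 0 = 0 := by
    simp [← hm₁, upd]
  have r3 : m₁.real 3 G.target = 0 := by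
    simp [← hm₁, upd, hD.target]
  have roff : ∀ b, b ≠ 3 → b ≠ 4 → m₁.real b = m.real b := by
    intro b h1 h2
    funext i
    simp [← hm₁, upd, h1, h2]
  clear hm₁
  have hH₁ : HeapEmpty m₁.int := by
    refine ⟨by simp [e7, hH.top], ?_, fun a i h1 h2 => ?_, ?_⟩
    · rw [eoff 16 (by omega) (by omega)]
      exact hH.rank
    · rw [eoff a (by omega) (by omega)]
      exact hH.zero a i h1 h2
    · rw [eoff 17 (by omega) (by omega)]
      exact hH.node
  have h71 : m₁.int 7 1 = 0 := by simp [e7]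
  have h72 : m₁.int 7 2 = 0 := by simp [e7]
  refine (ends_create (N := N) (W := K + 3) (hH₁.inv (by omega) h71 _) ?_ e8 G.target.2
    (by rw [h71]; omega) (fun i => hH₁.zero 11 i (by omega) (by omega))
    (fun hn => absurd (hH₁.node _) hn)).mono ?_
  · rw [eoff 18 (by omega) (by omega)]
    exact hD.base
  rintro k m₂ ⟨⟨q1, q2⟩, q3, q4, q5, q6, q7, q8, q9, q10, q11, q12⟩
  have hfr : SearchFrame m m₂ := by
    refine ⟨fun a ha => ?_, fun i _ _ => ?_, fun b h1 h2 h3 => ?_⟩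
    · rw [q4 a (by omega), eoff a (by omega) (by omega)]
    · rw [q4 9 (by omega), eoff 9 (by omega) (by omega)]
    · rw [q5 b h1, roff b h2 h3]
  have e19 : m₂.int 19 = m.int 19 := by rw [q4 19 (by omega), eoff 19 (by omega) (by omega)]
  have e17 : ∀ w, m₂.int 17 w = if w = G.target then 1 else 0 := by
    intro w
    rw [q6, h71, hH₁.node]
  have hnd : ∀ u, m₂.int 19 u ≠ e₀ + 1 := fun u => by
    have := hst u
    rw [e19]
    omega
  refine ends_skip ⟨⟨hD.frame hfr, q1, ?_, ?_, ?_, ?_, ?_, ?_⟩, ?_, hfr, ?_⟩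
  · rw [hfr.register 0 (by omega) (by omega), hs]
  · intro u
    rw [e19]
    exact (hst u).trans (by omega)
  · intro u hu
    rw [e17] at hu ⊢
    split_ifs at hu ⊢ with hut
    · rw [q7, h71, if_pos rfl, q5 3 (by omega), hut, r3, r4]
    · exact absurd rfl hu
  · rw [q10, h71]
    have := Finset.card_filter_le (Finset.range K) fun a => m₂.int 19 (m₂.int 21 a) ≠ e₀ + 1
    simp only [arcsLeft, Finset.card_range, Finset.range_zero, Finset.filter_empty,
      Finset.card_empty] at this ⊢
    omega
  · rw [q11, h72]
    simp
  · refine Search.init ?_ (fun v => hnd v) (fun v => ?_) ?_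
    · rintro e u w ⟨a, -, -, -, -, h5, -⟩
      exact hnd w h5
    · rw [e17]
      simp [Fin.ext_iff]
    · rw [q5 3 (by omega), r3]
  · rw [q8]
    exact fun i => hH₁.zero 11 i (by omega) (by omega)
  · rw [hH₁.pot] at q2
    omega

/-- Once the queue is exhausted, all heap arrays of the structure are zero again, as required by the
next search. -/
theorem ends_search (hL : ∀ r, Nat.fib (r + 1) ≤ K + 2 → r ≤ L)
    (hD : GraphData G K m.int m.real) (hH : HeapEmpty m.int)
    (hs : m.int 9 0 = e₀ + 1) (hst : ∀ u, m.int 19 u ≤ e₀) :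
    Ends search m fun k m' => SearchDone G e₀ m' ∧ GraphData G K m'.int m'.real ∧
      HeapEmpty m'.int ∧ (∀ u, m'.int 19 u ≤ e₀ + 1) ∧ SearchFrame m m' ∧
      k ≤ 200 * K + 330 * ((L + 1) * (N + 1)) + 900 := by
  refine ends_seq ((ends_start hD hH hs hst).mono ?_)
  rintro k₀ m₀ ⟨h1, h2, h3, h4⟩
  have key := ends_loop (c := .natLt 0 top) (p := SearchProg.round)
    (fun m' => SearchState G K e₀ 0 0 m' ∧ (∀ i, m'.int 11 i = 0) ∧ SearchFrame m₀ m')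
    (searchTime N K L (e₀ + 1)) (m := m₀) (by
      rintro m₁ ⟨g1, g2, g3⟩ hc
      refine (ends_round hL g1 hc).mono ?_
      rintro k m₂ ⟨⟨i1, i2, i3⟩, i4⟩
      exact ⟨⟨i1, i2, g3.trans i3⟩, i4⟩) ⟨h1, h2, .refl m₀⟩
  refine key.mono ?_
  rintro k m' ⟨⟨g1, g2, g3⟩, hc, hk⟩
  have ht : m'.int 7 0 = 0 := Nat.eq_zero_of_not_pos hc
  obtain ⟨j1, j2⟩ := g1.heap.eq_zero_of_no_root ht g2
  have hq : ∀ v : Fin N, ¬ m'.int 17 v ≠ 0 := fun v => by simp [j2]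
  refine ⟨⟨fun u vs es htr hw => g1.search.dist_le hq ?_ htr hw, fun u hu => ?_⟩, g1.data,
    ⟨ht, g1.heap.rank_zero, j1, j2⟩, g1.stamps, h3.trans g3, ?_⟩
  · intro e u w hj hd
    obtain ⟨a, a1, a2, a3, a4⟩ := g1.data.joins e u w hj
    exact ⟨a, a1, a2, a3, a4, hd, by omega⟩
  · obtain ⟨vs, es, n1, -, n2⟩ := g1.search.path u (Or.inl hu)
    exact ⟨vs, es, n1, n2⟩
  -- At first at most `K` arcs and `N` nodes are left. The start contributes at most `21 · 40` to
  -- the constant.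
  · have b1 := Finset.card_filter_le (Finset.range K) fun a => m₀.int 19 (m₀.int 21 a) ≠ e₀ + 1
    have b2 := Finset.card_filter_le (Finset.range N) fun a => m₀.int 19 a ≠ e₀ + 1
    rw [Finset.card_range] at b1 b2
    have b3 := Nat.mul_le_mul_left (L + 1) b2
    simp only [searchTime, arcsLeft, nodesLeft, Finset.range_zero, Finset.filter_empty,
      Finset.card_empty] at hk
    rw [Nat.mul_add_one (L + 1)]
    split_ifs at hk <;> omega

end

/-! ## Counting loops -/

/-- Run `p` for the values `0, 1, …` below `x` of the register `r`. -/
def Prog.count (r : ℕ) (x : NatExp) (p : Prog) : Prog :=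
  .seq (.setNat 9 (.lit r) 0)
    (.loop (.natLt (.cell 9 (.lit r)) x) (.seq p (.setNat 9 (.lit r) (.cell 9 (.lit r) + 1))))

/-- Each iteration costs two steps beyond the body, for the test and the increment. The invariant
takes the index as an argument, since the register is rewritten only after the body. -/
theorem ends_count {r n c : ℕ} {x : NatExp} {p : Prog} {m : Memory} (I : ℕ → Memory → Prop)
    (hx : ∀ i m, I i m → m.int 9 r = i ∧ x.eval m = n) (h0 : I 0 (m.setNat 9 r 0))
    (h : ∀ i m, i < n → I i m → Ends p m fun k m' => k ≤ c ∧ m'.int 9 r = i ∧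
      I (i + 1) (m'.setNat 9 r (i + 1))) :
    Ends (.count r x p) m fun k m' => I n m' ∧ k ≤ n * (c + 2) + 2 := by
  refine ends_seq (ends_setNat ?_)
  refine (ends_loop (fun m' => ∃ i, i ≤ n ∧ I i m') (fun m' => (n - m'.int 9 r) * (c + 2)) ?_
    ⟨0, Nat.zero_le _, h0⟩).mono ?_
  · rintro m₁ ⟨i, hi, hI⟩ hc
    obtain ⟨h1, h2⟩ := hx i m₁ hI
    simp only [Test.Holds, NatExp.eval, h1, h2] at hc
    refine ends_seq ((h i m₁ hc hI).mono ?_)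
    rintro k m₂ ⟨h3, h4, h5⟩
    refine ends_setNat ?_
    have e : Memory.setNat m₂ 9 (NatExp.eval m₂ (.lit r))
        (NatExp.eval m₂ (.cell 9 (.lit r) + 1)) = m₂.setNat 9 r (i + 1) := by
      simp [h4]
    rw [e]
    refine ⟨⟨i + 1, hc, h5⟩, ?_⟩
    have : (m₂.setNat 9 r (i + 1)).int 9 r = i + 1 := by simp [upd]
    obtain ⟨d, hd⟩ : ∃ d, n - i = d + 1 := ⟨n - i - 1, by omega⟩
    rw [this, h1, hd, show n - (i + 1) = d by omega, Nat.add_one_mul]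
    omega
  · rintro k m' ⟨⟨i, hi, hI⟩, hc, hk⟩
    obtain ⟨h1, h2⟩ := hx i m' hI
    simp only [Test.Holds, NatExp.eval, h1, h2] at hc
    obtain rfl : i = n := by omega
    refine ⟨hI, ?_⟩
    have : (m.setNat 9 r 0).int 9 r = 0 := by simp [upd]
    have e : Memory.setNat m 9 (NatExp.eval m (.lit r)) (NatExp.eval m 0) = m.setNat 9 r 0 := by
      simp
    change k + _ ≤ (i - (Memory.setNat m 9 (NatExp.eval m (.lit r)) (NatExp.eval m 0)).int 9 r) *
      (c + 2) + 1 at hk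
    rw [e, this, Nat.sub_zero] at hk
    omega

/-! ## The preparation of the arrays -/

namespace SetupProg

/-- The starts of the blocks of children. -/
def blocks : Prog := .count 3 (.cell 0 0) (.block [
  .setNat 18 (.cell 9 3) (.cell 9 4),
  .setNat 9 4 (.cell 9 4 + (.cell 9 8 + 3))])

/-- The list of the arcs: every edge, and every edge in reverse. -/
def arcs : Prog := .count 3 (.cell 0 1) (.block [
  .setNat 20 (.cell 9 3) (.cell 1 (.cell 9 3)),
  .setNat 21 (.cell 9 3) (.cell 2 (.cell 9 3)),
  .setNat 22 (.cell 9 3) (.cell 9 3),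
  .setNat 20 (.cell 0 1 + .cell 9 3) (.cell 2 (.cell 9 3)),
  .setNat 21 (.cell 0 1 + .cell 9 3) (.cell 1 (.cell 9 3)),
  .setNat 22 (.cell 0 1 + .cell 9 3) (.cell 9 3)])

/-- The chains of the arcs with the same second node. -/
def chains : Prog := .count 3 (.cell 9 8) (.block [
  .setNat 23 (.cell 9 3) (.cell 24 (.cell 21 (.cell 9 3))),
  .setNat 24 (.cell 21 (.cell 9 3)) (.cell 9 3 + 1)])

/-- The number of the arcs. -/
def number : Prog :=
  .cond (.natEq (.cell 0 4) 0) (.setNat 9 8 (.cell 0 1 + .cell 0 1)) (.setNat 9 8 (.cell 0 1))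

/-- The preparation of the arrays of the search. -/
def setup : Prog := .seq number (.seq blocks (.seq arcs chains))

end SetupProg

open SetupProg

/-! ### Correctness of the preparation -/

section

variable {m : Memory}

/-- Integer expressions have no product, so the multiples of `K + 3` are tabulated by repeated
addition. -/
theorem ends_blocks {N K : ℕ} (hN : m.int 0 0 = N) (hK : m.int 9 8 = K) (h4 : m.int 9 4 = 0) :
    Ends blocks m fun k m' => (∀ a, a ≠ 9 → a ≠ 18 → m'.int a = m.int a) ∧
      (∀ i, i ≠ 3 → i ≠ 4 → m'.int 9 i = m.int 9 i) ∧ m'.real = m.real ∧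
      (∀ v, v < N → m'.int 18 v = v * (K + 3)) ∧ k ≤ 6 * N + 2 := by
  refine (ends_count (n := N) (c := 3) (fun n m' => m'.int 9 3 = n ∧
    (∀ a, a ≠ 9 → a ≠ 18 → m'.int a = m.int a) ∧
    (∀ i, i ≠ 3 → i ≠ 4 → m'.int 9 i = m.int 9 i) ∧ m'.real = m.real ∧
    m'.int 9 4 = n * (K + 3) ∧ ∀ v, v < n → m'.int 18 v = v * (K + 3)) ?_ ?_ ?_).mono ?_
  · rintro i m' ⟨h1, h2, -⟩
    exact ⟨h1, by simp [h2, hN]⟩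
  · refine ⟨by simp [upd], fun a h1 h2 => ?_, fun i h1 h2 => ?_, rfl, ?_, ?_⟩
    · funext i
      simp [upd, h1]
    · simp [upd, h1]
    · simp [upd, h4]
    · simp
  · rintro i m₁ hi ⟨h1, h2, h3, h4, h5, h6⟩
    simp only [Prog.block, ends_seq_iff, ends_setNat_iff, ends_skip_iff]
    refine ⟨by norm_num, by simp [upd, h1], by simp [upd], fun a ha ha' => ?_, fun j hj hj' => ?_,
      h4, ?_, fun v hv => ?_⟩
    · funext j
      simp [upd, ha, ha', h2]
    · simp [upd, hj, hj', h3]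
    · simp [upd, h5, h3, hK]
      ring
    · rcases (Nat.lt_succ_iff.1 hv).lt_or_eq with hlt | rfl
      · simp [upd, h1, h5, hlt.ne, h6 v hlt]
      · simp [upd, h1, h5]
  · rintro k m' ⟨⟨h1, h2, h3, h4, h5, h6⟩, hk⟩
    exact ⟨h2, h3, h4, h6, by omega⟩

/-- The reversed arcs are written for directed graphs too; they stand from index `M` on, where they
are ignored because then `K = M`. -/
theorem ends_arcs {M : ℕ} (hM : m.int 0 1 = M) :
    Ends arcs m fun k m' => (∀ a, a ≠ 9 → a ≠ 20 → a ≠ 21 → a ≠ 22 → m'.int a = m.int a) ∧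
      (∀ i, i ≠ 3 → m'.int 9 i = m.int 9 i) ∧ m'.real = m.real ∧
      (∀ e, e < M → m'.int 20 e = m.int 1 e ∧ m'.int 21 e = m.int 2 e ∧ m'.int 22 e = e ∧
        m'.int 20 (M + e) = m.int 2 e ∧ m'.int 21 (M + e) = m.int 1 e ∧ m'.int 22 (M + e) = e) ∧
      k ≤ 9 * M + 2 := by
  refine (ends_count (n := M) (c := 7) (fun n m' => m'.int 9 3 = n ∧
    (∀ a, a ≠ 9 → a ≠ 20 → a ≠ 21 → a ≠ 22 → m'.int a = m.int a) ∧
    (∀ i, i ≠ 3 → m'.int 9 i = m.int 9 i) ∧ m'.real = m.real ∧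
    ∀ e, e < n → m'.int 20 e = m.int 1 e ∧ m'.int 21 e = m.int 2 e ∧ m'.int 22 e = e ∧
      m'.int 20 (M + e) = m.int 2 e ∧ m'.int 21 (M + e) = m.int 1 e ∧ m'.int 22 (M + e) = e)
    ?_ ?_ ?_).mono ?_
  · rintro i m' ⟨h1, h2, -⟩
    exact ⟨h1, by simp [h2, hM]⟩
  · refine ⟨by simp [upd], fun a h1 h2 h3 h4 => ?_, fun i h1 => ?_, rfl, by simp⟩
    · funext i
      simp [upd, h1]
    · simp [upd, h1]
  · rintro i m₁ hi ⟨h1, h2, h3, h4, h5⟩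
    have e1 := h2 1 (by omega) (by omega) (by omega) (by omega)
    have e2 := h2 2 (by omega) (by omega) (by omega) (by omega)
    have e0 := h2 0 (by omega) (by omega) (by omega) (by omega)
    simp only [Prog.block, ends_seq_iff, ends_setNat_iff, ends_skip_iff]
    refine ⟨by norm_num, by simp [upd, h1], by simp [upd], fun a ha h20 h21 h22 => ?_,
      fun j hj => ?_, h4, fun e he => ?_⟩
    · funext j
      simp [upd, ha, h20, h21, h22, h2]
    · simp [upd, hj, h3]
    · have he0 : e ≠ M + i := by omega
      have hne : i ≠ M + i := by omega
      have hme : M + e ≠ i := by omega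
      rcases (Nat.lt_succ_iff.1 he).lt_or_eq with hlt | rfl
      · obtain ⟨f1, f2, f3, f4, f5, f6⟩ := h5 e hlt
        simp [upd, h1, e0, e1, e2, hM, he0, hlt.ne, hme, f1, f2, f3, f4, f5, f6]
      · simp [upd, h1, e0, e1, e2, hM, hne, show M ≠ 0 by omega]
  · rintro k m' ⟨⟨h1, h2, h3, h4, h5⟩, hk⟩
    exact ⟨h2, h3, h4, h5, by omega⟩

/-- Each arc is put at the head of the list of its second node, pointing to the previous head. Since
arcs come by increasing index, everything it points to has a smaller index. -/
theorem ends_chains {K : ℕ} (hK : m.int 9 8 = K) (h24 : ∀ v, m.int 24 v = 0) :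
    Ends chains m fun k m' => (∀ a, a ≠ 9 → a ≠ 23 → a ≠ 24 → m'.int a = m.int a) ∧
      (∀ i, i ≠ 3 → m'.int 9 i = m.int 9 i) ∧ m'.real = m.real ∧
      (∀ a, a < K → m'.int 23 a ≤ a ∧
        (m'.int 23 a ≠ 0 → m.int 21 (m'.int 23 a - 1) = m.int 21 a) ∧
        ∀ b, b < a → m.int 21 b = m.int 21 a → b < m'.int 23 a) ∧
      (∀ v, m'.int 24 v ≤ K ∧ (m'.int 24 v ≠ 0 → m.int 21 (m'.int 24 v - 1) = v)) ∧
      (∀ b, b < K → b < m'.int 24 (m.int 21 b)) ∧ k ≤ 5 * K + 2 := by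
  refine (ends_count (n := K) (c := 3) (fun n m' => m'.int 9 3 = n ∧
    (∀ a, a ≠ 9 → a ≠ 23 → a ≠ 24 → m'.int a = m.int a) ∧
    (∀ i, i ≠ 3 → m'.int 9 i = m.int 9 i) ∧ m'.real = m.real ∧
    (∀ a, a < n → m'.int 23 a ≤ a ∧
      (m'.int 23 a ≠ 0 → m.int 21 (m'.int 23 a - 1) = m.int 21 a) ∧
      ∀ b, b < a → m.int 21 b = m.int 21 a → b < m'.int 23 a) ∧
    (∀ v, m'.int 24 v ≤ n ∧ (m'.int 24 v ≠ 0 → m.int 21 (m'.int 24 v - 1) = v)) ∧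
    (∀ b, b < n → b < m'.int 24 (m.int 21 b))) ?_ ?_ ?_).mono ?_
  · rintro i m' ⟨h1, h2, h3, -⟩
    exact ⟨h1, by simp [h3, hK]⟩
  · refine ⟨by simp [upd], fun a h1 h2 h3 => ?_, fun i h1 => ?_, rfl, by simp, ?_, by simp⟩
    · funext i
      simp [upd, h1]
    · simp [upd, h1]
    · simp [upd, h24]
  · rintro i m₁ hi ⟨h1, h2, h3, h4, h5, h6, h7⟩
    have e21 := h2 21 (by omega) (by omega) (by omega)
    simp only [Prog.block, ends_seq_iff, ends_setNat_iff, ends_skip_iff]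
    refine ⟨by norm_num, by simp [upd, h1], by simp [upd], fun a ha h20 h21 => ?_,
      fun j hj => ?_, h4, fun a ha => ?_, fun v => ?_, fun b hb => ?_⟩
    · funext j
      simp [upd, ha, h20, h21, h2]
    · simp [upd, hj, h3]
    · rcases (Nat.lt_succ_iff.1 ha).lt_or_eq with hlt | rfl
      · simpa [upd, h1, hlt.ne] using h5 a hlt
      · obtain ⟨g1, g2⟩ := h6 (m.int 21 a)
        simp only [upd, h1, e21, Memory.setNat_int, NatExp.eval]
        simp
        exact ⟨g1, g2, fun b hb hb' => hb' ▸ h7 b hb⟩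
    · obtain ⟨g1, g2⟩ := h6 v
      by_cases hv : v = m.int 21 i
      · simp [upd, h1, e21, hv]
      · simp [upd, h1, e21, hv]
        exact ⟨by omega, g2⟩
    · by_cases hbi : m.int 21 b = m.int 21 i
      · simp [upd, h1, e21, hbi, hb]
      · simp [upd, h1, e21, hbi]
        exact h7 b (lt_of_le_of_ne (Nat.lt_succ_iff.1 hb) fun he => hbi (he ▸ rfl))
  · rintro k m' ⟨⟨h1, h2, h3, h4, h5, h6, h7⟩, hk⟩
    exact ⟨h2, h3, h4, h5, h6, h7, by omega⟩

end

theorem ends_setup {N M : ℕ} (G : Instance N M) :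
    Ends setup G.input fun k m => (∃ K, K ≤ 2 * M ∧ GraphData G K m.int m.real) ∧
      HeapEmpty m.int ∧ (∀ u, m.int 19 u = 0) ∧ m.int 3 0 = 0 ∧ k ≤ 6 * N + 19 * M + 8 := by
  obtain ⟨K, hK⟩ : ∃ K, K = if G.directed then M else M + M := ⟨_, rfl⟩
  have hK2 : K ≤ 2 * M := by
    rw [hK]
    split_ifs <;> omega
  have hMK : M ≤ K := by
    rw [hK]
    split_ifs <;> omega
  have step : Ends number G.input fun k m => (∀ a, a ≠ 9 → m.int a = G.input.int a) ∧
      (∀ i, i ≠ 8 → m.int 9 i = 0) ∧ m.real = G.input.real ∧ m.int 9 8 = K ∧ k ≤ 2 := by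
    refine ends_cond (fun hc => ends_setNat ?_) fun hc => ends_setNat ?_
    · have hd : G.directed = false := by
        simpa [Instance.input] using hc
      refine ⟨fun a ha => ?_, fun i hi => ?_, rfl, ?_, le_rfl⟩
      · funext i
        simp [upd, ha]
      · simp [upd, hi, Instance.input]
      · simp [upd, hK, hd, Instance.input]
    · have hd : G.directed = true := by
        simpa [Instance.input] using hc
      refine ⟨fun a ha => ?_, fun i hi => ?_, rfl, ?_, le_rfl⟩
      · funext i
        simp [upd, ha]
      · simp [upd, hi, Instance.input]
      · simp [upd, hK, hd, Instance.input]
  refine ends_seq (step.mono ?_)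
  rintro k₁ m₁ ⟨g1, g2, g3, g4, g5⟩
  refine ends_seq ((ends_blocks (N := N) (by rw [g1 0 (by omega)]; rfl) g4
    (g2 4 (by omega))).mono ?_)
  rintro k₂ m₂ ⟨h1, h2, h3, h4, h5⟩
  have e0 : ∀ a, a ≠ 9 → a ≠ 18 → m₂.int a = G.input.int a := fun a ha ha' => by
    rw [h1 a ha ha', g1 a ha]
  refine ends_seq ((ends_arcs (M := M) (by rw [e0 0 (by omega) (by omega)]; rfl)).mono ?_)
  rintro k₃ m₃ ⟨i1, i2, i3, i4, i5⟩
  refine (ends_chains (K := K) (by rw [i2 8 (by omega), h2 8 (by omega) (by omega), g4]) ?_).mono ?_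
  · intro v
    rw [i1 24 (by omega) (by omega) (by omega) (by omega), e0 24 (by omega) (by omega)]
    rfl
  rintro k₄ m₄ ⟨j1, j2, j3, j4, j5, j6, j7⟩
  have f0 : ∀ a, a < 9 ∨ (10 ≤ a ∧ a ≤ 17) ∨ a = 19 → m₄.int a = G.input.int a := by
    intro a ha
    rw [j1 a (by omega) (by omega) (by omega), i1 a (by omega) (by omega) (by omega) (by omega),
      e0 a (by omega) (by omega)]
  have f1 : ∀ a, a = 20 ∨ a = 21 ∨ a = 22 → m₄.int a = m₃.int a := fun a ha =>
    j1 a (by omega) (by omega) (by omega)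
  have f20 := f1 20 (by omega)
  have f21 := f1 21 (by omega)
  have f22 := f1 22 (by omega)
  have harc : ∀ e : Fin M, m₃.int 20 e = G.tail e ∧ m₃.int 21 e = G.head e ∧ m₃.int 22 e = e ∧
      m₃.int 20 (M + e) = G.head e ∧ m₃.int 21 (M + e) = G.tail e ∧ m₃.int 22 (M + e) = e := by
    intro e
    have := i4 e e.2
    rw [e0 1 (by omega) (by omega), e0 2 (by omega) (by omega)] at this
    simpa [Instance.input] using this
  have hr : m₄.real = G.input.real := by rw [j3, i3, h3, g3]
  refine ⟨⟨K, hK2, ?_⟩, ⟨?_, ?_, ?_, ?_⟩, ?_, ?_, ?_⟩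
  · refine ⟨?_, ?_, ?_, ?_, ?_, ?_, ?_, ?_, ?_, ?_, ?_, ?_, ?_, ?_⟩
    · rw [f0 0 (by omega)]
      rfl
    · rw [f0 0 (by omega)]
      rfl
    · rw [f0 0 (by omega)]
      rfl
    · intro v hv
      rw [j1 18 (by omega) (by omega) (by omega),
        i1 18 (by omega) (by omega) (by omega) (by omega), h4 v hv]
    · intro a ha
      rw [f20, f21, f22]
      by_cases haM : a < M
      · obtain ⟨a1, a2, a3, -⟩ := harc ⟨a, haM⟩
        exact ⟨⟨a, haM⟩, _, _, a1, a2, a3, Or.inl ⟨rfl, rfl⟩⟩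
      · obtain ⟨x, rfl⟩ := Nat.exists_eq_add_of_le (not_lt.1 haM)
        have hd : G.directed = false := by
          by_contra hd
          rw [Bool.not_eq_false] at hd
          simp [hd] at hK
          omega
        have hx : x < M := by
          simp [hd] at hK
          omega
        obtain ⟨-, -, -, a1, a2, a3⟩ := harc ⟨x, hx⟩
        exact ⟨⟨x, hx⟩, _, _, a1, a2, a3, Or.inr ⟨hd, rfl, rfl⟩⟩
    · intro e u w hj
      rw [f20, f21, f22]
      obtain ⟨a1, a2, a3, a4, a5, a6⟩ := harc e
      rcases hj with ⟨rfl, rfl⟩ | ⟨hd, rfl, rfl⟩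
      · exact ⟨e, e.2.trans_le hMK, a1, a2, a3⟩
      · refine ⟨M + e, ?_, a4, a5, a6⟩
        simp [hK, hd]
    · exact fun a ha => (j4 a ha).1
    · rw [f21]
      exact fun a ha => (j4 a ha).2.1
    · rw [f21]
      exact fun a ha => (j4 a ha).2.2
    · exact fun v _ => (j5 v).1
    · rw [f21]
      exact fun v _ => (j5 v).2
    · rw [f21]
      exact j6
    · intro e
      simp [hr, Instance.input]
    · intro e
      simp [hr, Instance.input]
  · rw [f0 7 (by omega)]
    rfl
  · rw [f0 16 (by omega)]
    rfl
  · intro a i ha ha'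
    rw [f0 a (by omega)]
    obtain rfl | rfl | rfl | rfl | rfl : a = 10 ∨ a = 11 ∨ a = 12 ∨ a = 13 ∨ a = 14 := by omega
    all_goals rfl
  · intro v
    rw [f0 17 (by omega)]
    rfl
  · intro v
    rw [f0 19 (by omega)]
    rfl
  · rw [f0 3 (by omega)]
    rfl
  · omega

/-! ## One search for each edge -/

namespace MainProg

/-- Copy the path that starts at the node in `(9, 7)` to array `6`, from the cell in `(9, 6)` on. -/
def follow : Prog :=
  .loop (.neg (.natEq (.cell 9 7) (.cell 0 3))) (.block [
    .setNat 6 (.cell 9 6) (.cell 25 (.cell 9 7)),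
    .setNat 9 6 (.cell 9 6 + 1),
    .setNat 9 7 (.cell 26 (.cell 9 7))])

/-- Record the path that was found: array `27` marks the edge, `28` and `29` hold the start and
the length of the path, and the real array `5` holds its cost. -/
def record : Prog := .block [
  .setNat 27 (.cell 9 3) 1,
  .setNat 28 (.cell 9 3) (.cell 9 6),
  .setReal 5 (.cell 9 3) (.cell 3 (.cell 0 2)),
  .setNat 9 7 (.cell 0 2),
  follow,
  .setNat 29 (.cell 9 3) (.cell 9 6 - .cell 28 (.cell 9 3))]

/-- Search for a path along the edges of weight at most that of the edge in `(9, 3)`. -/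
def treat : Prog := .seq (.setNat 9 0 (.cell 9 3 + 1)) (.seq SearchProg.search
  (.cond (.natEq (.cell 19 (.cell 0 2)) (.cell 9 0)) record (.setNat 27 (.cell 9 3) 0)))

/-- The searches for all edges. -/
def searches : Prog := .count 3 (.cell 0 1) treat

end MainProg

open MainProg

/-! ### Following the pointers and recording the paths -/

section

variable {N M : ℕ} {G : Instance N M} {m : Memory}

/-- The loop tests only for the end node. On a simple path it occurs last, so the copy does not stop
early. -/
theorem ends_follow {u : Fin N} {vs : List (Fin N)} {es : List (Fin M)}
    (h : Pointer G (m.int 25) (m.int 26) u vs es) (hvs : vs.Nodup) (hu : m.int 9 7 = u)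
    (ht : m.int 0 3 = G.target) :
    Ends follow m fun k m' => (∀ a, a ≠ 6 → a ≠ 9 → m'.int a = m.int a) ∧ m'.real = m.real ∧
      (∀ i, i ≠ 6 → i ≠ 7 → m'.int 9 i = m.int 9 i) ∧
      (∀ i, i < m.int 9 6 → m'.int 6 i = m.int 6 i) ∧ m'.int 9 6 = m.int 9 6 + es.length ∧
      (∀ i (hi : i < es.length), m'.int 6 (m.int 9 6 + i) = es[i]) ∧ k ≤ 5 * es.length + 1 := by
  generalize hne : m.int 25 = ne at h
  generalize hnv : m.int 26 = nv at h
  induction h generalizing m with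
  | nil =>
    refine ⟨_, _, .loopDone ?_, fun _ _ _ => rfl, rfl, fun _ _ _ => rfl, fun _ _ => rfl, rfl,
      ?_, le_rfl⟩
    · simp [hu, ht]
    · simp
  | @cons u w e vs es h1 h2 hj hp ih =>
    have hut : u ≠ G.target := by
      rintro rfl
      exact (List.nodup_cons.1 hvs).1 (Instance.Trace.target_mem _ hp.trace)
    have hstep : Ends (.block [
        .setNat 6 (.cell 9 6) (.cell 25 (.cell 9 7)),
        .setNat 9 6 (.cell 9 6 + 1),
        .setNat 9 7 (.cell 26 (.cell 9 7))]) m fun k m' =>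
        (∀ a, a ≠ 6 → a ≠ 9 → m'.int a = m.int a) ∧ m'.real = m.real ∧
        (∀ i, i ≠ 6 → i ≠ 7 → m'.int 9 i = m.int 9 i) ∧
        (∀ i, m'.int 6 i = if i = m.int 9 6 then (e : ℕ) else m.int 6 i) ∧
        m'.int 9 6 = m.int 9 6 + 1 ∧ m'.int 9 7 = w ∧ k ≤ 4 := by
      simp only [Prog.block, ends_seq_iff, ends_setNat_iff, ends_skip_iff]
      refine ⟨fun a ha ha' => ?_, rfl, fun i hi hi' => ?_, fun i => ?_, ?_, ?_, by norm_num⟩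
      · funext i
        simp [upd, ha, ha']
      · simp [upd, hi, hi']
      · simp [upd, hu, hne, h1]
      · simp [upd]
      · simp [upd, hu, hnv, h2]
    obtain ⟨k₁, m₁, hr, g1, g2, g3, g4, g5, g6, g7⟩ := hstep
    obtain ⟨k₂, m₂, hr', i1, i2, i3, i4, i5, i6, i7⟩ := ih (m := m₁) (List.nodup_cons.1 hvs).2 g6
      (by rw [g1 0 (by omega) (by omega), ht]) (by rw [g1 25 (by omega) (by omega), hne])
      (by rw [g1 26 (by omega) (by omega), hnv])
    refine ⟨_, _, .loopStep ?_ hr hr', fun a ha ha' => (i1 a ha ha').trans (g1 a ha ha'),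
      i2.trans g2, fun i hi hi' => (i3 i hi hi').trans (g3 i hi hi'), fun i hi => ?_, ?_,
      fun i hi => ?_, ?_⟩
    · simpa [hu, ht, Fin.ext_iff] using hut
    · rw [i4 i (by omega), g4, if_neg (by omega)]
    · rw [i5, g5, List.length_cons]
      omega
    · cases i with
      | zero => rw [i4 _ (by omega), g4, if_pos (by omega), List.getElem_cons_zero]
      | succ i =>
        have := i6 i (by simpa using hi)
        rw [g5] at this
        rw [List.getElem_cons_succ, ← this]
        congr 1
        omega
    · rw [List.length_cons]
      omega

/-- The path `P` is recorded for the edge `e`: it is a cheapest path among those of weight at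
most `weight e`, if there is such a path. -/
structure Recorded (G : Instance N M) (e : Fin M) (P : List (Fin M)) (m : Memory) : Prop where
  feasible : m.int 27 e ≠ 0 → P ∈ G.paths ∧ Instance.cost G.nominal P = m.real 5 e ∧
    ∀ e' ∈ P, G.weight e' ≤ G.weight e
  min : ∀ Q ∈ G.paths, (∀ e' ∈ Q, G.weight e' ≤ G.weight e) →
    m.int 27 e ≠ 0 ∧ m.real 5 e ≤ Instance.cost G.nominal Q
  length : m.int 27 e ≠ 0 → m.int 29 e = P.length
  le : m.int 27 e ≠ 0 → m.int 28 e + P.length ≤ m.int 9 6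
  entry : m.int 27 e ≠ 0 → ∀ i (hi : i < P.length), m.int 6 (m.int 28 e + i) = P[i]

theorem Recorded.of_eq {e : Fin M} {P : List (Fin M)} {m' : Memory} (h : Recorded G e P m)
    (h27 : m'.int 27 e = m.int 27 e) (h28 : m'.int 28 e = m.int 28 e)
    (h29 : m'.int 29 e = m.int 29 e) (h5 : m'.real 5 e = m.real 5 e)
    (h9 : m.int 9 6 ≤ m'.int 9 6) (h6 : ∀ i, i < m.int 9 6 → m'.int 6 i = m.int 6 i) :
    Recorded G e P m' := by
  obtain ⟨i1, i2, i3, i4, i5⟩ := h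
  rw [← h27] at i1 i2 i3 i4 i5
  rw [← h28] at i4 i5
  rw [← h29] at i3
  rw [← h5] at i1 i2
  refine ⟨i1, i2, i3, fun h0 => (i4 h0).trans h9, fun h0 i hi => ?_⟩
  rw [h6 _ (by have := i4 h0; omega), i5 h0 i hi]

theorem ends_record {K : ℕ} {e : Fin M} (hD : GraphData G K m.int m.real)
    (hS : SearchDone G e m) (h3 : m.int 9 3 = e) (hs : m.int 19 G.source = e + 1) :
    Ends record m fun k m' => (∃ P, Recorded G e P m') ∧ k ≤ 5 * N + 10 ∧
      (∀ a, a ≠ 6 → a ≠ 9 → a ≠ 27 → a ≠ 28 → a ≠ 29 → m'.int a = m.int a) ∧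
      (∀ b, b ≠ 5 → m'.real b = m.real b) ∧
      (∀ i, i ≠ 6 → i ≠ 7 → m'.int 9 i = m.int 9 i) ∧
      (∀ i : ℕ, i ≠ e → m'.int 27 i = m.int 27 i ∧ m'.int 28 i = m.int 28 i ∧
        m'.int 29 i = m.int 29 i ∧ m'.real 5 i = m.real 5 i) ∧
      m.int 9 6 ≤ m'.int 9 6 ∧ ∀ i, i < m.int 9 6 → m'.int 6 i = m.int 6 i := by
  obtain ⟨vs, es, hvs, hp, hw, hsum⟩ := hS.path _ hs
  have hpath : es ∈ G.paths := ⟨vs, hvs, hp.trace⟩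
  rw [record, Prog.block, Prog.block, Prog.block, Prog.block, Prog.block, Prog.block, Prog.block]
  refine ends_seq (ends_setNat (ends_seq (ends_setNat (ends_seq (ends_setReal (ends_seq
    (ends_setNat (ends_seq ?_))))))))
  generalize hm₁ : Memory.setNat (Memory.setReal (Memory.setNat (Memory.setNat
    _ _ _ _) _ _ _) _ _ _) _ _ _ = m₁
  have e27 : ∀ i, m₁.int 27 i = if i = e then 1 else m.int 27 i := by
    intro i
    simp [← hm₁, upd, h3]
  have e28 : ∀ i, m₁.int 28 i = if i = e then m.int 9 6 else m.int 28 i := by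
    intro i
    simp [← hm₁, upd, h3]
  have e5 : ∀ i, m₁.real 5 i = if i = e then m.real 3 G.source else m.real 5 i := by
    intro i
    simp [← hm₁, upd, h3, hD.source]
  have e97 : m₁.int 9 7 = G.source := by simp [← hm₁, upd, hD.source]
  have e9 : ∀ i, i ≠ 7 → m₁.int 9 i = m.int 9 i := by
    intro i hi
    simp [← hm₁, upd, hi]
  have eoff : ∀ a, a ≠ 9 → a ≠ 27 → a ≠ 28 → m₁.int a = m.int a := by
    intro a h1 h2 h3
    funext i
    simp [← hm₁, upd, h1, h2, h3]
  have roff : ∀ b, b ≠ 5 → m₁.real b = m.real b := by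
    intro b hb
    funext i
    simp [← hm₁, upd, hb]
  clear hm₁
  refine (ends_follow (m := m₁) (by
    rwa [eoff 25 (by omega) (by omega) (by omega), eoff 26 (by omega) (by omega) (by omega)])
    hvs e97 (by rw [eoff 0 (by omega) (by omega) (by omega), hD.target])).mono ?_
  rintro k m₂ ⟨g1, g2, g3, g4, g5, g6, g7⟩
  refine ends_seq (ends_setNat (ends_skip ?_))
  generalize hm₃ : Memory.setNat m₂ _ _ _ = m₃
  have f28 : ∀ i, m₂.int 28 i = if i = e then m.int 9 6 else m.int 28 i := by
    intro i
    rw [g1 28 (by omega) (by omega), e28]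
  have f29 : ∀ i, m₃.int 29 i = if i = e then es.length else m.int 29 i := by
    intro i
    simp [← hm₃, upd, g3, e9, h3, g5, f28]
    simp [g1, eoff]
  have foff : ∀ a, a ≠ 29 → m₃.int a = m₂.int a := by
    intro a ha
    funext i
    simp [← hm₃, upd, ha]
  have fr : m₃.real = m₂.real := by simp [← hm₃]
  clear hm₃
  rw [e9 6 (by omega)] at g4 g5 g6
  have k27 : ∀ i, m₃.int 27 i = if i = e then 1 else m.int 27 i := by
    intro i
    rw [foff 27 (by omega), g1 27 (by omega) (by omega), e27]
  have k28 : ∀ i, m₃.int 28 i = if i = e then m.int 9 6 else m.int 28 i := by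
    intro i
    rw [foff 28 (by omega), f28]
  have k5 : ∀ i, m₃.real 5 i = if i = e then m.real 3 G.source else m.real 5 i := by
    intro i
    rw [fr, g2, e5]
  -- A simple path has fewer edges than there are nodes; this bounds the copying by `O(N)` per edge.
  have hlen : es.length ≤ N := by
    have h1 := hp.trace.length_eq
    have h2 := hvs.length_le_card
    rw [Fintype.card_fin] at h2
    omega
  refine ⟨⟨es, ⟨?_, ?_, ?_, ?_, ?_⟩⟩, by omega, ?_, ?_, ?_, ?_, ?_, ?_⟩
  · intro _
    refine ⟨hpath, ?_, hw⟩
    rw [G.cost_eq_sum hpath, k5, if_pos rfl, hsum]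
  · intro Q hQ hwQ
    obtain ⟨vs', -, htr⟩ := id hQ
    rw [G.cost_eq_sum hQ, k5, k27, if_pos rfl, if_pos rfl]
    exact ⟨one_ne_zero, (hS.le _ _ _ htr hwQ).2⟩
  · intro _
    rw [f29, if_pos rfl]
  · intro _
    rw [k28, if_pos rfl, foff 9 (by omega), g5]
  · intro _ i hi
    rw [k28, if_pos rfl, foff 6 (by omega), g6 i hi]
  · intro a h6 h9 h27 h28 h29
    rw [foff a h29, g1 a h6 h9, eoff a h9 h27 h28]
  · intro b hb
    rw [fr, g2, roff b hb]
  · intro i h6 h7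
    rw [foff 9 (by omega), g3 i h6 h7, e9 i h7]
  · intro i hi
    rw [k27, k28, f29, k5]
    simp [hi]
  · rw [foff 9 (by omega), g5]
    omega
  · intro i hi
    rw [foff 6 (by omega), g4 i hi, eoff 6 (by omega) (by omega) (by omega)]

/-- The state of the program after the searches for the first `n` edges. -/
structure SearchesState (G : Instance N M) (K n : ℕ) (m : Memory) : Prop where
  data : GraphData G K m.int m.real
  heap : HeapEmpty m.int
  stamps : ∀ u, m.int 19 u ≤ n
  output : m.int 3 0 = 0
  recorded : ∀ e : Fin M, (e : ℕ) < n → ∃ P, Recorded G e P m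

theorem SearchesState.of_eq {K n : ℕ} {m' : Memory} (h : SearchesState G K n m)
    (hi : ∀ a, a ≠ 9 → m'.int a = m.int a) (h9 : m'.int 9 6 = m.int 9 6)
    (hr : m'.real = m.real) : SearchesState G K n m' := by
  refine ⟨h.data.congr (hi 0 (by omega)) (hi 18 (by omega)) (fun a _ _ => hi a (by omega))
    fun b _ => by rw [hr], ⟨?_, ?_, fun a i h1 h2 => ?_, ?_⟩, ?_, ?_, fun e he => ?_⟩
  · rw [hi 7 (by omega)]
    exact h.heap.top
  · rw [hi 16 (by omega)]
    exact h.heap.rank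
  · rw [hi a (by omega)]
    exact h.heap.zero a i h1 h2
  · rw [hi 17 (by omega)]
    exact h.heap.node
  · rw [hi 19 (by omega)]
    exact h.stamps
  · rw [hi 3 (by omega)]
    exact h.output
  · obtain ⟨P, hP⟩ := h.recorded e he
    exact ⟨P, hP.of_eq (by rw [hi 27 (by omega)]) (by rw [hi 28 (by omega)])
      (by rw [hi 29 (by omega)]) (by rw [hr]) h9.ge fun i _ => by rw [hi 6 (by omega)]⟩

/-- Later paths are appended behind the register `(9, 6)`, so the paths already recorded stay
intact. -/
theorem ends_treat {K L : ℕ} (hL : ∀ r, Nat.fib (r + 1) ≤ K + 2 → r ≤ L) {e : Fin M}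
    (h : SearchesState G K e m) (h3 : m.int 9 3 = e) :
    Ends treat m fun k m' => k ≤ 200 * K + 330 * ((L + 1) * (N + 1)) + 5 * N + 920 ∧
      m'.int 9 3 = e ∧ SearchesState G K (e + 1) m' := by
  refine ends_seq (ends_setNat ?_)
  generalize hm₁ : Memory.setNat m _ _ _ = m₁
  have e9 : ∀ i, m₁.int 9 i = if i = 0 then (e : ℕ) + 1 else m.int 9 i := by
    intro i
    simp [← hm₁, upd, h3]
  have eoff : ∀ a, a ≠ 9 → m₁.int a = m.int a := by
    intro a ha
    funext i
    simp [← hm₁, upd, ha]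
  have er : m₁.real = m.real := by simp [← hm₁]
  clear hm₁
  have h₁ : SearchesState G K e m₁ := h.of_eq eoff (by simp [e9]) er
  refine ends_seq ((ends_search (e₀ := e) hL h₁.data h₁.heap (by simp [e9]) h₁.stamps).mono ?_)
  rintro k m₂ ⟨g1, g2, g3, g4, g5, g6⟩
  have f0 : m₂.int 9 0 = e + 1 := by
    rw [g5.register 0 (by omega) (by omega), e9, if_pos rfl]
  have f3 : m₂.int 9 3 = e := by
    rw [g5.register 3 (by omega) (by omega), e9, if_neg (by omega), h3]
  have f9 : m₂.int 9 6 = m₁.int 9 6 := g5.register 6 (by omega) (by omega)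
  have hrec : ∀ e' : Fin M, (e' : ℕ) < e → ∃ P, Recorded G e' P m₂ := by
    intro e' he'
    obtain ⟨P, hP⟩ := h₁.recorded e' he'
    exact ⟨P, hP.of_eq (by rw [g5.int 27 (by omega)]) (by rw [g5.int 28 (by omega)])
      (by rw [g5.int 29 (by omega)]) (by rw [g5.real 5 (by omega) (by omega) (by omega)])
      f9.ge fun i _ => by rw [g5.int 6 (by omega)]⟩
  have hout : m₂.int 3 0 = 0 := by
    rw [g5.int 3 (by omega)]
    exact h₁.output
  refine ends_cond (fun hc => ?_) fun hc => ends_setNat ?_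
  · replace hc : m₂.int 19 G.source = e + 1 := by
      simpa [g2.source, f0] using hc
    refine (ends_record g2 g1 f3 hc).mono ?_
    rintro l m₃ ⟨⟨P, i1⟩, i2, i3, i4, i5, i6, i7, i8⟩
    have j : ∀ a, a ≠ 6 → a ≠ 9 → (a < 27 ∨ 29 < a) → m₃.int a = m₂.int a := fun a h1 h2 h3 =>
      i3 a h1 h2 (by omega) (by omega) (by omega)
    refine ⟨by omega, by rw [i5 3 (by omega) (by omega), f3], ?_, ⟨?_, ?_, fun a i h1 h2 => ?_, ?_⟩,
      ?_, ?_, fun e' he' => ?_⟩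
    · exact g2.congr (j 0 (by omega) (by omega) (by omega)) (j 18 (by omega) (by omega) (by omega))
        (fun a _ _ => j a (by omega) (by omega) (by omega)) fun b _ => i4 b (by omega)
    · rw [j 7 (by omega) (by omega) (by omega)]
      exact g3.top
    · rw [j 16 (by omega) (by omega) (by omega)]
      exact g3.rank
    · rw [j a (by omega) (by omega) (by omega)]
      exact g3.zero a i h1 h2
    · rw [j 17 (by omega) (by omega) (by omega)]
      exact g3.node
    · rw [j 19 (by omega) (by omega) (by omega)]
      exact g4
    · rw [j 3 (by omega) (by omega) (by omega), hout]
    · rcases (Nat.lt_succ_iff.1 he').lt_or_eq with hlt | heq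
      · obtain ⟨Q, hQ⟩ := hrec e' hlt
        obtain ⟨n1, n2, n3, n4⟩ := i6 e' hlt.ne
        exact ⟨Q, hQ.of_eq n1 n2 n3 n4 i7 i8⟩
      · obtain rfl : e' = e := Fin.ext heq
        exact ⟨P, i1⟩
  · replace hc : ¬ m₂.int 19 G.source = e + 1 := by
      simpa [g2.source, f0] using hc
    generalize hm₃ : Memory.setNat m₂ _ _ _ = m₃
    have j27 : ∀ i, m₃.int 27 i = if i = e then 0 else m₂.int 27 i := by
      intro i
      simp [← hm₃, upd, f3]
    have j : ∀ a, a ≠ 27 → m₃.int a = m₂.int a := by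
      intro a ha
      funext i
      simp [← hm₃, upd, ha]
    have jr : m₃.real = m₂.real := by simp [← hm₃]
    clear hm₃
    refine ⟨by omega, by rw [j 9 (by omega), f3], ?_, ⟨?_, ?_, fun a i h1 h2 => ?_, ?_⟩, ?_, ?_,
      fun e' he' => ?_⟩
    · exact g2.congr (j 0 (by omega)) (j 18 (by omega)) (fun a _ _ => j a (by omega))
        fun b _ => by rw [jr]
    · rw [j 7 (by omega)]
      exact g3.top
    · rw [j 16 (by omega)]
      exact g3.rank
    · rw [j a (by omega)]
      exact g3.zero a i h1 h2
    · rw [j 17 (by omega)]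
      exact g3.node
    · rw [j 19 (by omega)]
      exact g4
    · rw [j 3 (by omega), hout]
    · rcases (Nat.lt_succ_iff.1 he').lt_or_eq with hlt | heq
      · obtain ⟨Q, hQ⟩ := hrec e' hlt
        exact ⟨Q, hQ.of_eq (by rw [j27, if_neg hlt.ne]) (by rw [j 28 (by omega)])
          (by rw [j 29 (by omega)]) (by rw [jr]) (by rw [j 9 (by omega)])
          fun i _ => by rw [j 6 (by omega)]⟩
      · obtain rfl : e' = e := Fin.ext heq
        have h0 : ¬ m₃.int 27 e' ≠ 0 := by simp [j27]
        refine ⟨[], fun hn => absurd hn h0, fun Q hQ hw => ?_, fun hn => absurd hn h0,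
          fun hn => absurd hn h0, fun hn => absurd hn h0⟩
        obtain ⟨vs, -, htr⟩ := hQ
        exact absurd (g1.le _ _ _ htr hw).1 hc

theorem ends_searches {K L : ℕ} (hL : ∀ r, Nat.fib (r + 1) ≤ K + 2 → r ≤ L)
    (h : SearchesState G K 0 m) :
    Ends searches m fun k m' => SearchesState G K M m' ∧
      k ≤ M * (200 * K + 330 * ((L + 1) * (N + 1)) + 5 * N + 922) + 2 := by
  refine (ends_count (n := M) (c := 200 * K + 330 * ((L + 1) * (N + 1)) + 5 * N + 920)
    (fun n m' => m'.int 9 3 = n ∧ SearchesState G K n m') ?_ ?_ ?_).mono ?_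
  · rintro i m' ⟨h1, h2⟩
    exact ⟨h1, h2.data.edges⟩
  · exact ⟨by simp [upd], h.of_eq (fun a ha => by funext i; simp [upd, ha]) (by simp [upd]) rfl⟩
  · rintro i m₁ hi ⟨h1, h2⟩
    refine (ends_treat (e := ⟨i, hi⟩) hL h2 h1).mono ?_
    rintro k m₂ ⟨g1, g2, g3⟩
    exact ⟨g1, g2, by simp [upd],
      g3.of_eq (fun a ha => by funext i; simp [upd, ha]) (by simp [upd]) rfl⟩
  · rintro k m' ⟨⟨h1, h2⟩, hk⟩
    exact ⟨h2, hk⟩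

end

/-! ## The selection of the paths -/

section

variable {N M : ℕ} {G : Instance N M}

/-- `lo` is the smallest `lam ≥ 0` for which the line of `e` is below the steeper ones. -/
theorem Instance.selected_iff {feas : Fin M → Prop} {val : Fin M → ℝ} {e : Fin M} {lo : ℝ}
    (he : feas e) (h0 : 0 ≤ lo)
    (hle : ∀ j, feas j → G.weight e < G.weight j →
      (val e - val j) / (G.weight j - G.weight e) ≤ lo)
    (heq : lo = 0 ∨ ∃ j, feas j ∧ G.weight e < G.weight j ∧
      lo = (val e - val j) / (G.weight j - G.weight e)) :
    G.Selected feas val e ↔ ∀ j, feas j →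
      (G.weight j < G.weight e → lo * (G.weight e - G.weight j) < val j - val e) ∧
      (G.weight j = G.weight e → e ≤ j) := by
  constructor
  · rintro ⟨-, lam, hlam, h⟩ j hj
    refine ⟨fun hw => ?_, (h j hj).2.2⟩
    -- Raising `lam` only makes the conditions against flatter lines harder, so it suffices to test
    -- them at the smallest value that the steeper lines allow.
    have hlo : lo ≤ lam := by
      rcases heq with rfl | ⟨i, hi, hwi, rfl⟩
      · exact hlam
      · rw [div_le_iff₀ (sub_pos.2 hwi)]
        linarith [(h i hi).1 hwi]
    have := (h j hj).2.1 hw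
    nlinarith
  · intro h
    refine ⟨he, lo, h0, fun j hj => ⟨fun hw => ?_, fun hw => ?_, (h j hj).2⟩⟩
    · have := hle j hj hw
      rw [div_le_iff₀ (sub_pos.2 hw)] at this
      linarith
    · have := (h j hj).1 hw
      linarith

end

namespace MainProg

/-- The value of `lam` for which the lines of the edges in `(9, 3)` and `(9, 4)` meet. -/
def meeting : RealExp :=
  (.cell 5 (.cell 9 3) - .cell 5 (.cell 9 4)) / (.cell 1 (.cell 9 4) - .cell 1 (.cell 9 3))

/-- The lower bound for `lam` that the steeper lines give for the edge in `(9, 3)`. -/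
def lower : Prog := .count 4 (.cell 0 1)
  (.cond (.conj (.neg (.natEq (.cell 27 (.cell 9 4)) 0))
    (.conj (.realLt (.cell 1 (.cell 9 3)) (.cell 1 (.cell 9 4)))
      (.realLt (.cell 6 0) meeting))) (.setReal 6 0 meeting) .skip)

/-- The edge in `(9, 4)` excludes the one in `(9, 3)`. -/
def excludes : Test :=
  .conj (.neg (.natEq (.cell 27 (.cell 9 4)) 0))
    (.neg (.conj
      (.neg (.conj (.realLt (.cell 1 (.cell 9 4)) (.cell 1 (.cell 9 3)))
        (.neg (.realLt (.cell 6 0 * (.cell 1 (.cell 9 3) - .cell 1 (.cell 9 4)))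
          (.cell 5 (.cell 9 4) - .cell 5 (.cell 9 3))))))
      (.neg (.conj (.conj (.neg (.realLt (.cell 1 (.cell 9 4)) (.cell 1 (.cell 9 3))))
        (.neg (.realLt (.cell 1 (.cell 9 3)) (.cell 1 (.cell 9 4)))))
        (.natLt (.cell 9 4) (.cell 9 3))))))

/-- Clear `(9, 5)` if the edge in `(9, 3)` is excluded. -/
def exclude : Prog := .count 4 (.cell 0 1) (.cond excludes (.setNat 9 5 0) .skip)

/-- Put the path of the edge in `(9, 3)` into the output. -/
def emit : Prog := .block [
  .setNat 4 (.cell 3 0) (.cell 28 (.cell 9 3)),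
  .setNat 5 (.cell 3 0) (.cell 29 (.cell 9 3)),
  .setNat 3 0 (.cell 3 0 + 1)]

/-- Decide whether the path of the edge in `(9, 3)` is selected. -/
def select : Prog := .cond (.natEq (.cell 27 (.cell 9 3)) 0) .skip (.block [
  .setReal 6 0 0,
  lower,
  .setNat 9 5 1,
  exclude,
  .cond (.natEq (.cell 9 5) 0) .skip emit])

/-- The selection among the recorded paths. -/
def selection : Prog := .count 3 (.cell 0 1) select

/-- The algorithm. -/
def main : Prog := .seq SetupProg.setup (.seq searches selection)

end MainProg

open MainProg

/-! ### Correctness and cost of the selection -/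

section

variable {N M : ℕ} {G : Instance N M} {m : Memory}

/-- The last disjunction records that the running maximum is attained, by the initial `0` or by a
meeting point; `Instance.selected_iff` needs this to know that the bound is the smallest admissible
one. -/
theorem ends_lower {e : Fin M} (h3 : m.int 9 3 = e) (hM : m.int 0 1 = M)
    (hw : ∀ j : Fin M, m.real 1 j = G.weight j) (h6 : m.real 6 0 = 0) :
    Ends lower m fun k m' => (∀ a, a ≠ 9 → m'.int a = m.int a) ∧
      (∀ i, i ≠ 4 → m'.int 9 i = m.int 9 i) ∧ (∀ b, b ≠ 6 → m'.real b = m.real b) ∧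
      0 ≤ m'.real 6 0 ∧
      (∀ j : Fin M, m.int 27 j ≠ 0 → G.weight e < G.weight j →
        (m.real 5 e - m.real 5 j) / (G.weight j - G.weight e) ≤ m'.real 6 0) ∧
      (m'.real 6 0 = 0 ∨ ∃ j : Fin M, m.int 27 j ≠ 0 ∧ G.weight e < G.weight j ∧
        m'.real 6 0 = (m.real 5 e - m.real 5 j) / (G.weight j - G.weight e)) ∧
      k ≤ 4 * M + 2 := by
  refine (ends_count (n := M) (c := 2) (fun n m' => m'.int 9 4 = n ∧
    (∀ a, a ≠ 9 → m'.int a = m.int a) ∧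
    (∀ i, i ≠ 4 → m'.int 9 i = m.int 9 i) ∧ (∀ b, b ≠ 6 → m'.real b = m.real b) ∧
    0 ≤ m'.real 6 0 ∧
    (∀ j : Fin M, (j : ℕ) < n → m.int 27 j ≠ 0 → G.weight e < G.weight j →
      (m.real 5 e - m.real 5 j) / (G.weight j - G.weight e) ≤ m'.real 6 0) ∧
    (m'.real 6 0 = 0 ∨ ∃ j : Fin M, m.int 27 j ≠ 0 ∧ G.weight e < G.weight j ∧
      m'.real 6 0 = (m.real 5 e - m.real 5 j) / (G.weight j - G.weight e))) ?_ ?_ ?_).mono ?_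
  · rintro i m' ⟨h1, h2, -⟩
    exact ⟨h1, by simp [h2, hM]⟩
  · refine ⟨by simp [upd], fun a ha => ?_, fun i hi => ?_, fun b _ => rfl, by simp [h6], by simp,
      Or.inl (by simp [h6])⟩
    · funext i
      simp [upd, ha]
    · simp [upd, hi]
  · rintro i m₁ hi ⟨h1, h2, h3', h4, h5, h6, h7⟩
    obtain ⟨j, rfl⟩ : ∃ j : Fin M, i = j := ⟨⟨i, hi⟩, rfl⟩
    have e3 : m₁.int 9 3 = e := by rw [h3' 3 (by omega), h3]
    have e27 := h2 27 (by omega)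
    have e1 := h4 1 (by omega)
    have e5 := h4 5 (by omega)
    refine ends_cond (fun hc => ends_setReal ?_) fun hc => ends_skip ?_
    · simp [meeting, h1, e3, e27, e1, e5, hw] at hc
      refine ⟨by norm_num, h1, by simp [upd], fun a ha => ?_, fun i hi => ?_, fun b hb => ?_, ?_⟩
      · funext i
        simp [upd, ha, h2]
      · simp [upd, hi, h3']
      · funext i
        simp [upd, hb, h4]
      · have : ∀ v : ℝ, v = (m.real 5 e - m.real 5 j) / (G.weight j - G.weight e) →
            0 ≤ v ∧ (∀ j' : Fin M, (j' : ℕ) < j + 1 → m.int 27 j' ≠ 0 →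
              G.weight e < G.weight j' →
              (m.real 5 e - m.real 5 j') / (G.weight j' - G.weight e) ≤ v) ∧
            (v = 0 ∨ ∃ j : Fin M, m.int 27 j ≠ 0 ∧ G.weight e < G.weight j ∧
              v = (m.real 5 e - m.real 5 j) / (G.weight j - G.weight e)) := by
          rintro v hv
          rw [← hv] at hc
          refine ⟨h5.trans hc.2.2.le, fun j' hj' hj0 hwj => ?_, Or.inr ⟨j, hc.1, hc.2.1, hv⟩⟩
          rcases (Nat.lt_succ_iff.1 hj').lt_or_eq with hlt | heq
          · exact (h6 j' hlt hj0 hwj).trans hc.2.2.le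
          · obtain rfl : j' = j := Fin.ext heq
            exact hv.ge
        refine this _ ?_
        simp [upd, meeting, h1, e3, e1, e5, hw]
    · simp [meeting, h1, e3, e27, e1, e5, hw] at hc
      refine ⟨by norm_num, h1, by simp [upd], fun a ha => ?_, fun i hi => ?_, h4, h5,
        fun j' hj' hj0 hwj => ?_, h7⟩
      · funext i
        simp [upd, ha, h2]
      · simp [upd, hi, h3']
      · rcases (Nat.lt_succ_iff.1 hj').lt_or_eq with hlt | heq
        · exact h6 j' hlt hj0 hwj
        · obtain rfl : j' = j := Fin.ext heq
          exact hc hj0 hwj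
  · rintro k m' ⟨⟨h1, h2, h3, h4, h5, h6, h7⟩, hk⟩
    exact ⟨h2, h3, h4, h5, fun j => h6 j j.2, h7, by omega⟩

theorem ends_exclude {e : Fin M} (h3 : m.int 9 3 = e) (hM : m.int 0 1 = M)
    (hw : ∀ j : Fin M, m.real 1 j = G.weight j) (h5 : m.int 9 5 = 1) :
    Ends exclude m fun k m' => (∀ a, a ≠ 9 → m'.int a = m.int a) ∧
      (∀ i, i ≠ 4 → i ≠ 5 → m'.int 9 i = m.int 9 i) ∧ m'.real = m.real ∧
      (m'.int 9 5 ≠ 0 ↔ ∀ j : Fin M, m.int 27 j ≠ 0 →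
        (G.weight j < G.weight e →
          m.real 6 0 * (G.weight e - G.weight j) < m.real 5 j - m.real 5 e) ∧
        (G.weight j = G.weight e → e ≤ j)) ∧ k ≤ 4 * M + 2 := by
  refine (ends_count (n := M) (c := 2) (fun n m' => m'.int 9 4 = n ∧
    (∀ a, a ≠ 9 → m'.int a = m.int a) ∧
    (∀ i, i ≠ 4 → i ≠ 5 → m'.int 9 i = m.int 9 i) ∧ m'.real = m.real ∧
    (m'.int 9 5 ≠ 0 ↔ ∀ j : Fin M, (j : ℕ) < n → m.int 27 j ≠ 0 →
      (G.weight j < G.weight e →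
        m.real 6 0 * (G.weight e - G.weight j) < m.real 5 j - m.real 5 e) ∧
      (G.weight j = G.weight e → e ≤ j))) ?_ ?_ ?_).mono ?_
  · rintro i m' ⟨h1, h2, -⟩
    exact ⟨h1, by simp [h2, hM]⟩
  · refine ⟨by simp [upd], fun a ha => ?_, fun i hi _ => ?_, rfl, by simp [upd, h5]⟩
    · funext i
      simp [upd, ha]
    · simp [upd, hi]
  · rintro i m₁ hi ⟨h1, h2, h3', h4, h6⟩
    obtain ⟨j, rfl⟩ : ∃ j : Fin M, i = j := ⟨⟨i, hi⟩, rfl⟩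
    have e3 : m₁.int 9 3 = e := by rw [h3' 3 (by omega) (by omega), h3]
    have e27 := h2 27 (by omega)
    -- The machine compares reals only by `<`. Equality of weights is therefore tested as the
    -- failure of both strict inequalities.
    have hex : excludes.Holds m₁ ↔ ¬ (m.int 27 j ≠ 0 → (G.weight j < G.weight e →
        m.real 6 0 * (G.weight e - G.weight j) < m.real 5 j - m.real 5 e) ∧
        (G.weight j = G.weight e → e ≤ j)) := by
      simp only [excludes, Test.Holds, NatExp.eval, RealExp.eval, NatExp.eval_ofNat,
        RealExp.eval_mul', RealExp.eval_sub', h1, e3, e27, h4, hw]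
      have hidx : e ≤ j ↔ ¬ (j : ℕ) < e := by rw [not_lt, Fin.le_def]
      have hwt : G.weight j = G.weight e ↔
          ¬ G.weight j < G.weight e ∧ ¬ G.weight e < G.weight j := by
        rw [not_lt, not_lt, le_antisymm_iff, and_comm]
      rw [hidx, hwt]
      tauto
    have hsucc : (∀ j' : Fin M, (j' : ℕ) < j + 1 → m.int 27 j' ≠ 0 →
        (G.weight j' < G.weight e →
          m.real 6 0 * (G.weight e - G.weight j') < m.real 5 j' - m.real 5 e) ∧
        (G.weight j' = G.weight e → e ≤ j')) ↔ m₁.int 9 5 ≠ 0 ∧ ¬ excludes.Holds m₁ := by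
      rw [h6, hex, not_not]
      refine ⟨fun h => ⟨fun j' hj' => h j' (by omega), h j (by omega)⟩, fun h j' hj' => ?_⟩
      rcases (Nat.lt_succ_iff.1 hj').lt_or_eq with hlt | heq
      · exact h.1 j' hlt
      · obtain rfl : j' = j := Fin.ext heq
        exact h.2
    refine ends_cond (fun hc => ends_setNat ?_) fun hc => ends_skip ?_
    · refine ⟨by norm_num, by simp [upd, h1], by simp [upd], fun a ha => ?_, fun i hi hi' => ?_, h4,
        ?_⟩
      · funext i
        simp [upd, ha, h2]
      · simp [upd, hi, hi', h3']
      · rw [hsucc]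
        simp [upd, hc]
    · refine ⟨by norm_num, h1, by simp [upd], fun a ha => ?_, fun i hi hi' => ?_, h4, ?_⟩
      · funext i
        simp [upd, ha, h2]
      · simp [upd, hi, hi', h3']
      · rw [hsucc]
        simp [upd, hc]
  · rintro k m' ⟨⟨h1, h2, h3, h4, h5⟩, hk⟩
    exact ⟨h2, h3, h4, by simpa using h5, by omega⟩

/-- The state of the selection after the first `n` edges, when it started on `m`: the output
consists of the recorded paths of the edges in `l`. -/
structure SelectionState (G : Instance N M) (m : Memory) (n : ℕ) (l : List (Fin M))
    (m' : Memory) : Prop where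
  counter : m'.int 9 3 = n
  int : ∀ a, a ≠ 3 → a ≠ 4 → a ≠ 5 → a ≠ 9 → m'.int a = m.int a
  real : ∀ b, b ≠ 6 → m'.real b = m.real b
  mem : ∀ e : Fin M, e ∈ l ↔
    G.Selected (fun e => m.int 27 e ≠ 0) (fun e => m.real 5 e) e ∧ (e : ℕ) < n
  nodup : l.Nodup
  number : m'.int 3 0 = l.length
  entry : ∀ i (hi : i < l.length), m'.int 4 i = m.int 28 l[i] ∧ m'.int 5 i = m.int 29 l[i]

theorem SelectionState.succ_of_not {n : ℕ} {l : List (Fin M)} {m₁ m₂ : Memory}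
    (h : SelectionState G m n l m₁) (hi : ∀ a, a ≠ 9 → m₂.int a = m₁.int a)
    (h3 : m₂.int 9 3 = n + 1) (hr : ∀ b, b ≠ 6 → m₂.real b = m₁.real b)
    (hn : ∀ e : Fin M, (e : ℕ) = n →
      ¬ G.Selected (fun e => m.int 27 e ≠ 0) (fun e => m.real 5 e) e) :
    SelectionState G m (n + 1) l m₂ := by
  refine ⟨h3, fun a h1 h2 h3 h4 => (hi a h4).trans (h.int a h1 h2 h3 h4),
    fun b hb => (hr b hb).trans (h.real b hb), fun e => ?_, h.nodup, ?_, fun i hil => ?_⟩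
  · rw [h.mem, Nat.lt_succ_iff_lt_or_eq]
    have := hn e
    tauto
  · rw [hi 3 (by omega), h.number]
  · rw [hi 4 (by omega), hi 5 (by omega)]
    exact h.entry i hil

theorem ends_select {e : Fin M} {l : List (Fin M)} {m₁ : Memory} (hM : m.int 0 1 = M)
    (hw : ∀ j : Fin M, m.real 1 j = G.weight j) (h : SelectionState G m e l m₁) :
    Ends select m₁ fun k m₂ => k ≤ 8 * M + 20 ∧ m₂.int 9 3 = e ∧
      ∃ l', SelectionState G m (e + 1) l' (m₂.setNat 9 3 (e + 1)) := by
  have e3 := h.counter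
  have e27 := h.int 27 (by omega) (by omega) (by omega) (by omega)
  refine ends_cond (fun hc => ends_skip ?_) fun hc => ?_
  · replace hc : m.int 27 e = 0 := by simpa [e3, e27] using hc
    refine ⟨by omega, e3, l, h.succ_of_not (fun a ha => ?_) (by simp [upd]) (fun b _ => rfl) ?_⟩
    · funext i
      simp [upd, ha]
    · rintro e' he' hsel
      obtain rfl : e' = e := Fin.ext he'
      exact hsel.1 hc
  · replace hc : m.int 27 e ≠ 0 := by simpa [e3, e27] using hc
    rw [Prog.block, Prog.block, Prog.block, Prog.block, Prog.block, Prog.block]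
    refine ends_seq (ends_setReal (ends_seq ?_))
    generalize hm₂ : Memory.setReal m₁ _ _ _ = m₂
    have f6 : m₂.real 6 0 = 0 := by simp [← hm₂, upd]
    have fr : ∀ b, b ≠ 6 → m₂.real b = m.real b := by
      intro b hb
      rw [← h.real b hb]
      funext i
      simp [← hm₂, upd, hb]
    have fi : m₂.int = m₁.int := by simp [← hm₂]
    clear hm₂
    have e0 := h.int 0 (by omega) (by omega) (by omega) (by omega)
    refine (ends_lower (G := G) (e := e) (by rw [fi, e3]) (by rw [fi, e0, hM])
      (by rw [fr 1 (by omega)]; exact hw) f6).mono ?_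
    rintro k₃ m₃ ⟨g1, g2, g3, g4, g5, g6, g7⟩
    rw [fi, e27, fr 5 (by omega)] at g5 g6
    refine ends_seq (ends_setNat (ends_seq ?_))
    generalize hm₄ : Memory.setNat m₃ _ _ _ = m₄
    have i9 : ∀ i, m₄.int 9 i = if i = 5 then 1 else m₃.int 9 i := by
      intro i
      simp [← hm₄, upd]
    have ioff : ∀ a, a ≠ 9 → m₄.int a = m₁.int a := by
      intro a ha
      rw [← fi, ← g1 a ha]
      funext i
      simp [← hm₄, upd, ha]
    have ir : m₄.real = m₃.real := by simp [← hm₄]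
    clear hm₄
    refine (ends_exclude (G := G) (e := e) (by rw [i9, if_neg (by omega), g2 3 (by omega), fi, e3])
      (by rw [ioff 0 (by omega), e0, hM])
      (by rw [ir, g3 1 (by omega), fr 1 (by omega)]; exact hw) (by simp [i9])).mono ?_
    rintro k₅ m₅ ⟨j1, j2, j3, j4, j5⟩
    rw [ioff 27 (by omega), e27, ir, g3 5 (by omega), fr 5 (by omega),
      ← Instance.selected_iff (G := G) (feas := fun e => m.int 27 e ≠ 0)
        (val := fun e => m.real 5 e) hc g4 g5 g6] at j4
    have n3 : m₅.int 9 3 = e := by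
      rw [j2 3 (by omega) (by omega), i9, if_neg (by omega), g2 3 (by omega), fi, e3]
    have noff : ∀ a, a ≠ 9 → m₅.int a = m₁.int a := fun a ha => (j1 a ha).trans (ioff a ha)
    have nr : ∀ b, b ≠ 6 → m₅.real b = m₁.real b := fun b hb => by
      rw [j3, ir, g3 b hb, fr b hb, h.real b hb]
    refine ends_seq (ends_cond (fun hd => ends_skip (ends_skip ?_)) fun hd => ?_)
    · replace hd : ¬ m₅.int 9 5 ≠ 0 := by simpa using hd
      refine ⟨by omega, n3, l, h.succ_of_not (fun a ha => ?_) (by simp [upd]) (fun b hb => nr b hb)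
        ?_⟩
      · funext i
        simp [upd, ha, noff]
      · rintro e' he'
        obtain rfl : e' = e := Fin.ext he'
        rwa [← j4]
    · replace hd : m₅.int 9 5 ≠ 0 := by simpa using hd
      have n0 : m₅.int 3 0 = l.length := by rw [noff 3 (by omega), h.number]
      have n28 := noff 28 (by omega)
      have n29 := noff 29 (by omega)
      have e28 := h.int 28 (by omega) (by omega) (by omega) (by omega)
      have e29 := h.int 29 (by omega) (by omega) (by omega) (by omega)
      simp only [emit, Prog.block, ends_seq_iff, ends_setNat_iff, ends_skip_iff]
      refine ⟨by omega, by simp [upd, n3], l ++ [e], by simp [upd], fun a h3 h4 h5 h9 => ?_,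
        fun b hb => ?_, fun e' => ?_, ?_, ?_, fun i hi => ?_⟩
      · rw [← h.int a h3 h4 h5 h9, ← noff a h9]
        funext i
        simp [upd, h3, h4, h5, h9]
      · rw [← h.real b hb, ← nr b hb]
        rfl
      · rw [List.mem_append, h.mem, List.mem_singleton, Nat.lt_succ_iff_lt_or_eq]
        have hsel := j4.1 hd
        constructor
        · rintro (⟨h1, h2⟩ | rfl)
          · exact ⟨h1, Or.inl h2⟩
          · exact ⟨hsel, Or.inr rfl⟩
        · rintro ⟨h1, h2 | h2⟩
          · exact Or.inl ⟨h1, h2⟩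
          · exact Or.inr (Fin.ext h2)
      · rw [List.nodup_append]
        refine ⟨h.nodup, List.nodup_singleton _, fun a ha b hb => ?_⟩
        rintro rfl
        have := ((h.mem a).1 ha).2
        rw [List.mem_singleton.1 hb] at this
        exact lt_irrefl _ this
      · simp [upd, n0]
      · rw [List.length_append, List.length_singleton] at hi
        rcases (Nat.lt_succ_iff.1 hi).lt_or_eq with hlt | rfl
        · rw [List.getElem_append_left hlt, ← (h.entry i hlt).1, ← (h.entry i hlt).2]
          simp [upd, n0, hlt.ne, noff]
        · rw [List.getElem_concat_length rfl]
          simp [upd, n0, n3, n28, n29, e28, e29]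

theorem ends_selection (hM : m.int 0 1 = M) (hw : ∀ j : Fin M, m.real 1 j = G.weight j)
    (h3 : m.int 3 0 = 0) :
    Ends selection m fun k m' => (∃ l, SelectionState G m M l m') ∧
      k ≤ M * (8 * M + 22) + 2 := by
  refine ends_count (n := M) (c := 8 * M + 20) (fun n m' => ∃ l, SelectionState G m n l m') ?_ ?_ ?_
  · rintro i m' ⟨l, h⟩
    refine ⟨h.counter, ?_⟩
    simp [h.int 0 (by omega) (by omega) (by omega) (by omega), hM]
  · refine ⟨[], by simp [upd], fun a _ _ _ ha => ?_, fun b _ => rfl, by simp, by simp,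
      by simp [upd, h3], by simp⟩
    funext i
    simp [upd, ha]
  · rintro i m' hi ⟨l, h⟩
    exact ends_select (e := ⟨i, hi⟩) hM hw h

end

/-! ## The algorithm as a whole -/

/-- Two steps along the Fibonacci sequence at least double its value. -/
theorem two_pow_le_fib (r : ℕ) : 2 ^ (r / 2) ≤ Nat.fib (r + 1) := by
  induction r using Nat.twoStepInduction with
  | zero => simp
  | one => simp
  | more n ih _ =>
    have h1 : Nat.fib (n + 3) = Nat.fib (n + 1) + Nat.fib (n + 2) := Nat.fib_add_two
    have h2 : Nat.fib (n + 1) ≤ Nat.fib (n + 2) := Nat.fib_le_fib_succ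
    rw [show (n + 2) / 2 = n / 2 + 1 by omega, pow_succ]
    change _ ≤ Nat.fib (n + 3)
    omega

theorem le_log_of_fib_le {r b : ℕ} (h : Nat.fib (r + 1) ≤ b) : r ≤ 2 * Nat.log 2 b + 1 := by
  have h1 := (two_pow_le_fib r).trans h
  have h2 : r / 2 ≤ Nat.log 2 b := Nat.le_log_of_pow_le (by norm_num) h1
  omega

/-- The integer logarithm of `2M + 2 ≤ 4M` is at most two above that of `M`, and `2 / log 2 < 3`. -/
theorem log_le_three_mul_log {M : ℕ} (hM : 0 < M) :
    (2 * Nat.log 2 (2 * M + 2) + 2 : ℝ) ≤ 6 + 3 * Real.log M := by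
  have h4 : 2 * M + 2 ≤ M * 2 ^ 2 := by omega
  have h1 : Nat.log 2 (2 * M + 2) ≤ Nat.log 2 M + 2 := by
    refine (Nat.log_mono_right h4).trans ?_
    rw [pow_two, ← mul_assoc, Nat.log_mul_base (by norm_num) (by omega),
      Nat.log_mul_base (by norm_num) (by omega)]
  have h2 : (2 : ℝ) ^ Nat.log 2 M ≤ M := by
    exact_mod_cast Nat.pow_log_le_self 2 hM.ne'
  have h3 : (Nat.log 2 M : ℝ) * Real.log 2 ≤ Real.log M := by
    rw [← Real.log_pow]
    exact Real.log_le_log (by positivity) h2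
  have h5 := Real.log_two_gt_d9
  have h6 : (Nat.log 2 (2 * M + 2) : ℝ) ≤ Nat.log 2 M + 2 := by exact_mod_cast h1
  have h7 : (0 : ℝ) ≤ Nat.log 2 M := Nat.cast_nonneg _
  nlinarith

/-- This replaces `log M`, which comes from the ranks of the heap, by `log N`. If `M ≤ N²`, then
`log M ≤ 2 log N`. Otherwise `N < √M` and `log M ≤ 2 √M`, so that the product is at most `2 M`. -/
theorem mul_log_le {N M : ℕ} (hN : 0 < N) (hM : 0 < M) :
    (N : ℝ) * Real.log M ≤ 2 * (M + N * Real.log N) := by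
  have hN1 : (1 : ℝ) ≤ N := by exact_mod_cast hN
  have hM1 : (1 : ℝ) ≤ M := by exact_mod_cast hM
  have hlog := Real.log_nonneg hN1
  by_cases h : (M : ℝ) ≤ (N : ℝ) ^ 2
  · have h1 : Real.log M ≤ 2 * Real.log N := by
      have := Real.log_le_log (by linarith) h
      rwa [Real.log_pow, Nat.cast_ofNat] at this
    nlinarith
  · have h1 : (N : ℝ) ≤ Real.sqrt M := Real.le_sqrt_of_sq_le (not_le.1 h).le
    have h2 : Real.log M ≤ 2 * Real.sqrt M := by
      have := Real.log_le_self (Real.sqrt_nonneg (M : ℝ))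
      rw [Real.log_sqrt (by linarith)] at this
      linarith
    have h3 := Real.mul_self_sqrt (show (0 : ℝ) ≤ M by linarith)
    have h4 := Real.log_nonneg hM1
    nlinarith [Real.sqrt_nonneg (M : ℝ), mul_nonneg (show (0 : ℝ) ≤ N by linarith) hlog]

/-- For `N ≥ 2` this is `log 2 > 1/2`; a single node is covered by `M ≥ 1`. -/
theorem le_add_mul_log {N M : ℕ} (hM : 0 < M) :
    (N : ℝ) ≤ 2 * (M + N * Real.log N) := by
  have hM1 : (1 : ℝ) ≤ M := by exact_mod_cast hM
  rcases Nat.lt_or_ge N 2 with h | h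
  · have : (N : ℝ) ≤ 1 := by exact_mod_cast Nat.lt_succ_iff.1 h
    have := mul_nonneg (Nat.cast_nonneg (α := ℝ) N) (Real.log_natCast_nonneg N)
    linarith
  · have h1 : (2 : ℝ) ≤ N := by exact_mod_cast h
    have h2 := Real.log_le_log (by norm_num) h1
    have h3 := Real.log_two_gt_d9
    nlinarith

theorem time_le {N M K k : ℕ} (hN : 0 < N) (hM : 0 < M) (hK : K ≤ 2 * M)
    (hk : k ≤ (6 * N + 19 * M + 8) + ((M * (200 * K +
      330 * ((2 * Nat.log 2 (2 * M + 2) + 1 + 1) * (N + 1)) + 5 * N + 922) + 2) +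
      (M * (8 * M + 22) + 2))) :
    (k : ℝ) ≤ 14000 * ((M : ℝ) ^ 2 + N * M * Real.log N) := by
  have h1 := log_le_three_mul_log hM
  have h2 := mul_log_le hN hM
  have h3 := le_add_mul_log (N := N) hM
  have hM1 : (1 : ℝ) ≤ M := by exact_mod_cast hM
  have hN1 : (1 : ℝ) ≤ N := by exact_mod_cast hN
  have hK' : (K : ℝ) ≤ 2 * M := by exact_mod_cast hK
  have hlog : 0 ≤ (N : ℝ) * Real.log N :=
    mul_nonneg (Nat.cast_nonneg _) (Real.log_natCast_nonneg N)
  have hk' : (k : ℝ) ≤ (6 * N + 19 * M + 8) + ((M * (200 * K +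
      330 * ((2 * Nat.log 2 (2 * M + 2) + 1 + 1) * (N + 1)) + 5 * N + 922) + 2) +
      (M * (8 * M + 22) + 2)) := by exact_mod_cast hk
  set Y : ℝ := M + N * Real.log N with hY
  -- From `N + 1 ≤ 2 N` the product is at most `12 N + 6 N log M`, and both `N` and `N log M` are at
  -- most `2 Y`.
  have h4 : (2 * Nat.log 2 (2 * M + 2) + 2 : ℝ) * (N + 1) ≤ 36 * Y := by
    have : (2 * Nat.log 2 (2 * M + 2) + 2 : ℝ) * (N + 1) ≤ (6 + 3 * Real.log M) * (2 * N) :=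
      mul_le_mul h1 (by linarith) (by positivity)
        (by linarith [Real.log_natCast_nonneg M])
    linarith
  have h5 : (6 * N + 19 * M + 12 : ℝ) ≤ M * (6 * N + 19 * M + 12) :=
    le_mul_of_one_le_left (by positivity) hM1
  -- The heap contributes `330 · 36 = 11880`; the other summands add less than `1500`.
  have h6 : (200 * K + 330 * ((2 * Nat.log 2 (2 * M + 2) + 2) * (N + 1)) + 5 * N + 922 +
      (8 * M + 22) + (6 * N + 19 * M + 12) : ℝ) ≤ 14000 * Y := by
    linarith
  have h7 := mul_le_mul_of_nonneg_left h6 (show (0 : ℝ) ≤ M by linarith)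
  have h8 : (M : ℝ) ^ 2 + N * M * Real.log N = M * Y := by
    rw [hY]
    ring
  rw [h8]
  linarith

open MainProg

/-- All feasible paths are stored in array `6`, but the output refers only to those of the selected
edges. Injectivity of `path` on these makes the listed paths distinct. -/
theorem ends_main {N M : ℕ} {G : Instance N M} (hM : 0 < M) (hne : G.paths.Nonempty) :
    Ends main G.input fun k m => (k : ℝ) ≤ 14000 * ((M : ℝ) ^ 2 + N * M * Real.log N) ∧
      ∃ S : Finset (List (Fin M)), m.Outputs S ∧ G.IsSolution S ∧ S.card ≤ M := by
  classical
  refine ends_seq ((ends_setup G).mono ?_)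
  rintro k₁ m₁ ⟨⟨K, hK, hD⟩, hH, hst, hout, hk₁⟩
  have hfib : ∀ r, Nat.fib (r + 1) ≤ K + 2 → r ≤ 2 * Nat.log 2 (2 * M + 2) + 1 := fun r hr =>
    le_log_of_fib_le (hr.trans (by omega))
  refine ends_seq ((ends_searches hfib ⟨hD, hH, fun u => (hst u).le, hout,
    fun e he => absurd he (Nat.not_lt_zero _)⟩).mono ?_)
  rintro k₂ m₂ ⟨hS, hk₂⟩
  refine (ends_selection hS.data.edges hS.data.weight hS.output).mono ?_
  rintro k₃ m₃ ⟨⟨l, hl⟩, hk₃⟩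
  refine ⟨time_le (Fin.pos G.source) hM hK (by omega), ?_⟩
  choose path hpath using fun e : Fin M => hS.recorded e e.2
  obtain ⟨hinj, hsol⟩ := Instance.isSolution_image_selected (G := G)
    (feas := fun e => m₂.int 27 e ≠ 0) (val := fun e => m₂.real 5 e) (path := path)
    (fun e he => (hpath e).feasible he) (fun e => (hpath e).min) hne hM
  have hmem : ∀ e, e ∈ l ↔ G.Selected (fun e => m₂.int 27 e ≠ 0) (fun e => m₂.real 5 e) e :=
    fun e => by simp [hl.mem]
  refine ⟨_, ⟨l.map path, ?_, ?_, ?_⟩, hsol, ?_⟩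
  · exact hl.nodup.map_on fun a ha b hb he => hinj ((hmem a).1 ha) ((hmem b).1 hb) he
  · ext P
    simp [hmem]
  · refine List.ext_getElem (by simp [Memory.output, hl.number]) fun i hi hi' => ?_
    have hil : i < l.length := by simpa using hi'
    have hf : m₂.int 27 l[i] ≠ 0 := ((hmem _).1 (List.getElem_mem hil)).1
    obtain ⟨e4, e5⟩ := hl.entry i hil
    simp only [Memory.output, List.getElem_map, List.getElem_range, e4, e5,
      (hpath _).length hf, hl.int 6 (by omega) (by omega) (by omega) (by omega)]
    -- In `Memory.Outputs` the list of edges is elaborated as a coercion through the list monad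
    -- followed by an identity map; this agrees with the entrywise coercion.
    have hcast : (do let a ← path l[i]; pure (a : ℕ)) =
        List.map (fun e : Fin M => (e : ℕ)) (path l[i]) := List.flatMap_pure_eq_map _ _
    rw [List.map_id', hcast]
    refine List.ext_getElem (by simp) fun j hj hj' => ?_
    have hjl : j < (path l[i]).length := by simpa using hj'
    simp only [List.getElem_map, List.getElem_range]
    exact (hpath _).entry hf j hjl
  · exact (Finset.card_image_le.trans (Finset.card_filter_le _ _)).trans (by simp)

end RobustSP

theorem mainTheorem8 :
    (∃ (prog : RobustSP.Prog) (C : ℝ),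
      ∀ (N M : ℕ) (G : RobustSP.Instance N M), 0 < M → G.paths.Nonempty →
        ∃ (k : ℕ) (m : RobustSP.Memory) (S : Finset (List (Fin M))),
          RobustSP.Runs prog G.input k m ∧
          (k : ℝ) ≤ C * ((M : ℝ) ^ 2 + (N : ℝ) * (M : ℝ) * Real.log (N : ℝ)) ∧
          m.Outputs S ∧
          G.IsSolution S ∧
          S.card ≤ M) ∧
    (∀ (N M : ℕ) (G : RobustSP.Instance N M), 0 < M →
      ∀ T : Finset (List (Fin M)), G.IsMaximalExtremeFamily T →
        T.card ≤ (Finset.univ.image G.weight).card) := by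
  refine ⟨⟨RobustSP.MainProg.main, 14000, fun N M G hM hne => ?_⟩,
    fun N M G hM T hT => G.card_le_of_isMaximalExtremeFamily hM hT⟩
  obtain ⟨k, m, hr, hk, S, hS⟩ := RobustSP.ends_main hM hne
  exact ⟨k, m, S, hr, hk, hS⟩
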